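/- Let $q$ be a prime power. A probability measure $\nu$ on $\mathbf{F}_q$ is called $\alpha$-balanced if $\nu(x+H)\le 1-\alpha$ for every $x\in\mathbf{F}_q$ and every proper additive subgroup $H<\mathbf{F}_q$. Let $\boldsymbol{\mu}=(\mu_{ij})_{1\le i,j\le n}$ be a matrix of $\alpha$-balanced probability measures on $\mathbf{F}_q$, and let $M\sim\mathrm{M}(\boldsymbol{\mu})$ mean that $M$ is a random $n\times n$ matrix over $\mathbf{F}_q$ with independent entries $M_{ij}\sim\mu_{ij}$. Let $X_1,\dots,X_n$ be the rows of $M$, so that $X_i\sim\mu_{i1}\otimes\cdots\otimes\mu_{in}$. For a subspace $V\le\mathbf{F}_q^n$ put \[ \rho(V)=\max_{1\le i\le n}\ \max_{x\in\mathbf{F}_q^n}\left|\mathbf{P}(X_i\in x+V)-q^{-\operatorname{codim}V}\right|. \] Given $\zeta,C,\alpha>0$ and an integer $m$, call $V$ sparse if there is a nonzero $v\in\mathbf{F}_q^n$ with $v\perp V$ (for the standard bilinear form) having at most $C\alpha^{-1}$ nonzero coordinates, and call $V$ saturated if $V$ is not sparse and \[ \rho(V)\le\exp\left(-\zeta(\alpha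 n/m)^{1/2}\right). \] Theorem. There is an absolute constant $\zeta_0>0$ such that for all $0<\zeta\le\zeta_0$ and all $C>0$ there is a constant $c>0$, depending only on $\zeta$ and $C$, such that for every $\alpha>0$ there is a constant $K>0$, depending only on $\zeta$, $C$ and $\alpha$, with the following property. Let $q$ be a prime power, let $n\ge 1$ and $m>1$ be integers with \[ m2^m\log n<c\alpha^2 n,\qquad \log q<\frac{c\alpha^2 n}{m2^m},\qquad q\ge\zeta^{-1/2}. \] Let $\boldsymbol{\mu}$ be an $n\times n$ matrix of $\alpha$-balanced probability measures on $\mathbf{F}_q$, and let $\lambda_1,\dots,\lambda_m\in\mathbf{F}_q$ be distinct. For $M\sim\mathrm{M}(\boldsymbol{\mu})$, let \[ R=\bigcap_{j=1}^m\operatorname{row}(M-\lambda_j), \] where $\operatorname{row}$ denotes the row space and $M-\lambda_j$ means $M-\lambda_jI$. Then \[ \mathbf{P}(R\text{ is saturated})\ \ge\ 1-K\exp\left(-\frac{c\alpha n}{m2^m}\right). \] -/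

import Mathlib

open MeasureTheory

/-- A measure `ν` on (the additive group of) `F` is `α`-balanced if every coset `x + H` of every
proper additive subgroup `H < F` has measure at most `1 - α`. -/
def IsBalanced {F : Type*} [Field F] [MeasurableSpace F] (α : ℝ) (ν : Measure F) : Prop :=
  ∀ (x : F) (H : AddSubgroup F), H ≠ ⊤ → ν.real {y | y - x ∈ H} ≤ 1 - α

/-- The law `μ_{i1} ⊗ ⋯ ⊗ μ_{in}` of the `i`-th row `X_i` of the random matrix. -/
noncomputable def rowLaw {F : Type*} [MeasurableSpace F] {n : ℕ}
    (μ : Fin n → Fin n → Measure F) (i : Fin n) : Measure (Fin n → F) :=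
  Measure.pi (μ i)

/-- The law of the random `n × n` matrix with independent entries `M i j ∼ μ i j`, as a product
measure on arrays of entries. -/
noncomputable def matrixLaw {F : Type*} [MeasurableSpace F] {n : ℕ}
    (μ : Fin n → Fin n → Measure F) : Measure (Fin n → Fin n → F) :=
  Measure.pi (fun i => rowLaw μ i)

/-- The row space of a square matrix. -/
def rowSpace {F : Type*} [Field F] {n : ℕ} (A : Matrix (Fin n) (Fin n) F) :
    Submodule F (Fin n → F) :=
  Submodule.span F (Set.range A.row)

/-- `R = ⋂ j, row (M - λ_j)`. -/
def rowInter {F : Type*} [Field F] {n m : ℕ} (lam : Fin m → F)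
    (M : Matrix (Fin n) (Fin n) F) : Submodule F (Fin n → F) :=
  ⨅ j : Fin m, rowSpace (M - lam j • (1 : Matrix (Fin n) (Fin n) F))

/-- The codimension of a subspace `V ≤ F ^ n`. -/
noncomputable def codim {F : Type*} [Field F] {n : ℕ} (V : Submodule F (Fin n → F)) : ℕ :=
  Module.finrank F ((Fin n → F) ⧸ V)

/-- `ρ_i(V) = max_x |P(X_i ∈ x + V) - 1 / q ^ codim V|`, where `q` is the size of `F`. The
supremum is a maximum, since `F ^ n` is finite. -/
noncomputable def rhoRow {F : Type*} [Field F] [Fintype F] [MeasurableSpace F] {n : ℕ}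
    (μ : Fin n → Fin n → Measure F) (i : Fin n) (V : Submodule F (Fin n → F)) : ℝ :=
  ⨆ x : Fin n → F, |(rowLaw μ i).real {y | y - x ∈ V} - 1 / (Fintype.card F : ℝ) ^ codim V|

/-- `ρ(V) = max_i ρ_i(V)`. -/
noncomputable def rho {F : Type*} [Field F] [Fintype F] [MeasurableSpace F] {n : ℕ}
    (μ : Fin n → Fin n → Measure F) (V : Submodule F (Fin n → F)) : ℝ :=
  ⨆ i : Fin n, rhoRow μ i V

/-- `V` is sparse, at threshold `s`, if some nonzero `v ⟂ V` has at most `s` nonzero entries. -/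
def IsSparse {F : Type*} [Field F] {n : ℕ} (s : ℝ) (V : Submodule F (Fin n → F)) : Prop :=
  ∃ v : Fin n → F, v ≠ 0 ∧ (∀ w ∈ V, v ⬝ᵥ w = 0) ∧ ((Function.support v).ncard : ℝ) ≤ s

/-- `V` is saturated if it is not sparse at threshold `C / α` and
`ρ(V) ≤ exp (-ζ (α n / m) ^ (1 / 2))`. -/
def IsSaturated {F : Type*} [Field F] [Fintype F] [MeasurableSpace F] {n : ℕ}
    (ζ C α : ℝ) (m : ℕ) (μ : Fin n → Fin n → Measure F) (V : Submodule F (Fin n → F)) : Prop :=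
  ¬ IsSparse (C / α) V ∧ rho μ V ≤ Real.exp (-ζ * Real.sqrt (α * n / m))

/-! Write y = ζ(αn/m)^(1/2), and k for the codimension of a possible value V of R. Up to raising the
sparsity constant, R is saturated unless it is sparse, or semisaturated (e^(-y) < ρ(V) ≤ q^(-k)), or
unsaturated (not sparse, with ρ(V) above both e^(-y) and q^(-k)). Each of the three events has its
own argument.

Sparse. The rows of ∏(M - λ_j) lie in R, so v ⊥ R forces ∏(M - λ_j)v = 0. The left side is a
polynomial of degree m in M. Applying Cauchy-Schwarz m times, on disjoint blocks of rows, replaces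
it by its polarized leading part, which vanishes with probability at most m(1-α)^⌊n/m⌋; the price is
a 2^m-th root (`expect_shiftProd_eq_zero_pow_le`). A union bound over sparse v follows.

Semisaturated. The complement of R is invariant under M. Fixing the k × k matrix of M on V^⊥ costs
q^(k²) and confines each row of M to a coset of V, of probability at most 2q^(-k). As ρ(V) > e^(-y),
Fourier inversion produces a nonzero u in V^⊥ of small defect `totalGap`. Such u have density at
most 2^(-9n), so there are few such V, and the union bound closes
(`expect_rowInter_mem_le_of_small_gap`).

Unsaturated. This is a swapping argument in the style of Kahn, Komlós and Szemerédi. Sublevel sets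
of the defect keep doubling until they contain a subgroup, and non-sparsity keeps subgroups of V^⊥
out of low sublevels. Hence a lazy random vector, whose Fourier transform is positive, hits V with
probability p ≥ 20000 ρ(V) (`rho_le_cosetProb_lazyWeight`). About n - r independent lazy vectors in
V, with at most mr rows of M, determine V; every other row then falls in a coset of V, of
probability at most p/10000. The sum over V is free because V is determined
(`expect_rowInter_mem_le_of_swap`). -/

set_option linter.unusedSectionVars false

/-! ### Finite product expectations and resampling. -/

section Expectation

/-- The real-valued indicator of a proposition. -/
noncomputable def ind (p : Prop) : ℝ := by
  classical exact if p then 1 else 0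

theorem ind_true {p : Prop} (h : p) : ind p = 1 := by simp [ind, h]

theorem ind_false {p : Prop} (h : ¬ p) : ind p = 0 := by simp [ind, h]

theorem ind_nonneg (p : Prop) : 0 ≤ ind p := by
  by_cases h : p
  · simp [ind_true h]
  · simp [ind_false h]

theorem ind_le_one (p : Prop) : ind p ≤ 1 := by
  by_cases h : p
  · simp [ind_true h]
  · simp [ind_false h]

theorem ind_mono {p q : Prop} (h : p → q) : ind p ≤ ind q := by
  by_cases hp : p
  · rw [ind_true hp, ind_true (h hp)]
  · rw [ind_false hp]; exact ind_nonneg q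

theorem ind_and (p q : Prop) : ind (p ∧ q) = ind p * ind q := by
  by_cases hp : p
  · by_cases hq : q
    · simp [ind_true hp, ind_true hq, ind_true (And.intro hp hq)]
    · simp [ind_false hq, ind_false (fun h : p ∧ q => hq h.2)]
  · simp [ind_false hp, ind_false (fun h : p ∧ q => hp h.1)]

theorem ind_or_le (p q : Prop) : ind (p ∨ q) ≤ ind p + ind q := by
  by_cases hp : p
  · rw [ind_true hp]; linarith [ind_nonneg q, ind_le_one (p ∨ q)]
  · by_cases hq : q
    · rw [ind_true hq]; linarith [ind_nonneg p, ind_le_one (p ∨ q)]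
    · rw [ind_false (by tauto)]; linarith [ind_nonneg p, ind_nonneg q]

theorem ind_forall {ι : Type*} (s : Finset ι) (p : ι → Prop) :
    ind (∀ i ∈ s, p i) = ∏ i ∈ s, ind (p i) := by
  by_cases h : ∀ i ∈ s, p i
  · rw [ind_true h, Finset.prod_eq_one (fun i hi => ind_true (h i hi))]
  · rw [ind_false h]
    push Not at h
    obtain ⟨i, hi, hp⟩ := h
    exact (Finset.prod_eq_zero hi (ind_false hp)).symm

theorem ind_exists_le {ι : Type*} (s : Finset ι) (p : ι → Prop) :
    ind (∃ i ∈ s, p i) ≤ ∑ i ∈ s, ind (p i) := by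
  by_cases h : ∃ i ∈ s, p i
  · obtain ⟨i, hi, hp⟩ := h
    calc ind (∃ i ∈ s, p i) ≤ 1 := ind_le_one _
      _ = ind (p i) := (ind_true hp).symm
      _ ≤ _ := Finset.single_le_sum (f := fun i => ind (p i)) (fun i _ => ind_nonneg _) hi
  · rw [ind_false h]; exact Finset.sum_nonneg (fun i _ => ind_nonneg _)

/-- A finitely supported probability weight. -/
def IsWeight {R : Type*} [Fintype R] (w : R → ℝ) : Prop := (∀ a, 0 ≤ w a) ∧ ∑ a, w a = 1

/-- The expectation of `φ` for independent coordinates `x i` with weights `W i`. -/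
noncomputable def expect {κ R : Type*} [Fintype κ] [DecidableEq κ] [Fintype R]
    (W : κ → R → ℝ) (φ : (κ → R) → ℝ) : ℝ :=
  ∑ x : κ → R, (∏ i, W i (x i)) * φ x

/-- The weight of a point under the product of the weights `w j`. -/
def prodWeight {κ R : Type*} [Fintype κ] (w : κ → R → ℝ) (x : κ → R) : ℝ := ∏ i, w i (x i)

variable {κ R : Type*} [Fintype κ] [DecidableEq κ] [Fintype R]

theorem expect_prod (W : κ → R → ℝ) (a : κ → R → ℝ) :
    expect W (fun x => ∏ i, a i (x i)) = ∏ i, ∑ r, W i r * a i r := by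
  rw [Finset.prod_univ_sum, Fintype.piFinset_univ]
  exact Finset.sum_congr rfl fun x _ => Finset.prod_mul_distrib.symm

theorem isWeight_prodWeight {w : κ → R → ℝ} (hw : ∀ i, IsWeight (w i)) :
    IsWeight (prodWeight w) := by
  refine ⟨fun x => Finset.prod_nonneg fun i _ => (hw i).1 _, ?_⟩
  have := expect_prod w (fun _ _ => 1)
  simpa [expect, prodWeight, (hw _).2] using this

theorem expect_const {W : κ → R → ℝ} (hW : ∀ i, IsWeight (W i)) (c : ℝ) :
    expect W (fun _ => c) = c := by
  have := (isWeight_prodWeight hW).2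
  unfold expect
  rw [← Finset.sum_mul]
  simp only [prodWeight] at this
  rw [this, one_mul]

theorem expect_mono {W : κ → R → ℝ} (hW : ∀ i, IsWeight (W i)) {φ ψ : (κ → R) → ℝ}
    (h : ∀ x, φ x ≤ ψ x) : expect W φ ≤ expect W ψ :=
  Finset.sum_le_sum fun x _ =>
    mul_le_mul_of_nonneg_left (h x) ((isWeight_prodWeight hW).1 x)

theorem expect_nonneg {W : κ → R → ℝ} (hW : ∀ i, IsWeight (W i)) {φ : (κ → R) → ℝ}
    (h : ∀ x, 0 ≤ φ x) : 0 ≤ expect W φ := by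
  have := expect_mono hW h
  rwa [expect_const hW] at this

theorem expect_le_of_le {W : κ → R → ℝ} (hW : ∀ i, IsWeight (W i)) {φ : (κ → R) → ℝ} {c : ℝ}
    (h : ∀ x, φ x ≤ c) : expect W φ ≤ c := by
  have := expect_mono hW h
  rwa [expect_const hW] at this

theorem expect_mul_left (W : κ → R → ℝ) (c : ℝ) (φ : (κ → R) → ℝ) :
    expect W (fun x => c * φ x) = c * expect W φ := by
  unfold expect
  rw [Finset.mul_sum]
  exact Finset.sum_congr rfl fun x _ => by ring

theorem expect_mul_right (W : κ → R → ℝ) (c : ℝ) (φ : (κ → R) → ℝ) :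
    expect W (fun x => φ x * c) = expect W φ * c := by
  unfold expect
  rw [Finset.sum_mul]
  exact Finset.sum_congr rfl fun x _ => by ring

theorem expect_add (W : κ → R → ℝ) (φ ψ : (κ → R) → ℝ) :
    expect W (fun x => φ x + ψ x) = expect W φ + expect W ψ := by
  unfold expect
  rw [← Finset.sum_add_distrib]
  exact Finset.sum_congr rfl fun x _ => by ring

theorem expect_sum {ι : Type*} (s : Finset ι) (W : κ → R → ℝ) (φ : ι → (κ → R) → ℝ) :
    expect W (fun x => ∑ i ∈ s, φ i x) = ∑ i ∈ s, expect W (φ i) := by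
  unfold expect
  rw [Finset.sum_comm]
  exact Finset.sum_congr rfl fun x _ => by rw [Finset.mul_sum]

theorem expect_comm {κ' R' : Type*} [Fintype κ'] [DecidableEq κ'] [Fintype R']
    (W : κ → R → ℝ) (W' : κ' → R' → ℝ) (φ : (κ → R) → (κ' → R') → ℝ) :
    expect W (fun x => expect W' (fun y => φ x y)) =
      expect W' (fun y => expect W (fun x => φ x y)) := by
  unfold expect
  simp only [Finset.mul_sum]
  rw [Finset.sum_comm]
  exact Finset.sum_congr rfl fun x _ => Finset.sum_congr rfl fun y _ => by ring

/-- Resampling the coordinates in `T` does not change an expectation. -/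
theorem expect_resample {W : κ → R → ℝ} (hW : ∀ i, IsWeight (W i)) (T : Finset κ)
    (φ : (κ → R) → ℝ) :
    expect W (fun x => expect W (fun x' => φ (T.piecewise x' x))) = expect W φ := by
  have key : expect W (fun x => expect W (fun x' => φ (T.piecewise x' x))) =
      expect W (fun x => expect W (fun _ => φ x)) := by
    unfold expect
    simp only [Finset.mul_sum]
    rw [← Finset.sum_product', ← Finset.sum_product']
    -- Exchanging the `T`-coordinates of `x` and `x'` is a weight-preserving involution on pairs.
    refine Finset.sum_nbij' (fun p => (T.piecewise p.2 p.1, T.piecewise p.1 p.2))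
      (fun p => (T.piecewise p.2 p.1, T.piecewise p.1 p.2)) ?_ ?_ ?_ ?_ ?_
    · simp
    · simp
    · intro p _; ext i <;> by_cases hi : i ∈ T <;> simp [hi]
    · intro p _; ext i <;> by_cases hi : i ∈ T <;> simp [hi]
    · intro p _
      have : (∏ i, W i (p.1 i)) * ∏ i, W i (p.2 i) =
          (∏ i, W i (T.piecewise p.2 p.1 i)) * ∏ i, W i (T.piecewise p.1 p.2 i) := by
        rw [← Finset.prod_mul_distrib, ← Finset.prod_mul_distrib]
        refine Finset.prod_congr rfl fun i _ => ?_
        by_cases hi : i ∈ T <;> simp [hi, mul_comm]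
      dsimp only
      rw [← mul_assoc, this, ← mul_assoc]
  rw [key]
  congr 1
  ext x
  exact expect_const hW _

theorem sq_expect_le {W : κ → R → ℝ} (hW : ∀ i, IsWeight (W i)) (φ : (κ → R) → ℝ) :
    expect W φ ^ 2 ≤ expect W (fun x => φ x ^ 2) := by
  have h : 0 ≤ expect W (fun x => (φ x - expect W φ) ^ 2) := expect_nonneg hW fun x => sq_nonneg _
  have h2 : expect W (fun x => (φ x - expect W φ) ^ 2) =
      expect W (fun x => φ x ^ 2) + (expect W (fun x => (-2 * expect W φ) * φ x)
        + expect W (fun _ => expect W φ ^ 2)) := by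
    rw [← expect_add, ← expect_add]
    congr 1; ext x; ring
  rw [h2, expect_mul_left, expect_const hW] at h
  nlinarith

theorem expect_ind_forall (W : κ → R → ℝ) (hW : ∀ i, IsWeight (W i)) (T : Finset κ)
    (p : κ → R → Prop) :
    expect W (fun x => ind (∀ i ∈ T, p i (x i))) = ∏ i ∈ T, ∑ r, W i r * ind (p i r) := by
  have h := expect_prod W (fun i r => if i ∈ T then ind (p i r) else 1)
  have h1 : ∀ x : κ → R, (∏ i, if i ∈ T then ind (p i (x i)) else 1) =
      ind (∀ i ∈ T, p i (x i)) := by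
    intro x
    rw [ind_forall, Finset.prod_ite_mem]; simp
  simp only [h1] at h
  rw [h]
  have : ∀ i, (∑ r, W i r * if i ∈ T then ind (p i r) else 1) =
      if i ∈ T then ∑ r, W i r * ind (p i r) else 1 := by
    intro i; by_cases hi : i ∈ T <;> simp [hi, (hW i).2]
  simp only [this, Finset.prod_ite_mem, Finset.univ_inter]

theorem expect_ind_le_one {W : κ → R → ℝ} (hW : ∀ i, IsWeight (W i)) (p : (κ → R) → Prop) :
    expect W (fun x => ind (p x)) ≤ 1 :=
  expect_le_of_le hW fun _ => ind_le_one _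

theorem expect_ind_forall_le {W : κ → R → ℝ} (hW : ∀ i, IsWeight (W i)) (T : Finset κ)
    (p : κ → R → Prop) {B : ℝ} (hB : ∀ i ∈ T, ∑ r, W i r * ind (p i r) ≤ B) :
    expect W (fun x => ind (∀ i ∈ T, p i (x i))) ≤ B ^ T.card := by
  rw [expect_ind_forall W hW]
  refine (Finset.prod_le_prod (fun i _ => ?_) hB).trans (by simp)
  exact Finset.sum_nonneg fun r _ => mul_nonneg ((hW i).1 r) (ind_nonneg _)

/-- Resampling one coordinate does not change an expectation. -/
theorem expect_update {W : κ → R → ℝ} (hW : ∀ i, IsWeight (W i)) (j : κ) (φ : (κ → R) → ℝ) :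
    expect W (fun x => ∑ a, W j a * φ (Function.update x j a)) = expect W φ := by
  rw [← expect_resample hW {j} φ]
  congr 1; ext x
  have h := fun a => expect_ind_forall W hW {j} (fun _ r => r = a)
  have h2 : ∀ x' : κ → R, φ (Finset.piecewise {j} x' x) =
      ∑ a, φ (Function.update x j a) * ind (∀ i ∈ ({j} : Finset κ), x' i = a) := by
    intro x'
    rw [Finset.sum_eq_single (x' j)]
    · rw [ind_true (by simp), mul_one, Finset.piecewise_singleton]
    · intro b _ hb
      rw [ind_false (by simpa using hb.symm), mul_zero]
    · simp
  simp only [h2]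
  rw [expect_sum]
  refine Finset.sum_congr rfl fun a _ => ?_
  rw [expect_mul_left, h, Finset.prod_singleton, Finset.sum_eq_single a]
  · rw [ind_true rfl]; ring
  · intro b _ hb; rw [ind_false hb, mul_zero]
  · simp

end Expectation

/-! ### Odlyzko's bound for subspaces and its consequence for independent samples. -/

section Odlyzko

variable {F : Type*} [Field F] {n : ℕ}

theorem codim_add_finrank (V : Submodule F (Fin n → F)) :
    codim V + Module.finrank F V = n := by
  have := V.finrank_quotient_add_finrank
  simpa [codim] using this

variable [Fintype F]

/-- The probability that a random vector with independent coordinates lies in `x + V`. -/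
noncomputable def cosetProb (w : Fin n → F → ℝ) (x : Fin n → F)
    (V : Submodule F (Fin n → F)) : ℝ :=
  expect w (fun y => ind (y - x ∈ V))

theorem cosetProb_nonneg {w : Fin n → F → ℝ} (hw : ∀ j, IsWeight (w j)) (x : Fin n → F)
    (V : Submodule F (Fin n → F)) : 0 ≤ cosetProb w x V :=
  expect_nonneg hw fun _ => ind_nonneg _

/-- If `U` is proper, some basis vector e_j is not in `U`. Given the other coordinates, at most one
value of coordinate j puts the vector in the coset of `U`, which costs a factor `1 - β`; what
remains is membership in a coset of U + ⟨e_j⟩, of codimension one less. -/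
theorem cosetProb_le_pow_codim {w : Fin n → F → ℝ} (hw : ∀ j, IsWeight (w j)) {β : ℝ}
    (hβ : ∀ j a, w j a ≤ 1 - β) (x : Fin n → F) (U : Submodule F (Fin n → F)) :
    cosetProb w x U ≤ (1 - β) ^ codim U := by
  induction hd : codim U generalizing U with
  | zero => rw [pow_zero]; exact expect_ind_le_one hw _
  | succ d ih =>
    classical
    have hU : ∃ j, (Pi.single j (1 : F) : Fin n → F) ∉ U := by
      by_contra! h
      have : U = ⊤ := by
        rw [eq_top_iff]
        intro y _
        rw [pi_eq_sum_univ' y]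
        refine U.sum_mem fun j _ => U.smul_mem _ ?_
        have := h j
        convert this using 1
      subst this
      have := codim_add_finrank (⊤ : Submodule F (Fin n → F))
      simp at this
      omega
    obtain ⟨j, hj⟩ := hU
    set e : Fin n → F := Pi.single j 1 with he
    have hcod : codim (U ⊔ Submodule.span F {e}) = d := by
      have h1 := codim_add_finrank U
      have h2 := codim_add_finrank (U ⊔ Submodule.span F {e})
      have h3 : Module.finrank F ↥(U ⊔ Submodule.span F {e}) = Module.finrank F U + 1 := by
        have he0 : e ≠ 0 := fun h => hj (h ▸ U.zero_mem)
        have h4 := Submodule.finrank_sup_add_finrank_inf_eq U (Submodule.span F {e})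
        have h5 : U ⊓ Submodule.span F {e} = ⊥ := by
          rw [eq_bot_iff]
          rintro y ⟨hy, hy2⟩
          obtain ⟨c, rfl⟩ := Submodule.mem_span_singleton.1 hy2
          by_cases hc : c = 0
          · simp [hc]
          · exact absurd ((U.smul_mem_iff hc).1 hy) hj
        rw [h5, finrank_span_singleton he0] at h4
        simpa using h4
      omega
    have hupd : ∀ (y : Fin n → F) (a : F), Function.update y j a = y + (a - y j) • e := by
      intro y a
      ext i
      by_cases hi : i = j
      · subst hi; simp [he]
      · simp [he, hi]
    have hβ0 : 0 ≤ 1 - β := ((hw j).1 0).trans (hβ j 0)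
    calc cosetProb w x U
        = expect w (fun y => ∑ a, w j a * ind (Function.update y j a - x ∈ U)) :=
          (expect_update hw j _).symm
      _ ≤ expect w (fun y => (1 - β) * ind (y - x ∈ U ⊔ Submodule.span F {e})) := by
          refine expect_mono hw fun y => ?_
          by_cases hy : ∃ a, Function.update y j a - x ∈ U
          · obtain ⟨a, ha⟩ := hy
            rw [ind_true, mul_one, Finset.sum_eq_single a]
            · rw [ind_true ha, mul_one]; exact hβ j a
            · intro b _ hb
              rw [ind_false, mul_zero]
              intro hbU
              apply hj
              have := U.sub_mem hbU ha
              rw [hupd, hupd] at this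
              have h6 : y + (b - y j) • e - x - (y + (a - y j) • e - x) = (b - a) • e := by
                module
              rw [h6] at this
              exact (U.smul_mem_iff (sub_ne_zero.2 hb)).1 this
            · simp
            · rw [hupd] at ha
              have h7 : y - x = (y + (a - y j) • e - x) + (-(a - y j)) • e := by module
              rw [h7]
              exact Submodule.add_mem_sup ha
                (Submodule.smul_mem _ _ (Submodule.mem_span_singleton_self e))
          · push Not at hy
            rw [Finset.sum_eq_zero]
            · exact mul_nonneg hβ0 (ind_nonneg _)
            · intro a _; rw [ind_false (hy a), mul_zero]
      _ = (1 - β) * cosetProb w x (U ⊔ Submodule.span F {e}) := expect_mul_left _ _ _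
      _ ≤ (1 - β) * (1 - β) ^ d := mul_le_mul_of_nonneg_left (ih _ hcod) hβ0
      _ = (1 - β) ^ (d + 1) := by ring

theorem expect_cons {R : Type*} [Fintype R] {L : ℕ} (W : Fin (L + 1) → R → ℝ)
    (φ : (Fin (L + 1) → R) → ℝ) :
    expect W φ = ∑ r, W 0 r * expect (fun i => W i.succ) (fun x => φ (Fin.cons r x)) := by
  unfold expect
  rw [← (Fin.consEquiv (fun _ => R)).sum_comp, Fintype.sum_prod_type]
  refine Finset.sum_congr rfl fun r _ => ?_
  rw [Finset.mul_sum]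
  refine Finset.sum_congr rfl fun x _ => ?_
  rw [Fin.prod_univ_succ]
  simp [Fin.consEquiv, mul_assoc]

/-- Independent copies of a random vector which hits `V` with probability `p` are linearly
independent elements of `V` with probability at least `(p / 2) ^ L`. -/
theorem pow_le_expect_linearIndependent {w : Fin n → F → ℝ} (hw : ∀ j, IsWeight (w j)) {β : ℝ}
    (hβ0 : 0 ≤ β) (hβ1 : β ≤ 1)
    (hβ : ∀ j a, w j a ≤ 1 - β) (V : Submodule F (Fin n → F)) {r : ℕ}
    (hr : (1 - β) ^ r ≤ cosetProb w 0 V / 2) (L : ℕ) (hL : L + r ≤ n) :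
    (cosetProb w 0 V / 2) ^ L ≤ expect (fun _ : Fin L => prodWeight w)
      (fun z => ind (LinearIndependent F z ∧ ∀ s, z s ∈ V)) := by
  have hW := isWeight_prodWeight hw
  have hp := cosetProb_nonneg hw 0 V
  induction L with
  | zero =>
    rw [pow_zero]
    have : ∀ z : Fin 0 → Fin n → F, ind (LinearIndependent F z ∧ ∀ s, z s ∈ V) = 1 :=
      fun z => ind_true ⟨linearIndependent_empty_type, fun s => s.elim0⟩
    simp only [this]
    rw [expect_const (fun _ => hW)]
  | succ L ih =>
    rw [expect_cons]
    have hexp : ∑ r, prodWeight w r * expect (fun _ : Fin L => prodWeight w)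
        (fun z => ind (LinearIndependent F (Fin.cons r z : Fin (L + 1) → Fin n → F) ∧
          ∀ s, (Fin.cons r z : Fin (L + 1) → Fin n → F) s ∈ V)) =
        expect (fun _ : Fin L => prodWeight w) (fun z => expect w (fun r =>
          ind (LinearIndependent F (Fin.cons r z : Fin (L + 1) → Fin n → F) ∧
          ∀ s, (Fin.cons r z : Fin (L + 1) → Fin n → F) s ∈ V))) := by
      rw [expect_comm]; rfl
    rw [hexp, pow_succ]
    refine (mul_le_mul_of_nonneg_right (ih (by omega)) (by positivity)).trans ?_
    rw [← expect_mul_right]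
    refine expect_mono (fun _ => hW) fun z => ?_
    by_cases hz : LinearIndependent F z ∧ ∀ s, z s ∈ V
    swap
    · rw [ind_false hz, zero_mul]
      exact expect_nonneg hw fun _ => ind_nonneg _
    rw [ind_true hz, one_mul]
    set U := Submodule.span F (Set.range z) with hU
    have hcod : r ≤ codim U := by
      have h1 := codim_add_finrank U
      have h2 : Module.finrank F U = L := by
        rw [hU, finrank_span_eq_card hz.1, Fintype.card_fin]
      omega
    -- The span of the earlier vectors absorbs at most half of the probability of `V`, so a new
    -- vector lands in `V` outside that span with probability at least half of it.
    have hUp : cosetProb w 0 U ≤ cosetProb w 0 V / 2 :=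
      ((cosetProb_le_pow_codim hw hβ 0 U).trans
        (pow_le_pow_of_le_one (by linarith) (by linarith) hcod)).trans hr
    have hle : cosetProb w 0 V ≤ cosetProb w 0 U + expect w (fun r =>
        ind (LinearIndependent F (Fin.cons r z : Fin (L + 1) → Fin n → F) ∧
          ∀ s, (Fin.cons r z : Fin (L + 1) → Fin n → F) s ∈ V)) := by
      unfold cosetProb
      rw [← expect_add]
      refine expect_mono hw fun y => (ind_mono ?_).trans (ind_or_le _ _)
      intro hy
      rw [sub_zero] at hy ⊢
      by_cases hyU : y ∈ U
      · exact Or.inl hyU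
      · refine Or.inr ⟨linearIndependent_finCons.2 ⟨hz.1, hyU⟩, fun s => ?_⟩
        refine Fin.cases ?_ (fun s => ?_) s
        · simpa using hy
        · simpa using hz.2 s
    linarith

end Odlyzko

/-! ### Decoupling by repeated Cauchy-Schwarz. -/

section Decoupling

variable {κ R : Type*} [Fintype κ] [DecidableEq κ] [Fintype R]

/-- The `2 ^ s`-fold product of `e` over all ways of replacing blocks `B t`, `t < s`, of `x`
by the corresponding blocks of `x'`. -/
def decouple (B : ℕ → Finset κ) (e : (κ → R) → ℝ) : ℕ → (κ → R) → (κ → R) → ℝ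
  | 0 => fun x _ => e x
  | s + 1 => fun x x' => decouple B e s x x' * decouple B e s ((B s).piecewise x' x) x'

theorem decouple_congr (B : ℕ → Finset κ) (e : (κ → R) → ℝ) (s : ℕ) (x x' x'' : κ → R)
    (h : ∀ t < s, ∀ i ∈ B t, x' i = x'' i) : decouple B e s x x' = decouple B e s x x'' := by
  induction s generalizing x with
  | zero => rfl
  | succ s ih =>
    have h1 : (B s).piecewise x' x = (B s).piecewise x'' x := by
      ext i
      by_cases hi : i ∈ B s
      · simp [hi, h s (by omega) i hi]
      · simp [hi]
    simp only [decouple]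
    rw [h1, ih _ (fun t ht => h t (by omega)), ih _ (fun t ht => h t (by omega))]

/-- Cauchy-Schwarz applied to the average over block `T` of `x` yields two independent copies of
that block. Since `a` ignores the `T`-coordinates of `x'`, these are free to store the second copy,
and no third array is needed. -/
theorem sq_expect_expect_le {W : κ → R → ℝ} (hW : ∀ i, IsWeight (W i)) (T : Finset κ)
    (a : (κ → R) → (κ → R) → ℝ) (ha : ∀ x x' z, a x (T.piecewise z x') = a x x') :
    expect W (fun x => expect W (fun x' => a x x')) ^ 2 ≤
      expect W (fun x => expect W (fun x' => a x x' * a (T.piecewise x' x) x')) := by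
  have hsq : ∀ f : (κ → R) → ℝ, expect W f ^ 2 =
      expect W (fun z => expect W (fun z' => f z * f z')) := by
    intro f
    simp only [expect_mul_left]
    rw [expect_mul_right, sq]
  calc expect W (fun x => expect W (fun x' => a x x')) ^ 2
      = expect W (fun x' => expect W (fun x => expect W (fun z => a (T.piecewise z x) x'))) ^ 2 := by
        rw [expect_comm]
        congr 2
        ext x'
        exact (expect_resample hW T (fun x => a x x')).symm
    _ ≤ expect W (fun x' => expect W (fun x =>
          expect W (fun z => a (T.piecewise z x) x') ^ 2)) := by
        refine (sq_expect_le hW _).trans (expect_mono hW fun x' => ?_)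
        exact sq_expect_le hW _
    _ = expect W (fun x' => expect W (fun x => expect W (fun z =>
          expect W (fun z' => a (T.piecewise z x) x' *
            a (T.piecewise z' (T.piecewise z x)) x')))) := by
        congr 1; ext x'; congr 1; ext x
        rw [hsq]
        simp only [Finset.piecewise_idem_right]
    _ = expect W (fun x' => expect W (fun x =>
          expect W (fun z' => a x x' * a (T.piecewise z' x) x'))) := by
        congr 1; ext x'
        exact expect_resample hW T
          (fun x => expect W (fun z' => a x x' * a (T.piecewise z' x) x'))
    _ = expect W (fun x => expect W (fun x' => expect W (fun z' =>
          a x (T.piecewise z' x') *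
            a (T.piecewise (T.piecewise z' x') x) (T.piecewise z' x')))) := by
        rw [expect_comm]
        congr 1; ext x; congr 1; ext x'; congr 1; ext z'
        rw [ha, ha, Finset.piecewise_idem_left]
    _ = _ := by
        congr 1; ext x
        exact expect_resample hW T (fun x' => a x x' * a (T.piecewise x' x) x')

theorem expect_nonneg_decouple (B : ℕ → Finset κ) {e : (κ → R) → ℝ} (he : ∀ x, 0 ≤ e x) (s : ℕ)
    (x x' : κ → R) : 0 ≤ decouple B e s x x' := by
  induction s generalizing x with
  | zero => exact he x
  | succ s ih => exact mul_nonneg (ih _) (ih _)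

/-- One Cauchy-Schwarz step per block; disjointness ensures that block `B s` of `x'` is still unused
when step `s` needs it. -/
theorem expect_pow_le_decouple {W : κ → R → ℝ} (hW : ∀ i, IsWeight (W i)) {B : ℕ → Finset κ}
    {m : ℕ} (hB : ∀ s t, s < t → t < m → Disjoint (B s) (B t))
    {e : (κ → R) → ℝ} (he : ∀ x, 0 ≤ e x) (s : ℕ) (hs : s ≤ m) :
    expect W e ^ 2 ^ s ≤ expect W (fun x => expect W (fun x' => decouple B e s x x')) := by
  induction s with
  | zero => simp [decouple, expect_const hW]
  | succ s ih =>
    rw [pow_succ, pow_mul]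
    refine (pow_le_pow_left₀ (pow_nonneg (expect_nonneg hW he) _) (ih (by omega)) 2).trans ?_
    refine sq_expect_expect_le hW (B s) (decouple B e s) fun x x' z => ?_
    refine decouple_congr _ _ _ _ _ _ fun t ht i hi => ?_
    have : i ∉ B s := Finset.disjoint_left.1 (hB t s ht (by omega)) hi
    simp [this]

/-- Each of the 2^s hybrids of `x` and `x'` occurs as the argument of one factor of the product. -/
theorem ne_zero_of_decouple_ne_zero {B : ℕ → Finset κ} {e : (κ → R) → ℝ} {s : ℕ}
    {x x' : κ → R} (h : decouple B e s x x' ≠ 0) (S : Finset ℕ) (hS : S ⊆ Finset.range s) :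
    e ((S.biUnion B).piecewise x' x) ≠ 0 := by
  induction s generalizing x S with
  | zero =>
    have : S = ∅ := by simpa using hS
    subst this
    have h1 : ((∅ : Finset ℕ).biUnion B).piecewise x' x = x := by
      ext i; exact Finset.piecewise_eq_of_notMem _ _ _ (by simp)
    rw [h1]
    exact h
  | succ s ih =>
    simp only [decouple, ne_eq, mul_eq_zero, not_or] at h
    by_cases hs : s ∈ S
    · have h1 := ih h.2 (S.erase s) (by
        intro t ht
        have h2 := hS (Finset.mem_of_mem_erase ht)
        have h3 := Finset.ne_of_mem_erase ht
        simp at h2 ⊢; omega)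
      convert h1 using 2
      ext i
      by_cases hi : i ∈ (S.erase s).biUnion B
      · have : i ∈ S.biUnion B := Finset.biUnion_subset_biUnion_of_subset_left _
          (Finset.erase_subset _ _) hi
        simp only [Finset.piecewise_eq_of_mem _ _ _ hi, Finset.piecewise_eq_of_mem _ _ _ this]
      · rw [Finset.piecewise_eq_of_notMem _ _ _ hi]
        by_cases hi2 : i ∈ B s
        · have : i ∈ S.biUnion B := Finset.mem_biUnion.2 ⟨s, hs, hi2⟩
          rw [Finset.piecewise_eq_of_mem _ _ _ this, Finset.piecewise_eq_of_mem _ _ _ hi2]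
        · have : i ∉ S.biUnion B := by
            rw [Finset.mem_biUnion] at hi ⊢
            rintro ⟨t, ht, hit⟩
            refine hi ⟨t, Finset.mem_erase.2 ⟨?_, ht⟩, hit⟩
            rintro rfl; exact hi2 hit
          rw [Finset.piecewise_eq_of_notMem _ _ _ this, Finset.piecewise_eq_of_notMem _ _ _ hi2]
    · refine ih h.1 S fun t ht => ?_
      have h2 := hS ht
      have h3 : t ≠ s := by rintro rfl; exact hs ht
      simp at h2 ⊢; omega

end Decoupling

/-! ### Finite differences of a product of shifts of a matrix. -/

section Polynomial

open Matrix

variable {F : Type*} [Field F] {n : ℕ}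

/-- `(M - c (l - 1)) ⋯ (M - c 0) v`. -/
def shiftProd (c : ℕ → F) (v : Fin n → F) (M : Matrix (Fin n) (Fin n) F) : ℕ → Fin n → F
  | 0 => v
  | l + 1 => M *ᵥ shiftProd c v M l - c l • shiftProd c v M l

/-- The sum of `D (t_l) ⋯ D (t_1) v` over all enumerations of `T`, for `l = |T|`. -/
def permSum (D : ℕ → Matrix (Fin n) (Fin n) F) (v : Fin n → F) : ℕ → Finset ℕ → Fin n → F
  | 0, _ => v
  | l + 1, T => ∑ t ∈ T, D t *ᵥ permSum D v l (T.erase t)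

/-- The iterated difference of `shiftProd` in the directions `D t`, `t ∈ T`. -/
def altSum (c : ℕ → F) (v : Fin n → F) (N : Matrix (Fin n) (Fin n) F)
    (D : ℕ → Matrix (Fin n) (Fin n) F) (l : ℕ) (T : Finset ℕ) : Fin n → F :=
  ∑ S ∈ T.powerset, (-1 : F) ^ (T.card + S.card) • shiftProd c v (N + ∑ t ∈ S, D t) l

/-- A discrete Leibniz rule. The outermost factor is affine in the indicator of `S`, and direction
`t` enters only for sets `S` containing `t`; the part of the alternating sum over those sets is the
sum over `T` plus the one over `T.erase t`. -/
theorem altSum_succ (c : ℕ → F) (v : Fin n → F) (N : Matrix (Fin n) (Fin n) F)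
    (D : ℕ → Matrix (Fin n) (Fin n) F) (l : ℕ) (T : Finset ℕ) :
    altSum c v N D (l + 1) T = N *ᵥ altSum c v N D l T - c l • altSum c v N D l T +
      ∑ t ∈ T, D t *ᵥ (altSum c v N D l T + altSum c v N D l (T.erase t)) := by
  set Q : Finset ℕ → Fin n → F := fun S => shiftProd c v (N + ∑ t ∈ S, D t) l with hQ
  have hinner : ∀ t ∈ T, altSum c v N D l T + altSum c v N D l (T.erase t) =
      ∑ S ∈ T.powerset, if t ∈ S then (-1 : F) ^ (T.card + S.card) • Q S else 0 := by
    intro t ht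
    have h1 : altSum c v N D l (T.erase t) =
        -∑ S ∈ T.powerset, if t ∈ S then 0 else (-1 : F) ^ (T.card + S.card) • Q S := by
      have hf : (T.erase t).powerset = T.powerset.filter (fun S => ¬ t ∈ S) := by
        ext S; simp only [Finset.mem_powerset, Finset.mem_filter, Finset.subset_erase]
      rw [altSum, hf, Finset.sum_filter, ← Finset.sum_neg_distrib]
      refine Finset.sum_congr rfl fun S _ => ?_
      by_cases hS : t ∈ S
      · simp [hS]
      · have := Finset.card_erase_add_one ht
        simp only [hS, not_false_eq_true, if_true, if_false, ← this, ← neg_smul]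
        congr 1
        ring
    rw [h1, altSum, ← sub_eq_add_neg, ← Finset.sum_sub_distrib]
    refine Finset.sum_congr rfl fun S _ => ?_
    by_cases hS : t ∈ S <;> simp [hS, hQ]
  have hlast : ∑ t ∈ T, D t *ᵥ (altSum c v N D l T + altSum c v N D l (T.erase t)) =
      ∑ S ∈ T.powerset, (-1 : F) ^ (T.card + S.card) • ((∑ t ∈ S, D t) *ᵥ Q S) := by
    rw [Finset.sum_congr rfl fun t ht => by rw [hinner t ht, Matrix.mulVec_sum], Finset.sum_comm]
    refine Finset.sum_congr rfl fun S hS => ?_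
    rw [Matrix.sum_mulVec, Finset.smul_sum]
    have h2 : ∀ t, D t *ᵥ (if t ∈ S then (-1 : F) ^ (T.card + S.card) • Q S else 0) =
        if t ∈ S then (-1 : F) ^ (T.card + S.card) • (D t *ᵥ Q S) else 0 := by
      intro t; by_cases ht : t ∈ S <;> simp [ht, Matrix.mulVec_smul]
    simp only [h2]
    rw [Finset.sum_ite_mem, Finset.inter_eq_right.2 (Finset.mem_powerset.1 hS)]
  rw [hlast]
  simp only [altSum, Matrix.mulVec_sum, Finset.smul_sum]
  rw [← Finset.sum_sub_distrib, ← Finset.sum_add_distrib]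
  refine Finset.sum_congr rfl fun S _ => ?_
  simp only [shiftProd, Matrix.mulVec_smul, Matrix.add_mulVec, hQ]
  rw [smul_comm (c l)]
  rw [← smul_sub, ← smul_add]
  congr 1
  abel

/-- A polynomial of degree `l` is killed by more than `l` differences, and exactly `l` of them leave
the polarized leading term, in which the base point `N` and the shifts `c` have disappeared. -/
theorem altSum_eq (c : ℕ → F) (v : Fin n → F) (N : Matrix (Fin n) (Fin n) F)
    (D : ℕ → Matrix (Fin n) (Fin n) F) (l : ℕ) : ∀ T : Finset ℕ,
    (l < T.card → altSum c v N D l T = 0) ∧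
    (T.card = l → altSum c v N D l T = permSum D v l T) := by
  induction l with
  | zero =>
    intro T
    constructor
    · intro hT
      have := Finset.sum_powerset_neg_one_pow_card_of_nonempty (Finset.card_pos.1 hT)
      simp only [altSum, shiftProd]
      rw [← Finset.sum_smul]
      simp only [pow_add]
      rw [← Finset.mul_sum]
      have h2 : ∑ S ∈ T.powerset, (-1 : F) ^ S.card = 0 := by exact_mod_cast congrArg (Int.cast : ℤ → F) this
      rw [h2]; simp
    · intro hT
      rw [Finset.card_eq_zero] at hT
      subst hT
      simp [altSum, permSum, shiftProd]
  | succ l ih =>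
    intro T
    constructor
    · intro hT
      rw [altSum_succ, (ih T).1 (by omega)]
      simp only [Matrix.mulVec_zero, smul_zero, sub_zero, zero_add]
      refine Finset.sum_eq_zero fun t ht => ?_
      have := Finset.card_erase_add_one ht
      rw [(ih _).1 (by omega), Matrix.mulVec_zero]
    · intro hT
      rw [altSum_succ, (ih T).1 (by omega)]
      simp only [Matrix.mulVec_zero, smul_zero, sub_zero, zero_add, permSum]
      refine Finset.sum_congr rfl fun t ht => ?_
      have := Finset.card_erase_add_one ht
      rw [(ih _).2 (by omega)]

theorem permSum_congr {D D' : ℕ → Matrix (Fin n) (Fin n) F} (v : Fin n → F) (l : ℕ)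
    (T : Finset ℕ) (h : ∀ t ∈ T, D t = D' t) : permSum D v l T = permSum D' v l T := by
  induction l generalizing T with
  | zero => rfl
  | succ l ih =>
    simp only [permSum]
    refine Finset.sum_congr rfl fun t ht => ?_
    rw [h t ht, ih _ fun s hs => h s (Finset.mem_of_mem_erase hs)]

end Polynomial

/-! ### A product of shifts of the random matrix rarely kills a given vector. -/

section PolynomialProbability

open Matrix

variable {F : Type*} [Field F] [Fintype F] {n : ℕ}

theorem expect_dotProduct_eq_le {w : Fin n → F → ℝ} (hw : ∀ j, IsWeight (w j)) {α : ℝ}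
    (hα0 : 0 ≤ α) (hα1 : α ≤ 1) (hα : ∀ j a, w j a ≤ 1 - α) {h : Fin n → F} (hh : h ≠ 0) (a : F) :
    expect w (fun r => ind (r ⬝ᵥ h = a)) ≤ 1 - α := by
  by_cases hr : ∃ r : Fin n → F, r ⬝ᵥ h = a
  swap
  · push Not at hr
    refine expect_le_of_le hw fun r => ?_
    rw [ind_false (hr r)]; linarith
  obtain ⟨r₀, hr₀⟩ := hr
  set U : Submodule F (Fin n → F) := LinearMap.ker (dotProductEquiv F (Fin n) h) with hU
  have hmem : ∀ r, r ∈ U ↔ r ⬝ᵥ h = 0 := by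
    intro r; rw [hU, LinearMap.mem_ker, dotProductEquiv_apply_apply, dotProduct_comm]
  have hle : expect w (fun r => ind (r ⬝ᵥ h = a)) ≤ cosetProb w r₀ U := by
    refine expect_mono hw fun r => ind_mono fun hr => ?_
    rw [hmem, sub_dotProduct, hr, hr₀, sub_self]
  refine hle.trans ((cosetProb_le_pow_codim hw hα r₀ U).trans ?_)
  have hcod : codim U ≠ 0 := by
    intro h0
    have h1 := codim_add_finrank U
    have h2 : U = ⊤ := Submodule.eq_top_of_finrank_eq (by simp; omega)
    apply hh
    ext j
    have : (Pi.single j (1 : F) : Fin n → F) ∈ U := h2 ▸ Submodule.mem_top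
    rw [hmem] at this
    simpa using this
  calc (1 - α) ^ codim U ≤ (1 - α) ^ 1 :=
        pow_le_pow_of_le_one (by linarith) (by linarith) (by omega)
    _ = 1 - α := pow_one _

/-- The block of rows `B t` of `x' - x`. -/
def blockDiff (B : ℕ → Finset (Fin n)) (x x' : Fin n → Fin n → F) (t : ℕ) :
    Matrix (Fin n) (Fin n) F :=
  Matrix.of fun i => if i ∈ B t then x' i - x i else 0

theorem of_piecewise_eq_add_sum {B : ℕ → Finset (Fin n)} {m : ℕ}
    (hB : ∀ s t, s < t → t < m → Disjoint (B s) (B t)) (x x' : Fin n → Fin n → F)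
    {S : Finset ℕ} (hS : S ⊆ Finset.range m) :
    Matrix.of ((S.biUnion B).piecewise x' x) = Matrix.of x + ∑ t ∈ S, blockDiff B x x' t := by
  have hB' : ∀ s t, s < m → t < m → s ≠ t → Disjoint (B s) (B t) := by
    intro s t hs ht hst
    rcases lt_or_gt_of_ne hst with h | h
    · exact hB s t h ht
    · exact (hB t s h hs).symm
  ext i j
  simp only [Matrix.add_apply, Matrix.of_apply, Matrix.sum_apply, blockDiff]
  by_cases hi : i ∈ S.biUnion B
  · obtain ⟨t, ht, hit⟩ := Finset.mem_biUnion.1 hi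
    rw [Finset.piecewise_eq_of_mem _ _ _ hi, Finset.sum_eq_single_of_mem t ht]
    · simp [hit]
    · intro s hs hst
      have : i ∉ B s := Finset.disjoint_left.1 (hB' t s (Finset.mem_range.1 (hS ht))
        (Finset.mem_range.1 (hS hs)) hst.symm) hit
      simp [this]
  · rw [Finset.piecewise_eq_of_notMem _ _ _ hi, Finset.sum_eq_zero]
    · simp
    · intro s hs
      have : i ∉ B s := fun h => hi (Finset.mem_biUnion.2 ⟨s, hs, h⟩)
      simp [this]

/-- When the decoupled product is nonzero, every hybrid matrix kills `v`, so the alternating sum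
over hybrids vanishes term by term; that sum is the polarized form. -/
theorem permSum_eq_zero_of_decouple_ne_zero {B : ℕ → Finset (Fin n)} {m : ℕ}
    (hB : ∀ s t, s < t → t < m → Disjoint (B s) (B t)) (c : ℕ → F) (v : Fin n → F)
    (x x' : Fin n → Fin n → F)
    (h : decouple B (fun M => ind (shiftProd c v (Matrix.of M) m = 0)) m x x' ≠ 0) :
    permSum (blockDiff B x x') v m (Finset.range m) = 0 := by
  rw [← (altSum_eq c v (Matrix.of x) (blockDiff B x x') m _).2 (Finset.card_range m)]
  refine Finset.sum_eq_zero fun S hS => ?_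
  rw [← of_piecewise_eq_add_sum hB x x' (Finset.mem_powerset.1 hS)]
  have h1 := ne_zero_of_decouple_ne_zero h S (Finset.mem_powerset.1 hS)
  have h2 : shiftProd c v (Matrix.of ((S.biUnion B).piecewise x' x)) m = 0 := by
    by_contra h3
    exact h1 (ind_false h3)
  rw [h2, smul_zero]

/-- The matrix D_t has nonzero rows only in block t, so on the rows of block `l` only the terms
ending in D_l survive, and they give D_l applied to the previous form H. If H ≠ 0, each row of that
block must solve a nontrivial linear equation, and H vanishes with a probability bounded by
induction. -/
theorem expect_permSum_eq_zero_le {w : Fin n → Fin n → F → ℝ} (hw : ∀ i j, IsWeight (w i j))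
    {α : ℝ} (hα0 : 0 ≤ α) (hα1 : α ≤ 1) (hα : ∀ i j a, w i j a ≤ 1 - α)
    {B : ℕ → Finset (Fin n)} {m b : ℕ} (hB : ∀ s t, s < t → t < m → Disjoint (B s) (B t))
    (hb : ∀ t < m, b ≤ (B t).card) {v : Fin n → F} (hv : v ≠ 0) (l : ℕ) (hl : l ≤ m) :
    expect (fun i => prodWeight (w i)) (fun x => expect (fun i => prodWeight (w i)) (fun x' =>
      ind (permSum (blockDiff B x x') v l (Finset.range l) = 0))) ≤ l * (1 - α) ^ b := by
  have hW : ∀ i, IsWeight (prodWeight (w i)) := fun i => isWeight_prodWeight (hw i)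
  induction l with
  | zero =>
    simp only [permSum, ind_false hv]
    rw [expect_const hW, expect_const hW]; simp
  | succ l ih =>
    set H : (Fin n → Fin n → F) → (Fin n → Fin n → F) → Fin n → F :=
      fun x x' => permSum (blockDiff B x x') v l (Finset.range l) with hH
    have hstep : ∀ x x', ind (permSum (blockDiff B x x') v (l + 1) (Finset.range (l + 1)) = 0) ≤
        ind (H x x' = 0) + ind (H x x' ≠ 0 ∧ ∀ i ∈ B l, x' i ⬝ᵥ H x x' = x i ⬝ᵥ H x x') := by
      intro x x'
      refine (ind_mono fun h => ?_).trans (ind_or_le _ _)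
      by_cases h0 : H x x' = 0
      · exact Or.inl h0
      refine Or.inr ⟨h0, fun i hi => ?_⟩
      have h1 := congrFun h i
      simp only [permSum, Finset.sum_apply, Pi.zero_apply] at h1
      rw [Finset.sum_eq_single_of_mem l (by simp)] at h1
      · have h2 : (Finset.range (l + 1)).erase l = Finset.range l := by
          rw [Finset.range_add_one, Finset.erase_insert (by simp)]
        rw [h2] at h1
        simp only [Matrix.mulVec, blockDiff, Matrix.of_apply, hi, if_true] at h1
        have h3 := h1
        rw [sub_dotProduct] at h3
        exact sub_eq_zero.1 h3
      · intro t ht htl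
        have h3 : i ∉ B t := Finset.disjoint_right.1 (hB t l (by simp at ht; omega) (by omega)) hi
        simp [Matrix.mulVec, blockDiff, h3]
    have hfresh : ∀ x, expect (fun i => prodWeight (w i)) (fun x' =>
        ind (H x x' ≠ 0 ∧ ∀ i ∈ B l, x' i ⬝ᵥ H x x' = x i ⬝ᵥ H x x')) ≤ (1 - α) ^ b := by
      intro x
      -- With `x` fixed, H sees only blocks before `l` of `x'`, so block `l` can be resampled with H
      -- frozen.
      rw [← expect_resample hW (B l)]
      refine expect_le_of_le hW fun x' => ?_
      have hHeq : ∀ z, H x ((B l).piecewise z x') = H x x' := by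
        intro z
        refine permSum_congr v l _ fun t ht => ?_
        ext i j
        simp only [blockDiff, Matrix.of_apply]
        by_cases hi : i ∈ B t
        · have h3 : i ∉ B l :=
            Finset.disjoint_left.1 (hB t l (Finset.mem_range.1 ht) (by omega)) hi
          simp [hi, h3]
        · simp [hi]
      simp only [hHeq]
      by_cases h0 : H x x' = 0
      · refine expect_le_of_le hW fun z => ?_
        rw [ind_false (by tauto)]
        exact pow_nonneg (by linarith) _
      calc expect (fun i => prodWeight (w i)) (fun z => ind (H x x' ≠ 0 ∧
            ∀ i ∈ B l, (B l).piecewise z x' i ⬝ᵥ H x x' = x i ⬝ᵥ H x x'))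
          ≤ expect (fun i => prodWeight (w i)) (fun z => ind (
            ∀ i ∈ B l, z i ⬝ᵥ H x x' = x i ⬝ᵥ H x x')) := by
            refine expect_mono hW fun z => ind_mono fun h i hi => ?_
            have := h.2 i hi
            rwa [Finset.piecewise_eq_of_mem _ _ _ hi] at this
        _ ≤ (1 - α) ^ (B l).card :=
            expect_ind_forall_le hW (B l) (fun i r => r ⬝ᵥ H x x' = x i ⬝ᵥ H x x')
              fun i _ => expect_dotProduct_eq_le (hw i) hα0 hα1 (hα i) h0 _
        _ ≤ (1 - α) ^ b :=
            pow_le_pow_of_le_one (by linarith) (by linarith) (hb l (by omega))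
    calc _ ≤ expect (fun i => prodWeight (w i)) (fun x => expect (fun i => prodWeight (w i))
            (fun x' => ind (H x x' = 0)) + (1 - α) ^ b) := by
          refine expect_mono hW fun x => ?_
          refine (expect_mono hW (hstep x)).trans ?_
          rw [expect_add]
          exact add_le_add le_rfl (hfresh x)
      _ ≤ l * (1 - α) ^ b + (1 - α) ^ b := by
          rw [expect_add, expect_const hW]
          exact add_le_add (ih (by omega)) le_rfl
      _ = _ := by push_cast; ring

theorem exists_blocks (n m : ℕ) : ∃ B : ℕ → Finset (Fin n),
    (∀ s t, s < t → t < m → Disjoint (B s) (B t)) ∧ ∀ t < m, n / m ≤ (B t).card := by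
  classical
  -- Consecutive intervals of length ⌊n/m⌋. If ⌊n/m⌋ = 0, division by zero puts every index in block
  -- 0, which is harmless since the required size is then 0.
  refine ⟨fun t => Finset.univ.filter fun i => i.val / (n / m) = t, ?_, ?_⟩
  · intro s t hst _
    rw [Finset.disjoint_filter]
    intro i _ h1 h2
    omega
  · intro t ht
    rcases Nat.eq_zero_or_pos (n / m) with h0 | h0
    · rw [h0]; exact Nat.zero_le _
    have hlt : ∀ k, k < n / m → t * (n / m) + k < n := by
      intro k hk
      have h1 : (t + 1) * (n / m) ≤ m * (n / m) := Nat.mul_le_mul_right _ ht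
      have h2 := Nat.mul_div_le n m
      nlinarith
    have h3 := Finset.card_le_card_of_injOn (s := Finset.univ (α := Fin (n / m)))
      (t := Finset.univ.filter fun i : Fin n => i.val / (n / m) = t)
      (fun k => ⟨t * (n / m) + k, hlt k k.2⟩) (by
        intro k _
        simp only [Finset.coe_filter, Finset.mem_univ, true_and, Set.mem_ofPred_eq]
        rw [mul_comm, Nat.mul_add_div h0, Nat.div_eq_of_lt k.2, add_zero]) (by
        intro k _ k' _ h
        simp only [Fin.mk.injEq] at h
        ext; omega)
    simpa using h3

/-- A product of `m` shifts of the random matrix is unlikely to kill a nonzero vector. -/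
theorem expect_shiftProd_eq_zero_pow_le {w : Fin n → Fin n → F → ℝ}
    (hw : ∀ i j, IsWeight (w i j)) {α : ℝ} (hα0 : 0 ≤ α) (hα1 : α ≤ 1)
    (hα : ∀ i j a, w i j a ≤ 1 - α) (m : ℕ) (c : ℕ → F) {v : Fin n → F} (hv : v ≠ 0) :
    expect (fun i => prodWeight (w i)) (fun M => ind (shiftProd c v (Matrix.of M) m = 0)) ^ 2 ^ m
      ≤ m * (1 - α) ^ (n / m) := by
  have hW : ∀ i, IsWeight (prodWeight (w i)) := fun i => isWeight_prodWeight (hw i)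
  obtain ⟨B, hB, hb⟩ := exists_blocks n m
  refine (expect_pow_le_decouple hW hB (fun _ => ind_nonneg _) m le_rfl).trans ?_
  refine le_trans (expect_mono hW fun x => expect_mono hW fun x' => ?_)
    (expect_permSum_eq_zero_le hw hα0 hα1 hα hB hb hv m le_rfl)
  by_cases h : decouple B (fun M => ind (shiftProd c v (Matrix.of M) m = 0)) m x x' = 0
  · rw [h]; exact ind_nonneg _
  · rw [ind_true (permSum_eq_zero_of_decouple_ne_zero hB c v x x' h)]
    have hle : ∀ s y, decouple B (fun M => ind (shiftProd c v (Matrix.of M) m = 0)) s y x' ≤ 1 := by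
      intro s
      induction s with
      | zero => exact fun y => ind_le_one _
      | succ s ih =>
        intro y
        exact mul_le_one₀ (ih _) (expect_nonneg_decouple B (fun _ => ind_nonneg _) _ _ _) (ih _)
    exact hle m x

end PolynomialProbability

/-! ### Sparse vectors orthogonal to the row intersection. -/

section Sparse

open Matrix

variable {F : Type*} [Field F] {n : ℕ}

theorem mul_row_mem_rowSpace (Q A : Matrix (Fin n) (Fin n) F) (i : Fin n) :
    (Q * A) i ∈ rowSpace A := by
  rw [Matrix.mul_apply_eq_vecMul, Matrix.vecMul_eq_sum]
  exact Submodule.sum_mem _ fun k _ => Submodule.smul_mem _ _ (Submodule.subset_span ⟨k, rfl⟩)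

/-- The matrix `(M - c (l - 1)) ⋯ (M - c 0)`. -/
def shiftMatrix (c : ℕ → F) (M : Matrix (Fin n) (Fin n) F) : ℕ → Matrix (Fin n) (Fin n) F
  | 0 => 1
  | l + 1 => (M - c l • 1) * shiftMatrix c M l

theorem shiftMatrix_mulVec (c : ℕ → F) (v : Fin n → F) (M : Matrix (Fin n) (Fin n) F) (l : ℕ) :
    shiftMatrix c M l *ᵥ v = shiftProd c v M l := by
  induction l with
  | zero => simp [shiftMatrix, shiftProd]
  | succ l ih =>
    simp [shiftMatrix, shiftProd, ← ih, ← Matrix.mulVec_mulVec, Matrix.sub_mulVec,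
      Matrix.smul_mulVec]

theorem commute_shiftMatrix (c : ℕ → F) (M : Matrix (Fin n) (Fin n) F) (a : F) (l : ℕ) :
    Commute (M - a • 1) (shiftMatrix c M l) := by
  induction l with
  | zero => exact Commute.one_right _
  | succ l ih =>
    refine Commute.mul_right ?_ ih
    refine Commute.sub_left (Commute.sub_right (Commute.refl _) ?_) ?_
    · exact (Commute.one_right M).smul_right _
    · exact (Commute.one_left _).smul_left _

/-- The factors commute, so any of them can be brought to the right end; the rows of the product are
then combinations of the rows of that factor. Consequently they lie in all the row spaces at once.
-/
theorem exists_shiftMatrix_eq_mul (c : ℕ → F) (M : Matrix (Fin n) (Fin n) F) {j l : ℕ}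
    (h : j < l) : ∃ Q, shiftMatrix c M l = Q * (M - c j • 1) := by
  induction l with
  | zero => omega
  | succ l ih =>
    rcases Nat.lt_succ_iff_lt_or_eq.1 h with h | rfl
    · obtain ⟨Q, hQ⟩ := ih h
      exact ⟨(M - c l • 1) * Q, by rw [shiftMatrix, hQ, mul_assoc]⟩
    · exact ⟨shiftMatrix c M j, (commute_shiftMatrix c M (c j) j).eq⟩

theorem shiftProd_eq_zero_of_orthogonal {m : ℕ} (lam : Fin m → F) (c : ℕ → F)
    (hc : ∀ j : Fin m, c j = lam j) (M : Matrix (Fin n) (Fin n) F) {v : Fin n → F}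
    (hv : ∀ w ∈ rowInter lam M, v ⬝ᵥ w = 0) : shiftProd c v M m = 0 := by
  rw [← shiftMatrix_mulVec]
  ext i
  have : (shiftMatrix c M m) i ∈ rowInter lam M := by
    rw [rowInter, Submodule.mem_iInf]
    intro j
    obtain ⟨Q, hQ⟩ := exists_shiftMatrix_eq_mul c M j.2
    rw [hQ, ← hc]
    exact mul_row_mem_rowSpace _ _ _
  have := hv _ this
  rwa [dotProduct_comm] at this

/-- Codes a sparse vector by `s` position-value pairs, padded with `(i₀, 0)`, so that the union
bound has at most (nq)^s terms. -/
theorem exists_sum_single_eq [Fintype F] (i₀ : Fin n) (s : ℕ) (v : Fin n → F)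
    (hv : (Function.support v).ncard ≤ s) :
    ∃ p : Fin s → Fin n × F, ∑ k, Pi.single (p k).1 (p k).2 = v := by
  classical
  induction s generalizing v with
  | zero =>
    refine ⟨fun k => k.elim0, ?_⟩
    have : Function.support v = ∅ := (Set.ncard_eq_zero (Set.toFinite _)).1 (by omega)
    rw [Function.support_eq_empty_iff] at this
    simp [this]
  | succ s ih =>
    by_cases h : ∃ j, v j ≠ 0
    · obtain ⟨j, hj⟩ := h
      have hsub : Function.support (Function.update v j 0) = Function.support v \ {j} := by
        ext i; by_cases hi : i = j
        · subst hi; simp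
        · simp [hi]
      obtain ⟨p, hp⟩ := ih (Function.update v j 0) (by
        rw [hsub, Set.ncard_sdiff_singleton_of_mem (by simpa using hj)]; omega)
      refine ⟨Fin.cons (j, v j) p, ?_⟩
      rw [Fin.sum_univ_succ]
      simp only [Fin.cons_zero, Fin.cons_succ]
      rw [hp]
      ext i; by_cases hi : i = j
      · subst hi; simp
      · simp [hi]
    · push Not at h
      refine ⟨fun _ => (i₀, 0), ?_⟩
      ext i; simp [h i]

/-- The row intersection is unlikely to be sparse. -/
theorem expect_isSparse_le [Fintype F] {w : Fin n → Fin n → F → ℝ} (hw : ∀ i j, IsWeight (w i j))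
    {m : ℕ} (lam : Fin m → F) (hn : 0 < n) (c : ℕ → F) (hc : ∀ j : Fin m, c j = lam j)
    {t B : ℝ}
    (hB : ∀ v : Fin n → F, v ≠ 0 → expect (fun i => prodWeight (w i))
      (fun M => ind (shiftProd c v (Matrix.of M) m = 0)) ≤ B) :
    expect (fun i => prodWeight (w i)) (fun M => ind (IsSparse t (rowInter lam (Matrix.of M)))) ≤
      ((n : ℝ) * Fintype.card F) ^ ⌊t⌋₊ * B := by
  classical
  have hW : ∀ i, IsWeight (prodWeight (w i)) := fun i => isWeight_prodWeight (hw i)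
  have hB0 : 0 ≤ B := by
    refine le_trans ?_ (hB (Pi.single ⟨0, hn⟩ 1) (by simp))
    exact expect_nonneg hW fun _ => ind_nonneg _
  set dec : (Fin ⌊t⌋₊ → Fin n × F) → Fin n → F := fun p => ∑ k, Pi.single (p k).1 (p k).2 with hdec
  have hle : ∀ M : Fin n → Fin n → F, ind (IsSparse t (rowInter lam (Matrix.of M))) ≤
      ∑ p : Fin ⌊t⌋₊ → Fin n × F,
        ind (dec p ≠ 0 ∧ shiftProd c (dec p) (Matrix.of M) m = 0) := by
    intro M
    refine (ind_mono ?_).trans (ind_exists_le Finset.univ _)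
    rintro ⟨v, hv0, hv, hs⟩
    obtain ⟨p, hp⟩ := exists_sum_single_eq ⟨0, hn⟩ ⌊t⌋₊ v (Nat.le_floor hs)
    refine ⟨p, Finset.mem_univ _, ?_⟩
    rw [show dec p = v from hp]
    exact ⟨hv0, shiftProd_eq_zero_of_orthogonal lam c hc _ hv⟩
  refine (expect_mono hW hle).trans ?_
  rw [expect_sum]
  calc _ ≤ ∑ p : Fin ⌊t⌋₊ → Fin n × F, B := by
        refine Finset.sum_le_sum fun p _ => ?_
        by_cases h0 : dec p = 0
        · refine (expect_le_of_le hW fun M => ?_)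
          rw [ind_false (by tauto)]; exact hB0
        · exact (expect_mono hW fun M => ind_mono fun h => h.2).trans (hB _ h0)
    _ = _ := by simp [Fintype.card_prod]

end Sparse

/-! ### Doubling of sublevel sets away from subgroups. -/

section Growth

variable {G : Type*} [AddCommGroup G] [Fintype G]

/-- Functions such as the square of a norm: even, and the square root is subadditive up to
constants. -/
structure IsQuasiSq (f : G → ℝ) : Prop where
  zero : f 0 = 0
  nonneg : ∀ u, 0 ≤ f u
  neg : ∀ u, f (-u) = f u
  add_le : ∀ u v, f (u + v) ≤ 2 * f u + 2 * f v

open Classical in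
/-- The sublevel set of `f` at `r`. -/
noncomputable def sublevel (f : G → ℝ) (r : ℝ) : Finset G := Finset.univ.filter fun u => f u ≤ r

theorem mem_sublevel {f : G → ℝ} {r : ℝ} {u : G} : u ∈ sublevel f r ↔ f u ≤ r := by
  simp [sublevel]

/-- Let S be the sublevel set at `r`, which is symmetric. If some a + b + c in S + S + S is not in S
+ S, the translate of S by it is disjoint from S, and both lie in the sublevel at 16r. Otherwise S +
S is a nontrivial subgroup on which f ≤ 4r < θ, which is excluded. -/
theorem two_mul_card_sublevel_le {f : G → ℝ} (hf : IsQuasiSq f) {r θ : ℝ} (hr : 0 ≤ r)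
    (hrθ : 4 * r < θ) (hθ : ∀ H : AddSubgroup G, H ≠ ⊥ → ∃ u ∈ H, θ ≤ f u)
    (h2 : 2 ≤ (sublevel f r).card) :
    2 * (sublevel f r).card ≤ (sublevel f (16 * r)).card := by
  classical
  by_cases hx : ∃ a b c, f a ≤ r ∧ f b ≤ r ∧ f c ≤ r ∧ ∀ d e, f d ≤ r → f e ≤ r → a + b + c ≠ d + e
  · obtain ⟨a, b, c, ha, hb, hc, hne⟩ := hx
    have hdisj : Disjoint (sublevel f r) ((sublevel f r).image (fun d => a + b + c + d)) := by
      rw [Finset.disjoint_left]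
      intro e he he2
      obtain ⟨d, hd, hde⟩ := Finset.mem_image.1 he2
      rw [mem_sublevel] at he hd
      refine hne e (-d) he (by rwa [hf.neg]) ?_
      rw [← hde]; abel
    have hcard : ((sublevel f r).image (fun d => a + b + c + d)).card = (sublevel f r).card :=
      Finset.card_image_of_injective _ (add_right_injective _)
    calc 2 * (sublevel f r).card
        = (sublevel f r ∪ (sublevel f r).image (fun d => a + b + c + d)).card := by
          rw [Finset.card_union_of_disjoint hdisj, hcard]; ring
      _ ≤ _ := by
          refine Finset.card_le_card ?_
          intro u hu
          rw [mem_sublevel]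
          rcases Finset.mem_union.1 hu with hu | hu
          · rw [mem_sublevel] at hu; linarith
          · obtain ⟨d, hd, rfl⟩ := Finset.mem_image.1 hu
            rw [mem_sublevel] at hd
            have h1 := hf.add_le a b
            have h3 := hf.add_le c d
            have h4 := hf.add_le (a + b) (c + d)
            rw [← add_assoc] at h4
            linarith
  · push Not at hx
    exfalso
    have hsum : ∀ a b, f a ≤ r → f b ≤ r → f (a + b) ≤ 4 * r := fun a b ha hb => by
      linarith [hf.add_le a b]
    let H : AddSubgroup G :=
      { carrier := {u | ∃ d e, f d ≤ r ∧ f e ≤ r ∧ u = d + e}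
        zero_mem' := ⟨0, 0, by rwa [hf.zero], by rwa [hf.zero], by simp⟩
        neg_mem' := by
          rintro u ⟨d, e, hd, he, rfl⟩
          exact ⟨-d, -e, by rwa [hf.neg], by rwa [hf.neg], by abel⟩
        add_mem' := by
          rintro u v ⟨a, b, ha, hb, rfl⟩ ⟨c, d, hc, hd, rfl⟩
          obtain ⟨e, g, he, hg, h⟩ := hx a b c ha hb hc
          obtain ⟨e', g', he', hg', h'⟩ := hx e g d he hg hd
          exact ⟨e', g', he', hg', by rw [← add_assoc, h, h']⟩ }
    have hH : H ≠ ⊥ := by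
      intro hbot
      obtain ⟨a, ha, b, hb, hab⟩ := Finset.one_lt_card.1 (Nat.lt_of_succ_le h2)
      have h0 : ∀ a ∈ sublevel f r, a = 0 := by
        intro a ha
        have : a ∈ H := ⟨a, 0, mem_sublevel.1 ha, by rwa [hf.zero], by simp⟩
        rwa [hbot, AddSubgroup.mem_bot] at this
      exact hab ((h0 a ha).trans (h0 b hb).symm)
    obtain ⟨u, ⟨d, e, hd, he, rfl⟩, hu⟩ := hθ H hH
    linarith [hsum d e hd he]

theorem sublevel_mono (f : G → ℝ) {r s : ℝ} (h : r ≤ s) : sublevel f r ⊆ sublevel f s := by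
  intro u hu
  rw [mem_sublevel] at hu ⊢
  exact hu.trans h

theorem two_pow_mul_card_sublevel_le {f : G → ℝ} (hf : IsQuasiSq f) {r θ : ℝ} (hr : 0 ≤ r)
    (hθ : ∀ H : AddSubgroup G, H ≠ ⊥ → ∃ u ∈ H, θ ≤ f u)
    (h2 : 2 ≤ (sublevel f r).card) (J : ℕ) (hJ : 16 ^ J * r < θ) :
    2 ^ J * (sublevel f r).card ≤ (sublevel f (16 ^ J * r)).card := by
  induction J with
  | zero => simp
  | succ J ih =>
    have h16 : (16 : ℝ) ^ (J + 1) * r = 16 * (16 ^ J * r) := by ring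
    have hpos : 0 ≤ 16 ^ J * r := by positivity
    rw [h16] at hJ ⊢
    have h1 := ih (by linarith)
    have h3 : 2 ≤ (sublevel f (16 ^ J * r)).card := by
      refine h2.trans (Finset.card_le_card (sublevel_mono f ?_))
      exact le_mul_of_one_le_left hr (one_le_pow₀ (by norm_num))
    have h4 := two_mul_card_sublevel_le hf hpos (by linarith) hθ h3
    calc 2 ^ (J + 1) * (sublevel f r).card = 2 * (2 ^ J * (sublevel f r).card) := by ring
      _ ≤ 2 * (sublevel f (16 ^ J * r)).card := Nat.mul_le_mul_left _ h1
      _ ≤ _ := h4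

/-- If no nontrivial subgroup lies in a large sublevel set of `f`, then the nonzero part of
`∑ exp (-f / 2)` is much smaller than the same sum for a small multiple of `f`. -/
theorem sum_exp_neg_half_le {f : G → ℝ} (hf : IsQuasiSq f) {η θ : ℝ}
    (hη : 2 * η * (16 ^ 20 * 44) = 1) (hθ0 : 16 ^ 20 * 44 < θ)
    (hθ : ∀ H : AddSubgroup G, H ≠ ⊥ → ∃ u ∈ H, θ ≤ f u) [DecidableEq G] :
    ∑ u ∈ Finset.univ.erase (0 : G), Real.exp (-f u / 2) ≤
      1 / 20000 * ∑ u, Real.exp (-(2 * η * f u)) := by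
  have hη0 : 0 < η := by
    by_contra h
    push Not at h
    nlinarith
  have hη1 : 2 * η ≤ 1 / 4 := by nlinarith
  set S := ∑ u, Real.exp (-(2 * η * f u)) with hS
  -- Twenty doublings carry level 44 to level 16^20 · 44, where by the choice of `η` each term of
  -- `S` is still at least 1/e. If the sublevel at 44 is only {0}, nothing is left to count.
  have hlow : ((Finset.univ.erase (0 : G)).filter fun u => f u ≤ 44).card ≤
      Real.exp 1 / 2 ^ 20 * S := by
    by_cases hc : 2 ≤ (sublevel f 44).card
    · have h1 := two_pow_mul_card_sublevel_le hf (by norm_num) hθ hc 20 hθ0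
      have h2 : ((Finset.univ.erase (0 : G)).filter fun u => f u ≤ 44).card ≤
          (sublevel f 44).card := by
        refine Finset.card_le_card fun u hu => ?_
        exact mem_sublevel.2 (Finset.mem_filter.1 hu).2
      have h3 : ((sublevel f (16 ^ 20 * 44)).card : ℝ) * Real.exp (-1) ≤ S := by
        rw [← nsmul_eq_mul]
        refine (Finset.card_nsmul_le_sum _ (fun u => Real.exp (-(2 * η * f u))) _ ?_).trans
          (Finset.sum_le_univ_sum_of_nonneg fun u => (Real.exp_pos _).le)
        intro u hu
        rw [mem_sublevel] at hu
        refine Real.exp_le_exp.2 (neg_le_neg ?_)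
        calc 2 * η * f u ≤ 2 * η * (16 ^ 20 * 44) := by
              exact mul_le_mul_of_nonneg_left hu (by positivity)
          _ = 1 := hη
      have h4 : (2 : ℝ) ^ 20 * ((Finset.univ.erase (0 : G)).filter fun u => f u ≤ 44).card ≤
          (sublevel f (16 ^ 20 * 44)).card := by
        have := (Nat.mul_le_mul_left (2 ^ 20) h2).trans h1
        exact_mod_cast this
      have h5 : Real.exp 1 * Real.exp (-1) = 1 := by rw [← Real.exp_add]; simp
      rw [div_mul_eq_mul_div, le_div_iff₀ (by positivity)]
      calc _ ≤ ((sublevel f (16 ^ 20 * 44)).card : ℝ) := by rw [mul_comm]; exact h4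
        _ = Real.exp 1 * ((sublevel f (16 ^ 20 * 44)).card * Real.exp (-1)) := by
          rw [mul_left_comm, h5, mul_one]
        _ ≤ Real.exp 1 * S := mul_le_mul_of_nonneg_left h3 (Real.exp_pos _).le
    · have h0 : ((Finset.univ.erase (0 : G)).filter fun u => f u ≤ 44) = ∅ := by
        rw [Finset.eq_empty_iff_forall_notMem]
        intro u hu
        rw [Finset.mem_filter, Finset.mem_erase] at hu
        apply hc
        rw [← Finset.card_pair hu.1.1]
        refine Finset.card_le_card fun z hz => ?_
        rw [mem_sublevel]
        rcases Finset.mem_insert.1 hz with rfl | hz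
        · exact hu.2
        · rw [Finset.mem_singleton.1 hz, hf.zero]; norm_num
      rw [h0, Finset.card_empty, Nat.cast_zero]
      exact mul_nonneg (by positivity) (Finset.sum_nonneg fun u _ => (Real.exp_pos _).le)
  -- Above level 44, half of the exponent f/2 already exceeds 11 and the other half f/4 dominates
  -- 2ηf.
  have hhigh : ∑ u ∈ (Finset.univ.erase (0 : G)).filter (fun u => ¬ f u ≤ 44),
      Real.exp (-f u / 2) ≤ Real.exp (-11) * S := by
    rw [hS, Finset.mul_sum]
    refine (Finset.sum_le_sum fun u hu => ?_).trans
      (Finset.sum_le_univ_sum_of_nonneg fun u => by positivity)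
    rw [← Real.exp_add]
    refine Real.exp_le_exp.2 ?_
    have h1 := (Finset.mem_filter.1 hu).2
    push Not at h1
    nlinarith
  have hlow2 : ∑ u ∈ (Finset.univ.erase (0 : G)).filter (fun u => f u ≤ 44),
      Real.exp (-f u / 2) ≤ Real.exp 1 / 2 ^ 20 * S := by
    refine le_trans ?_ hlow
    rw [← nsmul_one]
    refine Finset.sum_le_card_nsmul _ _ _ fun u _ => ?_
    rw [Real.exp_le_one_iff]
    linarith [hf.nonneg u]
  rw [← Finset.sum_filter_add_sum_filter_not _ (fun u => f u ≤ 44)]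
  have hS0 : 0 ≤ S := Finset.sum_nonneg fun u _ => (Real.exp_pos _).le
  have he : Real.exp (-11) ≤ 1 / 50000 := by
    rw [Real.exp_neg, one_div]
    refine inv_anti₀ (by norm_num) ?_
    have h1 : Real.exp 11 = Real.exp 1 ^ 11 := by rw [← Real.exp_nat_mul]; norm_num
    rw [h1]
    calc (50000 : ℝ) ≤ 2.7 ^ 11 := by norm_num
      _ ≤ _ := pow_le_pow_left₀ (by norm_num) (by linarith [Real.exp_one_gt_d9]) 11
  have he2 : Real.exp 1 / 2 ^ 20 ≤ 3 / 1000000 := by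
    have := Real.exp_one_lt_d9
    rw [div_le_iff₀ (by positivity)]
    norm_num
    linarith
  nlinarith

end Growth

/-! ### The Fourier defect of one entry. -/

section Characters

variable {F : Type*} [Field F] [Fintype F]

/-- The Fourier transform of a weight. -/
noncomputable def hat (ψ : AddChar F ℂ) (w : F → ℝ) (t : F) : ℂ := ∑ a, (w a : ℂ) * ψ (t * a)

/-- The defect `1 - |ŵ(t)|²`. -/
noncomputable def gap (ψ : AddChar F ℂ) (w : F → ℝ) (t : F) : ℝ := 1 - ‖hat ψ w t‖ ^ 2

theorem re_addChar_le_one (ψ : AddChar F ℂ) (a : F) : (ψ a).re ≤ 1 := by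
  rw [← AddChar.norm_apply ψ a]; exact Complex.re_le_norm _

theorem norm_hat_sq (ψ : AddChar F ℂ) (w : F → ℝ) (t : F) :
    ‖hat ψ w t‖ ^ 2 = ∑ a, ∑ b, w a * w b * (ψ (t * (a - b))).re := by
  have h1 : ((‖hat ψ w t‖ ^ 2 : ℝ) : ℂ) = ∑ a, ∑ b, (w a : ℂ) * w b * ψ (t * (a - b)) := by
    push_cast
    rw [← Complex.mul_conj', hat, map_sum, Finset.sum_mul_sum]
    refine Finset.sum_congr rfl fun a _ => Finset.sum_congr rfl fun b _ => ?_
    rw [map_mul (starRingEnd ℂ), Complex.conj_ofReal, ← AddChar.map_neg_eq_conj, mul_sub, sub_eq_add_neg,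
      AddChar.map_add_eq_mul]
    ring
  have h2 := congrArg Complex.re h1
  rw [Complex.ofReal_re] at h2
  rw [h2, Complex.re_sum]
  refine Finset.sum_congr rfl fun a _ => ?_
  rw [Complex.re_sum]
  refine Finset.sum_congr rfl fun b _ => ?_
  rw [← Complex.ofReal_mul, Complex.re_ofReal_mul]

/-- With ξ, ξ' independent of law `w`, the defect is the mean of 1 - Re ψ(t(ξ - ξ')). The properties
in `IsQuasiSq` can then be checked term by term. -/
theorem gap_eq {w : F → ℝ} (hw : IsWeight w) (ψ : AddChar F ℂ) (t : F) :
    gap ψ w t = ∑ a, ∑ b, w a * w b * (1 - (ψ (t * (a - b))).re) := by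
  have h1 : (1 : ℝ) = ∑ a, ∑ b, w a * w b := by
    rw [← Finset.sum_mul_sum, hw.2, one_mul]
  rw [gap, norm_hat_sq]
  conv_lhs => rw [h1]
  rw [← Finset.sum_sub_distrib]
  refine Finset.sum_congr rfl fun a _ => ?_
  rw [← Finset.sum_sub_distrib]
  exact Finset.sum_congr rfl fun b _ => by ring

theorem gap_le_one (ψ : AddChar F ℂ) (w : F → ℝ) (t : F) : gap ψ w t ≤ 1 := by
  unfold gap; nlinarith [sq_nonneg ‖hat ψ w t‖]

/-- On the unit circle 1 - Re z = |1 - z|²/2, so the triangle inequality and (a + b)² ≤ 2a² + 2b²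
suffice. -/
theorem one_sub_re_mul_le {z z' : ℂ} (hz : ‖z‖ = 1) (hz' : ‖z'‖ = 1) :
    1 - (z * z').re ≤ 2 * (1 - z.re) + 2 * (1 - z'.re) := by
  have key : ∀ z : ℂ, ‖z‖ = 1 → ‖1 - z‖ ^ 2 = 2 * (1 - z.re) := by
    intro z hz
    have h1 := Complex.sq_norm z
    rw [hz, Complex.normSq_apply] at h1
    rw [Complex.sq_norm, Complex.normSq_apply]
    simp
    nlinarith
  have h1 := key z hz
  have h2 := key z' hz'
  have h3 := key (z * z') (by rw [norm_mul, hz, hz', one_mul])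
  have h4 : ‖1 - z * z'‖ ≤ ‖1 - z‖ + ‖1 - z'‖ := by
    have : 1 - z * z' = (1 - z) + z * (1 - z') := by ring
    rw [this]
    refine (norm_add_le _ _).trans ?_
    rw [norm_mul, hz, one_mul]
  have h5 : ‖1 - z * z'‖ ^ 2 ≤ (‖1 - z‖ + ‖1 - z'‖) ^ 2 :=
    pow_le_pow_left₀ (norm_nonneg _) h4 2
  nlinarith [sq_nonneg (‖1 - z‖ - ‖1 - z'‖)]

theorem isQuasiSq_gap {w : F → ℝ} (hw : IsWeight w) (ψ : AddChar F ℂ) :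
    IsQuasiSq (gap ψ w) where
  zero := by rw [gap_eq hw]; simp
  nonneg t := by
    rw [gap_eq hw]
    refine Finset.sum_nonneg fun a _ => Finset.sum_nonneg fun b _ => ?_
    exact mul_nonneg (mul_nonneg (hw.1 a) (hw.1 b)) (by linarith [re_addChar_le_one ψ (t * (a - b))])
  neg t := by
    rw [gap_eq hw, gap_eq hw]
    refine Finset.sum_congr rfl fun a _ => Finset.sum_congr rfl fun b _ => ?_
    rw [neg_mul, AddChar.map_neg_eq_conj, Complex.conj_re]
  add_le t t' := by
    rw [gap_eq hw, gap_eq hw, gap_eq hw, Finset.mul_sum, Finset.mul_sum, ← Finset.sum_add_distrib]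
    refine Finset.sum_le_sum fun a _ => ?_
    rw [Finset.mul_sum, Finset.mul_sum, ← Finset.sum_add_distrib]
    refine Finset.sum_le_sum fun b _ => ?_
    rw [add_mul, AddChar.map_add_eq_mul]
    have := one_sub_re_mul_le (AddChar.norm_apply ψ (t * (a - b)))
      (AddChar.norm_apply ψ (t' * (a - b)))
    nlinarith [mul_nonneg (hw.1 a) (hw.1 b)]

/-- The balancedness of a weight. -/
def IsBalancedWeight (α : ℝ) (w : F → ℝ) : Prop :=
  ∀ (x : F) (H : AddSubgroup F), H ≠ ⊤ → ∑ a, w a * ind (a - x ∈ H) ≤ 1 - α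

theorem IsBalancedWeight.apply_le {α : ℝ} {w : F → ℝ} (h : IsBalancedWeight α w) (a : F) :
    w a ≤ 1 - α := by
  have := h a ⊥ bot_ne_top
  rw [Finset.sum_eq_single a] at this
  · rwa [ind_true (by simp), mul_one] at this
  · intro b _ hb
    rw [ind_false, mul_zero]
    rwa [AddSubgroup.mem_bot, sub_eq_zero]
  · simp

/-- The average of the defect of a balanced weight over a nontrivial group is at least `α`. -/
theorem mul_card_le_sum_gap {w : F → ℝ} (hw : IsWeight w) {α : ℝ} (hα : IsBalancedWeight α w)
    {ψ : AddChar F ℂ} (hψ : ψ.IsPrimitive) {A : Type*} [AddCommGroup A] [Fintype A] (π : A →+ F)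
    (hπ : π ≠ 0) : α * Fintype.card A ≤ ∑ u, gap ψ w (π u) := by
  classical
  -- `K` annihilates the image of `π`. By orthogonality the average of |ŵ|² over `A` is the
  -- probability that ξ - ξ' lies in `K`; it is at most `1 - α` because primitivity of `ψ` makes `K`
  -- proper.
  let K : AddSubgroup F :=
    { carrier := {c | ∀ u, ψ (π u * c) = 1}
      zero_mem' := by simp
      add_mem' := by
        intro c d hc hd u
        rw [mul_add, AddChar.map_add_eq_mul, hc u, hd u, one_mul]
      neg_mem' := by
        intro c hc u
        rw [mul_neg, AddChar.map_neg_eq_conj, hc u, map_one] }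
  have hK : K ≠ ⊤ := by
    intro h
    obtain ⟨u, hu⟩ := DFunLike.ne_iff.1 hπ
    apply hψ hu
    ext c
    have : c ∈ K := h ▸ AddSubgroup.mem_top c
    simpa [AddChar.mulShift_apply] using this u
  have hsum : ∀ c, ∑ u, (ψ (π u * c)).re = Fintype.card A * ind (c ∈ K) := by
    intro c
    set χ : AddChar A ℂ := ψ.compAddMonoidHom ((AddMonoidHom.mulRight c).comp π) with hχ
    have hχa : ∀ u, χ u = ψ (π u * c) := fun u => rfl
    have h1 := AddChar.sum_eq_ite χ
    simp only [hχa] at h1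
    rw [← Complex.re_sum, h1]
    by_cases hc : c ∈ K
    · have : χ = 0 := by
        ext u; rw [hχa]; exact hc u
      rw [if_pos this, ind_true hc]; simp
    · have : χ ≠ 0 := by
        intro h
        apply hc
        intro u
        rw [← hχa, h]; rfl
      rw [if_neg this, ind_false hc]; simp
  have h2 : ∑ u, ‖hat ψ w (π u)‖ ^ 2 ≤ Fintype.card A * (1 - α) := by
    simp only [norm_hat_sq]
    rw [Finset.sum_comm]
    have h3 : ∀ a, ∑ u, ∑ b, w a * w b * (ψ (π u * (a - b))).re =
        Fintype.card A * ∑ b, w b * (w a * ind (a - b ∈ K)) := by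
      intro a
      rw [Finset.sum_comm, Finset.mul_sum]
      refine Finset.sum_congr rfl fun b _ => ?_
      rw [← Finset.mul_sum, hsum]
      ring
    simp only [h3]
    rw [← Finset.mul_sum, Finset.sum_comm]
    refine mul_le_mul_of_nonneg_left ?_ (Nat.cast_nonneg _)
    calc ∑ b, ∑ a, w b * (w a * ind (a - b ∈ K)) ≤ ∑ b, w b * (1 - α) := by
          refine Finset.sum_le_sum fun b _ => ?_
          rw [← Finset.mul_sum]
          exact mul_le_mul_of_nonneg_left (hα b K hK) (hw.1 b)
      _ = 1 - α := by rw [← Finset.sum_mul, hw.2, one_mul]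
  simp only [gap, Finset.sum_sub_distrib]
  simp
  linarith

theorem norm_hat_le (ψ : AddChar F ℂ) (w : F → ℝ) (t : F) :
    ‖hat ψ w t‖ ≤ Real.exp (-gap ψ w t / 2) := by
  have h1 : ‖hat ψ w t‖ ^ 2 ≤ Real.exp (-gap ψ w t / 2) ^ 2 := by
    rw [← Real.exp_nat_mul]
    have := Real.add_one_le_exp (-gap ψ w t)
    have h2 : ((2 : ℕ) : ℝ) * (-gap ψ w t / 2) = -gap ψ w t := by push_cast; ring
    rw [h2]
    unfold gap at this ⊢
    linarith
  exact (pow_le_pow_iff_left₀ (norm_nonneg _) (Real.exp_pos _).le two_ne_zero).1 h1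

end Characters

/-! ### Fourier analysis of coset probabilities and the lazy law. -/

section Fourier

theorem addChar_sum {ι A : Type*} [AddCommMonoid A] (ψ : AddChar A ℂ) (s : Finset ι) (a : ι → A) :
    ψ (∑ i ∈ s, a i) = ∏ i ∈ s, ψ (a i) := by
  classical
  induction s using Finset.induction_on with
  | empty => simp
  | insert i s hi ih => rw [Finset.sum_insert hi, Finset.prod_insert hi, AddChar.map_add_eq_mul, ih]

open Matrix

variable {F : Type*} [Field F] {n : ℕ}

/-- The orthogonal complement for the standard bilinear form. -/
def perp (V : Submodule F (Fin n → F)) : Submodule F (Fin n → F) where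
  carrier := {v | ∀ w ∈ V, v ⬝ᵥ w = 0}
  zero_mem' := fun w _ => zero_dotProduct w
  add_mem' := fun {a b} ha hb w hw => by rw [add_dotProduct, ha w hw, hb w hw, add_zero]
  smul_mem' := fun c v hv w hw => by rw [smul_dotProduct, hv w hw, smul_zero]

theorem mem_perp {V : Submodule F (Fin n → F)} {v : Fin n → F} :
    v ∈ perp V ↔ ∀ w ∈ V, v ⬝ᵥ w = 0 := Iff.rfl

theorem finrank_perp (V : Submodule F (Fin n → F)) : Module.finrank F (perp V) = codim V := by
  have h : perp V = V.dualAnnihilator.comap (dotProductEquiv F (Fin n) : _ →ₗ[F] _) := by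
    ext v
    simp [mem_perp, Submodule.mem_dualAnnihilator]
  have h2 : Module.finrank F (perp V) = Module.finrank F V.dualAnnihilator := by
    rw [h, Submodule.comap_equiv_eq_map_symm]
    exact LinearEquiv.finrank_map_eq _ _
  rw [h2, codim, ← V.dualQuotEquivDualAnnihilator.finrank_eq, Subspace.dual_finrank_eq]

theorem mem_iff_forall_perp {V : Submodule F (Fin n → F)} {z : Fin n → F} :
    z ∈ V ↔ ∀ u ∈ perp V, u ⬝ᵥ z = 0 := by
  refine ⟨fun hz u hu => hu z hz, fun h => ?_⟩
  by_contra hz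
  obtain ⟨f, hf, hV⟩ := Submodule.exists_le_ker_of_notMem hz
  apply hf
  have h1 : ∀ w, f w = (dotProductEquiv F (Fin n)).symm f ⬝ᵥ w := by
    intro w
    rw [← dotProductEquiv_apply_apply, LinearEquiv.apply_symm_apply]
  rw [h1]
  refine h _ fun w hw => ?_
  rw [← h1]; exact hV hw

variable [Fintype F]

noncomputable instance (V : Submodule F (Fin n → F)) : Fintype (perp V) := Fintype.ofFinite _

theorem card_perp (V : Submodule F (Fin n → F)) :
    Fintype.card (perp V) = Fintype.card F ^ codim V := by
  rw [Module.card_eq_pow_finrank (K := F), finrank_perp]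

theorem sum_addChar_perp {ψ : AddChar F ℂ} (hψ : ψ.IsPrimitive) (V : Submodule F (Fin n → F))
    (z : Fin n → F) :
    ∑ u : perp V, ψ ((u : Fin n → F) ⬝ᵥ z) = (Fintype.card F : ℂ) ^ codim V * ind (z ∈ V) := by
  classical
  set χ : AddChar (perp V) ℂ := ψ.compAddMonoidHom
    { toFun := fun u : perp V => (u : Fin n → F) ⬝ᵥ z
      map_zero' := by simp
      map_add' := fun a b => by simp [add_dotProduct] } with hχ
  have hχa : ∀ u, χ u = ψ ((u : Fin n → F) ⬝ᵥ z) := fun u => rfl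
  have h1 := AddChar.sum_eq_ite χ
  simp only [hχa] at h1
  rw [h1]
  by_cases hz : z ∈ V
  · have : χ = 0 := by
      ext u
      rw [hχa, u.2 z hz]; simp
    rw [if_pos this, ind_true hz, card_perp]; simp
  · have : χ ≠ 0 := by
      intro h
      apply hz
      rw [mem_iff_forall_perp]
      intro u hu
      by_contra hne
      apply hψ hne
      ext c
      have h2 : χ ⟨c • u, (perp V).smul_mem c hu⟩ = 1 := by rw [h]; rfl
      rw [hχa, smul_dotProduct, smul_eq_mul, mul_comm] at h2
      simpa [AddChar.mulShift_apply] using h2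
    rw [if_neg this, ind_false hz]; simp

/-- The Fourier transform of the law of a vector with independent coordinates. -/
noncomputable def vecHat (ψ : AddChar F ℂ) (w : Fin n → F → ℝ) (u : Fin n → F) : ℂ :=
  ∏ j, hat ψ (w j) (u j)

/-- The sum over the coordinates of the defects. -/
noncomputable def totalGap (ψ : AddChar F ℂ) (w : Fin n → F → ℝ) (u : Fin n → F) : ℝ :=
  ∑ j, gap ψ (w j) (u j)

theorem sum_prodWeight_mul_addChar (ψ : AddChar F ℂ) (w : Fin n → F → ℝ) (u : Fin n → F) :
    ∑ y : Fin n → F, ((∏ j, w j (y j) : ℝ) : ℂ) * ψ (u ⬝ᵥ y) = vecHat ψ w u := by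
  unfold vecHat hat
  rw [Finset.prod_univ_sum, Fintype.piFinset_univ]
  refine Finset.sum_congr rfl fun y _ => ?_
  rw [Finset.prod_mul_distrib, dotProduct, addChar_sum]
  push_cast
  rfl

theorem cosetProb_eq_sum {ψ : AddChar F ℂ} (hψ : ψ.IsPrimitive) (w : Fin n → F → ℝ)
    (x : Fin n → F) (V : Submodule F (Fin n → F)) :
    (cosetProb w x V : ℂ) = ((Fintype.card F : ℂ) ^ codim V)⁻¹ *
      ∑ u : perp V, ψ (-((u : Fin n → F) ⬝ᵥ x)) * vecHat ψ w u := by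
  have hq : (Fintype.card F : ℂ) ^ codim V ≠ 0 := by simp
  rw [eq_inv_mul_iff_mul_eq₀ hq]
  unfold cosetProb expect
  push_cast
  rw [Finset.mul_sum]
  have h1 : ∀ y : Fin n → F, (Fintype.card F : ℂ) ^ codim V *
      ((∏ j, (w j (y j) : ℂ)) * (ind (y - x ∈ V) : ℂ)) =
      ∑ u : perp V, ψ (-((u : Fin n → F) ⬝ᵥ x)) *
        (((∏ j, w j (y j) : ℝ) : ℂ) * ψ ((u : Fin n → F) ⬝ᵥ y)) := by
    intro y
    rw [mul_left_comm, ← sum_addChar_perp hψ V (y - x), Finset.mul_sum]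
    refine Finset.sum_congr rfl fun u _ => ?_
    rw [dotProduct_sub, sub_eq_neg_add, AddChar.map_add_eq_mul]
    push_cast; ring
  simp only [h1]
  rw [Finset.sum_comm]
  refine Finset.sum_congr rfl fun u _ => ?_
  rw [← Finset.mul_sum, sum_prodWeight_mul_addChar]

theorem vecHat_zero {w : Fin n → F → ℝ} (hw : ∀ j, IsWeight (w j)) (ψ : AddChar F ℂ) :
    vecHat ψ w 0 = 1 := by
  unfold vecHat hat
  refine Finset.prod_eq_one fun j _ => ?_
  simp only [Pi.zero_apply, zero_mul, AddChar.map_zero_eq_one, mul_one]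
  exact_mod_cast (hw j).2

theorem norm_vecHat_le (ψ : AddChar F ℂ) (w : Fin n → F → ℝ) (u : Fin n → F) :
    ‖vecHat ψ w u‖ ≤ Real.exp (-totalGap ψ w u / 2) := by
  unfold vecHat totalGap
  rw [norm_prod, neg_div, Finset.sum_div, ← Finset.sum_neg_distrib, Real.exp_sum]
  refine Finset.prod_le_prod (fun j _ => norm_nonneg _) fun j _ => ?_
  rw [← neg_div]
  exact norm_hat_le ψ (w j) (u j)

theorem isQuasiSq_totalGap {w : Fin n → F → ℝ} (hw : ∀ j, IsWeight (w j)) (ψ : AddChar F ℂ) :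
    IsQuasiSq (totalGap ψ w) where
  zero := Finset.sum_eq_zero fun j _ => (isQuasiSq_gap (hw j) ψ).zero
  nonneg u := Finset.sum_nonneg fun j _ => (isQuasiSq_gap (hw j) ψ).nonneg _
  neg u := Finset.sum_congr rfl fun j _ => (isQuasiSq_gap (hw j) ψ).neg _
  add_le u v := by
    unfold totalGap
    rw [Finset.mul_sum, Finset.mul_sum, ← Finset.sum_add_distrib]
    exact Finset.sum_le_sum fun j _ => (isQuasiSq_gap (hw j) ψ).add_le _ _

theorem IsQuasiSq.restrict {f : (Fin n → F) → ℝ} (hf : IsQuasiSq f)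
    (W : Submodule F (Fin n → F)) : IsQuasiSq (fun u : W => f u) where
  zero := hf.zero
  nonneg _ := hf.nonneg _
  neg _ := hf.neg _
  add_le _ _ := hf.add_le _ _

/-- In the inversion formula the term u = 0 is exactly the uniform value; the others are bounded
through |ŵ| ≤ exp(-gap/2). -/
theorem abs_cosetProb_sub_le [DecidableEq F] {w : Fin n → F → ℝ} (hw : ∀ j, IsWeight (w j))
    {ψ : AddChar F ℂ} (hψ : ψ.IsPrimitive) (x : Fin n → F) (V : Submodule F (Fin n → F)) :
    |cosetProb w x V - 1 / (Fintype.card F : ℝ) ^ codim V| ≤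
      ((Fintype.card F : ℝ) ^ codim V)⁻¹ *
        ∑ u ∈ Finset.univ.erase (0 : perp V), Real.exp (-totalGap ψ w u / 2) := by
  have h1 := cosetProb_eq_sum hψ w x V
  rw [← Finset.add_sum_erase _ _ (Finset.mem_univ (0 : perp V))] at h1
  have h2 : (((cosetProb w x V - 1 / (Fintype.card F : ℝ) ^ codim V : ℝ)) : ℂ) =
      ((Fintype.card F : ℂ) ^ codim V)⁻¹ * ∑ u ∈ Finset.univ.erase (0 : perp V),
        ψ (-((u : Fin n → F) ⬝ᵥ x)) * vecHat ψ w u := by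
    push_cast
    rw [h1]
    simp [vecHat_zero hw]
    ring
  rw [← Real.norm_eq_abs, ← Complex.norm_real, h2, norm_mul, norm_inv, norm_pow,
    Complex.norm_natCast]
  refine mul_le_mul_of_nonneg_left ?_ (by positivity)
  refine (norm_sum_le _ _).trans (Finset.sum_le_sum fun u _ => ?_)
  rw [norm_mul, AddChar.norm_apply, one_mul]
  exact norm_vecHat_le ψ w u

/-- The law of `b * (ξ - ξ')`, with `ξ`, `ξ'` independent of law `w` and `b` Bernoulli of
parameter `η`. -/
noncomputable def lazyWeight (η : ℝ) (w : F → ℝ) (a : F) : ℝ :=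
  (1 - η) * ind (a = 0) + η * ∑ b, w b * w (a + b)

theorem isWeight_lazyWeight {η : ℝ} (h0 : 0 ≤ η) (h1 : η ≤ 1) {w : F → ℝ} (hw : IsWeight w) :
    IsWeight (lazyWeight η w) := by
  refine ⟨fun a => ?_, ?_⟩
  · refine add_nonneg (mul_nonneg (by linarith) (ind_nonneg _)) (mul_nonneg h0 ?_)
    exact Finset.sum_nonneg fun b _ => mul_nonneg (hw.1 _) (hw.1 _)
  · unfold lazyWeight
    rw [Finset.sum_add_distrib, ← Finset.mul_sum, ← Finset.mul_sum, Finset.sum_comm]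
    have h2 : ∑ a : F, ind (a = 0) = 1 := by
      rw [Finset.sum_eq_single 0, ind_true rfl]
      · intro b _ hb; exact ind_false hb
      · simp
    have h3 : ∑ b, ∑ a, w b * w (a + b) = 1 := by
      have : ∀ b, ∑ a, w b * w (a + b) = w b := by
        intro b
        rw [← Finset.mul_sum, show ∑ a, w (a + b) = ∑ a, w a from
          Equiv.sum_comp (Equiv.addRight b) w, hw.2, mul_one]
      simp only [this, hw.2]
    rw [h2, h3]; ring

theorem lazyWeight_le {η : ℝ} (h0 : 0 ≤ η) (h1 : η ≤ 1) {w : F → ℝ} (hw : IsWeight w) {α : ℝ}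
    (hα : ∀ a, w a ≤ 1 - α) (a : F) : lazyWeight η w a ≤ 1 - α * η := by
  have h2 : ∑ b, w b * w (a + b) ≤ 1 - α := by
    calc ∑ b, w b * w (a + b) ≤ ∑ b, w b * (1 - α) :=
          Finset.sum_le_sum fun b _ => mul_le_mul_of_nonneg_left (hα _) (hw.1 _)
      _ = 1 - α := by rw [← Finset.sum_mul, hw.2, one_mul]
  unfold lazyWeight
  nlinarith [ind_le_one (a = 0), ind_nonneg (a = 0)]

theorem hat_lazyWeight (η : ℝ) (ψ : AddChar F ℂ) (w : F → ℝ) (t : F) :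
    hat ψ (lazyWeight η w) t = ((1 - η * gap ψ w t : ℝ) : ℂ) := by
  have h1 : ∑ a, ((∑ b, w b * w (a + b) : ℝ) : ℂ) * ψ (t * a) = ((‖hat ψ w t‖ ^ 2 : ℝ) : ℂ) := by
    push_cast
    rw [← Complex.mul_conj', hat, map_sum, Finset.sum_mul_sum]
    simp only [Finset.sum_mul]
    rw [Finset.sum_comm, Finset.sum_comm (s := Finset.univ (α := F))]
    rw [Finset.sum_comm]
    conv_rhs => rw [Finset.sum_comm]
    refine Finset.sum_congr rfl fun b _ => ?_
    rw [← Equiv.sum_comp (Equiv.addRight b) (fun a => (w a : ℂ) * ψ (t * a) *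
      (starRingEnd ℂ) ((w b : ℂ) * ψ (t * b)))]
    refine Finset.sum_congr rfl fun a _ => ?_
    simp only [Equiv.coe_addRight]
    rw [map_mul (starRingEnd ℂ), Complex.conj_ofReal, ← AddChar.map_neg_eq_conj]
    have : ψ (t * a) = ψ (t * (a + b)) * ψ (-(t * b)) := by
      rw [← AddChar.map_add_eq_mul]; congr 1; ring
    rw [this]; ring
  have h2 : ∑ a : F, ((ind (a = 0) : ℝ) : ℂ) * ψ (t * a) = 1 := by
    rw [Finset.sum_eq_single 0]
    · rw [ind_true rfl]; simp
    · intro b _ hb; rw [ind_false hb]; simp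
    · simp
  unfold gap
  push_cast at h1 ⊢
  rw [hat]
  unfold lazyWeight
  push_cast
  simp only [add_mul, Finset.sum_add_distrib, mul_assoc]
  rw [← Finset.mul_sum, ← Finset.mul_sum, h2, h1]
  ring

/-- The transform of the lazy law is 1 - η·gap ≥ 1/2 in each coordinate, so the inversion sum has no
cancellation, and 1 - s ≥ e^(-2s) for 0 ≤ s ≤ 1/2 bounds it below. -/
theorem le_cosetProb_lazyWeight {η : ℝ} (h0 : 0 ≤ η) (h1 : η ≤ 1 / 2) {w : Fin n → F → ℝ}
    (hw : ∀ j, IsWeight (w j))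
    {ψ : AddChar F ℂ} (hψ : ψ.IsPrimitive) (V : Submodule F (Fin n → F)) :
    ((Fintype.card F : ℝ) ^ codim V)⁻¹ * ∑ u : perp V, Real.exp (-(2 * η * totalGap ψ w u)) ≤
      cosetProb (fun j => lazyWeight η (w j)) 0 V := by
  have h2 := cosetProb_eq_sum hψ (fun j => lazyWeight η (w j)) 0 V
  have h3 : cosetProb (fun j => lazyWeight η (w j)) 0 V =
      ((Fintype.card F : ℝ) ^ codim V)⁻¹ *
        ∑ u : perp V, ∏ j, (1 - η * gap ψ (w j) ((u : Fin n → F) j)) := by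
    have h4 : (cosetProb (fun j => lazyWeight η (w j)) 0 V : ℂ) =
      ((((Fintype.card F : ℝ) ^ codim V)⁻¹ *
        ∑ u : perp V, ∏ j, (1 - η * gap ψ (w j) ((u : Fin n → F) j)) : ℝ) : ℂ) := by
      rw [h2]
      push_cast
      congr 1
      refine Finset.sum_congr rfl fun u _ => ?_
      rw [dotProduct_zero, neg_zero, AddChar.map_zero_eq_one, one_mul, vecHat]
      refine Finset.prod_congr rfl fun j _ => ?_
      rw [hat_lazyWeight]; push_cast; ring
    exact_mod_cast h4
  rw [h3]
  refine mul_le_mul_of_nonneg_left (Finset.sum_le_sum fun u _ => ?_) (by positivity)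
  unfold totalGap
  rw [Finset.mul_sum, ← Finset.sum_neg_distrib, Real.exp_sum]
  refine Finset.prod_le_prod (fun j _ => (Real.exp_pos _).le) fun j _ => ?_
  set g := gap ψ (w j) ((u : Fin n → F) j) with hg
  have hg1 : g ≤ 1 := gap_le_one _ _ _
  have hg0 : 0 ≤ g := (isQuasiSq_gap (hw j) ψ).nonneg _
  have hx : η * g ≤ 1 / 2 := by nlinarith
  have hx0 : 0 ≤ η * g := mul_nonneg h0 hg0
  have h5 : Real.exp (-(2 * η * g)) * (1 + 2 * (η * g)) ≤ 1 := by
    have := Real.add_one_le_exp (2 * (η * g))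
    calc _ ≤ Real.exp (-(2 * η * g)) * Real.exp (2 * (η * g)) :=
          mul_le_mul_of_nonneg_left (by linarith) (Real.exp_pos _).le
      _ = 1 := by rw [← Real.exp_add]; ring_nf; exact Real.exp_zero
  have h6 : 1 ≤ (1 - η * g) * (1 + 2 * (η * g)) := by nlinarith
  exact le_of_mul_le_mul_right (h5.trans h6) (by linarith)

/-- If `V` is not sparse then nontrivial groups orthogonal to `V` contain an element of large
defect. -/
theorem exists_le_totalGap {w : Fin n → F → ℝ} (hw : ∀ j, IsWeight (w j)) {α C : ℝ} (hα0 : 0 < α)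
    (hα : ∀ j, IsBalancedWeight α (w j)) {ψ : AddChar F ℂ} (hψ : ψ.IsPrimitive)
    {V : Submodule F (Fin n → F)} (hV : ¬ IsSparse (C / α) V) (H : AddSubgroup (perp V))
    (hH : H ≠ ⊥) : ∃ u ∈ H, C ≤ totalGap ψ w u := by
  classical
  obtain ⟨u₀, hne⟩ := H.ne_bot_iff_exists_ne_zero.1 hH
  have hne' : ((u₀ : perp V) : Fin n → F) ≠ 0 := by
    intro h; apply hne; ext1; ext1; exact h
  have hsupp : C / α < ((Function.support ((u₀ : perp V) : Fin n → F)).ncard : ℝ) := by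
    by_contra h
    push Not at h
    exact hV ⟨_, hne', fun w hw => (u₀ : perp V).2 w hw, h⟩
  by_contra hcon
  push Not at hcon
  have hlt : ∑ u : H, totalGap ψ w ((u : perp V) : Fin n → F) ≤ ∑ u : H, C :=
    Finset.sum_le_sum fun u _ => (hcon u u.2).le
  -- Each coordinate in the support of `u₀` is a nonzero homomorphism on `H`, so its defect averages
  -- at least `α`. There are more than C/α such coordinates, hence the total defect averages more
  -- than `C`.
  have hge : α * Fintype.card H * (Function.support ((u₀ : perp V) : Fin n → F)).ncard ≤
      ∑ u : H, totalGap ψ w ((u : perp V) : Fin n → F) := by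
    unfold totalGap
    rw [Finset.sum_comm, Set.ncard_eq_toFinset_card', mul_comm, ← nsmul_eq_mul]
    refine (Finset.card_nsmul_le_sum _ (fun j => ∑ u : H, gap ψ (w j) (((u : perp V) :
      Fin n → F) j)) _ fun j hj => ?_).trans
      (Finset.sum_le_univ_sum_of_nonneg fun j => Finset.sum_nonneg fun u _ =>
        (isQuasiSq_gap (hw j) ψ).nonneg _)
    let π : H →+ F :=
      { toFun := fun u => ((u : perp V) : Fin n → F) j
        map_zero' := rfl
        map_add' := fun _ _ => rfl }
    refine mul_card_le_sum_gap (hw j) (hα j) hψ π ?_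
    intro h
    rw [Set.mem_toFinset, Function.mem_support] at hj
    exact hj (DFunLike.congr_fun h u₀)
  have hcard : (0 : ℝ) < Fintype.card H := by exact_mod_cast Fintype.card_pos
  rw [div_lt_iff₀ hα0] at hsupp
  simp only [Finset.sum_const, Finset.card_univ, nsmul_eq_mul] at hlt
  nlinarith

end Fourier

/-! ### Semisaturated subspaces: few of them, each unlikely. -/

section Semisaturated

open Matrix

variable {F : Type*} [Field F] {n : ℕ}

theorem vecMul_mem_rowSpace (M : Matrix (Fin n) (Fin n) F) (a : F) {r : Fin n → F}
    (hr : r ∈ rowSpace (M - a • (1 : Matrix (Fin n) (Fin n) F))) :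
    r ᵥ* M ∈ rowSpace (M - a • (1 : Matrix (Fin n) (Fin n) F)) := by
  induction hr using Submodule.span_induction with
  | mem x hx =>
    obtain ⟨i, rfl⟩ := hx
    have h1 : (M - a • (1 : Matrix (Fin n) (Fin n) F)) * M =
        M * (M - a • (1 : Matrix (Fin n) (Fin n) F)) := by
      rw [sub_mul, mul_sub]; simp
    have h2 : (M - a • (1 : Matrix (Fin n) (Fin n) F)).row i ᵥ* M =
        ((M - a • (1 : Matrix (Fin n) (Fin n) F)) * M) i := by
      rw [Matrix.mul_apply_eq_vecMul]; rfl
    rw [h2, h1]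
    exact mul_row_mem_rowSpace _ _ _
  | zero => rw [Matrix.zero_vecMul]; exact Submodule.zero_mem _
  | add x y _ _ hx hy => rw [Matrix.add_vecMul]; exact Submodule.add_mem _ hx hy
  | smul c x _ hx => rw [Matrix.smul_vecMul]; exact Submodule.smul_mem _ _ hx

/-- `M` commutes with `M - a`, so every row space is stable under right multiplication by `M`;
dually, the complement of their intersection is stable under `M`. -/
theorem mulVec_mem_perp_rowInter {m : ℕ} (lam : Fin m → F) (M : Matrix (Fin n) (Fin n) F)
    {u : Fin n → F} (hu : u ∈ perp (rowInter lam M)) : M *ᵥ u ∈ perp (rowInter lam M) := by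
  intro r hr
  rw [dotProduct_comm, Matrix.dotProduct_mulVec, dotProduct_comm]
  refine hu _ ?_
  rw [rowInter, Submodule.mem_iInf] at hr ⊢
  exact fun j => vecMul_mem_rowSpace M _ (hr j)

variable [Fintype F]

theorem sum_prodWeight_ind_le {w : Fin n → F → ℝ} (hw : ∀ j, IsWeight (w j))
    {V : Submodule F (Fin n → F)} {B : ℝ} (hB : ∀ x, cosetProb w x V ≤ B) (p : (Fin n → F) → Prop)
    (hp : ∀ r r', p r → p r' → r - r' ∈ V) : ∑ r, prodWeight w r * ind (p r) ≤ B := by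
  by_cases h : ∃ r, p r
  · obtain ⟨r₀, hr₀⟩ := h
    refine le_trans ?_ (hB r₀)
    exact expect_mono hw fun r => ind_mono fun hr => hp r r₀ hr hr₀
  · push Not at h
    refine le_trans (le_of_eq (Finset.sum_eq_zero fun r _ => ?_))
      ((cosetProb_nonneg hw 0 V).trans (hB 0))
    rw [ind_false (h r), mul_zero]

/-- A union bound over the matrix T of the action of `M` on the complement of `V`. Once T is fixed,
the products of row i with a basis of the complement are prescribed, so the row lies in a single
coset of `V`. -/
theorem expect_rowInter_eq_le {w : Fin n → Fin n → F → ℝ} (hw : ∀ i j, IsWeight (w i j)) {m : ℕ}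
    (lam : Fin m → F) (V : Submodule F (Fin n → F)) {B : ℝ}
    (hB : ∀ i x, cosetProb (w i) x V ≤ B) :
    expect (fun i => prodWeight (w i)) (fun M => ind (rowInter lam (Matrix.of M) = V)) ≤
      (Fintype.card F : ℝ) ^ (codim V * codim V) * B ^ n := by
  have hW : ∀ i, IsWeight (prodWeight (w i)) := fun i => isWeight_prodWeight (hw i)
  let b := Module.finBasisOfFinrankEq F (perp V) (finrank_perp V)
  have hle : ∀ M : Fin n → Fin n → F, ind (rowInter lam (Matrix.of M) = V) ≤
      ∑ T : Fin (codim V) → Fin (codim V) → F, ind (∀ i ∈ (Finset.univ : Finset (Fin n)),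
        ∀ l, M i ⬝ᵥ (b l : Fin n → F) = ∑ l', T l l' * (b l' : Fin n → F) i) := by
    intro M
    refine (ind_mono fun hV => ?_).trans (ind_exists_le Finset.univ _)
    have hmem : ∀ l, Matrix.of M *ᵥ (b l : Fin n → F) ∈ perp V := by
      intro l
      have := mulVec_mem_perp_rowInter lam (Matrix.of M) (u := b l) (hV.symm ▸ (b l).2)
      rwa [hV] at this
    refine ⟨fun l l' => b.repr ⟨_, hmem l⟩ l', Finset.mem_univ _, fun i _ l => ?_⟩
    have h1 := congrArg (fun z : perp V => (z : Fin n → F) i) (b.sum_repr ⟨_, hmem l⟩)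
    simp only [Submodule.coe_sum, Submodule.coe_smul, Finset.sum_apply, Pi.smul_apply,
      smul_eq_mul] at h1
    rw [h1]
    rfl
  refine (expect_mono hW hle).trans ?_
  rw [expect_sum]
  have hcard : (Fintype.card (Fin (codim V) → Fin (codim V) → F) : ℝ) =
      (Fintype.card F : ℝ) ^ (codim V * codim V) := by
    simp [pow_mul]
  rw [← hcard]
  rw [← nsmul_eq_mul, ← Finset.card_univ]
  refine Finset.sum_le_card_nsmul _ _ _ fun T _ => ?_
  have := expect_ind_forall_le hW Finset.univ (fun i r => ∀ l, r ⬝ᵥ (b l : Fin n → F) =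
    ∑ l', T l l' * (b l' : Fin n → F) i) (B := B) ?_
  · simpa using this
  intro i _
  refine sum_prodWeight_ind_le (hw i) (hB i) _ fun r r' hr hr' => ?_
  rw [mem_iff_forall_perp]
  intro u hu
  have h2 := congrArg (fun z : perp V => (z : Fin n → F)) (b.sum_repr ⟨u, hu⟩)
  simp only [Submodule.coe_sum, Submodule.coe_smul] at h2
  rw [← h2, sum_dotProduct]
  refine Finset.sum_eq_zero fun l _ => ?_
  rw [smul_dotProduct, dotProduct_comm, sub_dotProduct, hr l, hr' l, sub_self, smul_zero]

/-- The subspaces of codimension `k` whose complement meets `S i \ {0}` for some `i`. -/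
theorem card_subspaces_le (k : ℕ) (S : Fin n → Finset (Fin n → F)) {A : ℕ}
    (hA : ∀ i, (S i).card ≤ A) (𝒱 : Finset (Submodule F (Fin n → F)))
    (h𝒱 : ∀ V ∈ 𝒱, codim V = k ∧ ∃ i, ∃ u ∈ perp V, u ≠ 0 ∧ u ∈ S i) :
    𝒱.card * Fintype.card F ^ n ≤
      n * Fintype.card F ^ k * (Fintype.card F ^ (n * k) * A) := by
  classical
  -- Subspaces are counted by bases of their complements; a pair (i, t) records the row and the
  -- coordinates of the vector lying in `S i`.
  set Bad : Fin n × (Fin k → F) → Finset (Fin k → Fin n → F) := fun p =>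
    Finset.univ.filter fun b => p.2 ≠ 0 ∧ ∑ l, p.2 l • b l ∈ S p.1 with hBad
  have hbas : ∀ V ∈ 𝒱, ∃ b : Fin k → Fin n → F, perp V = Submodule.span F (Set.range b) ∧
      b ∈ Finset.univ.biUnion Bad := by
    intro V hV
    obtain ⟨hk, i, u, hu, hu0, huS⟩ := h𝒱 V hV
    let b := Module.finBasisOfFinrankEq F (perp V) ((finrank_perp V).trans hk)
    have h2 : ∀ u (hu : u ∈ perp V), ∑ l, b.repr ⟨u, hu⟩ l • (b l : Fin n → F) = u := by
      intro u hu
      have := congrArg (fun z : perp V => (z : Fin n → F)) (b.sum_repr ⟨u, hu⟩)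
      simpa only [Submodule.coe_sum, Submodule.coe_smul] using this
    refine ⟨fun l => b l, le_antisymm ?_ ?_, ?_⟩
    · intro u hu
      rw [← h2 u hu]
      exact Submodule.sum_mem _ fun l _ =>
        Submodule.smul_mem _ _ (Submodule.subset_span ⟨l, rfl⟩)
    · rw [Submodule.span_le]
      rintro _ ⟨l, rfl⟩
      exact (b l).2
    · rw [Finset.mem_biUnion]
      refine ⟨(i, fun l => b.repr ⟨u, hu⟩ l), Finset.mem_univ _, ?_⟩
      rw [hBad, Finset.mem_filter]
      refine ⟨Finset.mem_univ _, ?_, ?_⟩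
      · intro h0
        apply hu0
        rw [← h2 u hu]
        have h0' : ∀ l, b.repr ⟨u, hu⟩ l = 0 := fun l => congrFun h0 l
        exact Finset.sum_eq_zero fun l _ => by rw [h0' l, zero_smul]
      · simpa only [h2 u hu] using huS
  choose! bas hspan hmem using hbas
  have hinj : Set.InjOn bas 𝒱 := by
    intro V hV V' hV' h
    have h1 : perp V = perp V' := by rw [hspan V hV, hspan V' hV', h]
    ext z
    rw [mem_iff_forall_perp, mem_iff_forall_perp, h1]
  have hcard : 𝒱.card ≤ (Finset.univ.biUnion Bad).card :=
    Finset.card_le_card_of_injOn bas (fun V hV => hmem V hV) hinj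
  have hfib : ∀ p, (Bad p).card * Fintype.card F ^ n ≤ Fintype.card F ^ (n * k) * A := by
    rintro ⟨i, t⟩
    by_cases ht : t = 0
    · have : Bad (i, t) = ∅ := by
        rw [hBad]; simp [ht]
      rw [this]; simp
    · obtain ⟨l₀, hl₀⟩ := Function.ne_iff.1 ht
      -- As t_{l₀} ≠ 0, the combination ∑ t_l b_l and the vectors b_l with l ≠ l₀ recover b_{l₀}.
      have hle : (Bad (i, t)).card ≤
          (S i ×ˢ (Finset.univ : Finset ({l : Fin k // l ≠ l₀} → Fin n → F))).card := by
        refine Finset.card_le_card_of_injOn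
          (fun b => (∑ l, t l • b l, fun l => b l)) ?_ ?_
        · intro b hb
          have hb' := (Finset.mem_filter.1 hb).2.2
          simpa using hb'
        · intro b _ b' _ h
          simp only [Prod.mk.injEq] at h
          have hne : ∀ l, l ≠ l₀ → b l = b' l := fun l hl => congrFun h.2 ⟨l, hl⟩
          have h3 := h.1
          rw [← Finset.add_sum_erase _ _ (Finset.mem_univ l₀),
            ← Finset.add_sum_erase _ (fun l => t l • b' l) (Finset.mem_univ l₀),
            Finset.sum_congr rfl fun l hl => by rw [hne l (Finset.ne_of_mem_erase hl)]] at h3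
          have h4 := smul_right_injective _ hl₀ (add_right_cancel h3)
          ext1 l
          by_cases hl : l = l₀
          · rw [hl]; exact h4
          · exact hne l hl
      have hk : 0 < k := Fin.pos l₀
      rw [Finset.card_product] at hle
      have hc : (Finset.univ : Finset ({l : Fin k // l ≠ l₀} → Fin n → F)).card =
          Fintype.card F ^ (n * (k - 1)) := by
        rw [Finset.card_univ, Fintype.card_fun, Fintype.card_fun, Fintype.card_fin]
        rw [Fintype.card_subtype_compl, Fintype.card_fin]
        simp [pow_mul]
      rw [hc] at hle
      calc (Bad (i, t)).card * Fintype.card F ^ n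
          ≤ ((S i).card * Fintype.card F ^ (n * (k - 1))) * Fintype.card F ^ n :=
            Nat.mul_le_mul_right _ hle
        _ = Fintype.card F ^ (n * k) * (S i).card := by
            obtain ⟨k', rfl⟩ : ∃ k', k = k' + 1 := ⟨k - 1, by omega⟩
            rw [Nat.add_sub_cancel, mul_add, mul_one, pow_add]; ring
        _ ≤ _ := Nat.mul_le_mul_left _ (hA i)
  calc 𝒱.card * Fintype.card F ^ n
      ≤ (∑ p, (Bad p).card) * Fintype.card F ^ n :=
        Nat.mul_le_mul_right _ (hcard.trans Finset.card_biUnion_le)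
    _ = ∑ p, (Bad p).card * Fintype.card F ^ n := Finset.sum_mul _ _ _
    _ ≤ ∑ p : Fin n × (Fin k → F), Fintype.card F ^ (n * k) * A :=
        Finset.sum_le_sum fun p _ => hfib p
    _ = _ := by simp [Fintype.card_prod]

/-- Defects average at least `α` on every nontrivial subgroup, so twenty doublings are available.
When the sublevel is a single point, `q ≥ 2 ^ 20` is needed instead. -/
theorem card_sublevel_gap_le {w : F → ℝ} (hw : IsWeight w) {α : ℝ}
    (hα : IsBalancedWeight α w) {ψ : AddChar F ℂ} (hψ : ψ.IsPrimitive) {h : ℝ} (h0 : 0 ≤ h)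
    (hh : 16 ^ 20 * h < α) (hq : 2 ^ 20 ≤ Fintype.card F) :
    2 ^ 20 * (sublevel (gap ψ w) h).card ≤ Fintype.card F := by
  classical
  by_cases h2 : 2 ≤ (sublevel (gap ψ w) h).card
  · refine (two_pow_mul_card_sublevel_le (isQuasiSq_gap hw ψ) h0 (fun H hH => ?_) h2 20 hh).trans
      (Finset.card_le_univ _)
    by_contra hcon
    push Not at hcon
    have h3 := mul_card_le_sum_gap hw hα hψ H.subtype (by
      intro h
      apply hH
      rw [eq_bot_iff]
      intro u hu
      exact DFunLike.congr_fun h (⟨u, hu⟩ : H))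
    have h4 : ∑ u : H, gap ψ w (H.subtype u) < ∑ _u : H, α :=
      Finset.sum_lt_sum_of_nonempty ⟨0, Finset.mem_univ _⟩ fun u _ => hcon u u.2
    simp only [Finset.sum_const, Finset.card_univ, nsmul_eq_mul] at h4
    linarith
  · calc _ ≤ 2 ^ 20 * 1 := Nat.mul_le_mul_left _ (by omega)
      _ ≤ _ := by simpa using hq

/-- By Markov at least half of the coordinates have defect at most `h`, each such coordinate saving
2^20. The choice of this set of coordinates costs 2^n, leaving 2^(10n)/2^n. -/
theorem card_sublevel_totalGap_le {w : Fin n → F → ℝ} (hw : ∀ j, IsWeight (w j)) {α : ℝ}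
    (hα : ∀ j, IsBalancedWeight α (w j)) {ψ : AddChar F ℂ} (hψ : ψ.IsPrimitive)
    {h Y : ℝ} (h0 : 0 < h) (hh : 16 ^ 20 * h < α) (hq : 2 ^ 20 ≤ Fintype.card F)
    (hY : 2 * Y ≤ h * n) :
    2 ^ (9 * n) * (sublevel (totalGap ψ w) Y).card ≤ Fintype.card F ^ n := by
  classical
  set box : Finset (Fin n) → Finset (Fin n → F) := fun J =>
    Fintype.piFinset fun j => if j ∈ J then sublevel (gap ψ (w j)) h else Finset.univ with hbox
  set 𝒥 : Finset (Finset (Fin n)) := Finset.univ.filter fun J => n ≤ 2 * J.card with h𝒥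
  have hsub : sublevel (totalGap ψ w) Y ⊆ 𝒥.biUnion box := by
    intro v hv
    rw [mem_sublevel] at hv
    rw [Finset.mem_biUnion]
    refine ⟨Finset.univ.filter fun j => gap ψ (w j) (v j) ≤ h, ?_, ?_⟩
    · rw [h𝒥, Finset.mem_filter]
      refine ⟨Finset.mem_univ _, ?_⟩
      have h1 := Finset.card_filter_add_card_filter_not (s := (Finset.univ : Finset (Fin n)))
        (fun j => gap ψ (w j) (v j) ≤ h)
      rw [Finset.card_univ, Fintype.card_fin] at h1
      have h2 : ((Finset.univ.filter fun j => ¬ gap ψ (w j) (v j) ≤ h).card : ℝ) * h ≤ Y := by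
        rw [← nsmul_eq_mul]
        refine (Finset.card_nsmul_le_sum _ (fun j => gap ψ (w j) (v j)) _ fun j hj => ?_).trans
          ((Finset.sum_le_univ_sum_of_nonneg fun j => (isQuasiSq_gap (hw j) ψ).nonneg _).trans hv)
        have := (Finset.mem_filter.1 hj).2
        push Not at this
        exact this.le
      have h3 : (2 * (Finset.univ.filter fun j => ¬ gap ψ (w j) (v j) ≤ h).card : ℝ) ≤ n := by
        refine not_lt.1 fun hc => ?_
        nlinarith
      have h4 : 2 * (Finset.univ.filter fun j => ¬ gap ψ (w j) (v j) ≤ h).card ≤ n := by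
        exact_mod_cast h3
      omega
    · rw [hbox, Fintype.mem_piFinset]
      intro j
      by_cases hj : gap ψ (w j) (v j) ≤ h
      · simp [hj, mem_sublevel]
      · simp [hj]
  have hcard : ∀ J ∈ 𝒥, 2 ^ (10 * n) * (box J).card ≤ Fintype.card F ^ n := by
    intro J hJ
    have hJ' := (Finset.mem_filter.1 hJ).2
    calc 2 ^ (10 * n) * (box J).card ≤ 2 ^ (20 * J.card) * (box J).card :=
          Nat.mul_le_mul_right _ (Nat.pow_le_pow_right (by norm_num) (by omega))
      _ = ∏ j, (if j ∈ J then 2 ^ 20 else 1) *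
            (if j ∈ J then sublevel (gap ψ (w j)) h else Finset.univ).card := by
          rw [Finset.prod_mul_distrib, Finset.prod_ite_mem, Finset.univ_inter, Finset.prod_const,
            pow_mul, hbox, Fintype.card_piFinset]
      _ ≤ ∏ _j : Fin n, Fintype.card F := by
          refine Finset.prod_le_prod' fun j _ => ?_
          by_cases hj : j ∈ J
          · simp only [hj, if_true]
            exact card_sublevel_gap_le (hw j) (hα j) hψ h0.le hh hq
          · simp [hj]
      _ = _ := by simp
  have h5 : 2 ^ (10 * n) * (sublevel (totalGap ψ w) Y).card ≤ 2 ^ n * Fintype.card F ^ n := by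
    calc _ ≤ 2 ^ (10 * n) * ∑ J ∈ 𝒥, (box J).card :=
          Nat.mul_le_mul_left _ ((Finset.card_le_card hsub).trans Finset.card_biUnion_le)
      _ = ∑ J ∈ 𝒥, 2 ^ (10 * n) * (box J).card := Finset.mul_sum _ _ _
      _ ≤ 𝒥.card * Fintype.card F ^ n := by
          rw [← smul_eq_mul]; exact Finset.sum_le_card_nsmul _ _ _ hcard
      _ ≤ 2 ^ n * Fintype.card F ^ n := by
          refine Nat.mul_le_mul_right _ ((Finset.card_le_univ _).trans ?_)
          simp
  have h6 : 2 ^ (10 * n) = 2 ^ n * 2 ^ (9 * n) := by rw [← pow_add]; congr 1; ring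
  rw [h6, mul_assoc] at h5
  exact Nat.le_of_mul_le_mul_left h5 (by positivity)

theorem expect_ind_rowInter_eq_sum {w : Fin n → Fin n → F → ℝ} {m : ℕ} (lam : Fin m → F)
    (𝒱 : Finset (Submodule F (Fin n → F))) :
    expect (fun i => prodWeight (w i)) (fun M => ind (rowInter lam (Matrix.of M) ∈ 𝒱)) =
      ∑ V ∈ 𝒱, expect (fun i => prodWeight (w i))
        (fun M => ind (rowInter lam (Matrix.of M) = V)) := by
  rw [← expect_sum]
  congr 1; ext M
  by_cases h : rowInter lam (Matrix.of M) ∈ 𝒱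
  · rw [ind_true h, Finset.sum_eq_single_of_mem _ h, ind_true rfl]
    intro V _ hV
    exact ind_false hV.symm
  · rw [ind_false h, Finset.sum_eq_zero]
    intro V hV
    refine ind_false ?_
    rintro rfl
    exact h hV

/-- The row intersection is unlikely to be a subspace of small codimension `k` which is hit by
the rows with probability comparable to `q ^ (-k)` but has a vector of small defect in its
complement. -/
theorem expect_rowInter_mem_le_of_small_gap {w : Fin n → Fin n → F → ℝ}
    (hw : ∀ i j, IsWeight (w i j)) {α : ℝ}
    (hα : ∀ i j, IsBalancedWeight α (w i j)) {ψ : AddChar F ℂ} (hψ : ψ.IsPrimitive) {m : ℕ}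
    (lam : Fin m → F) {h Y : ℝ} (h0 : 0 < h) (hh : 16 ^ 20 * h < α)
    (hq : 2 ^ 20 ≤ Fintype.card F) (hY : 2 * Y ≤ h * n)
    (𝒱 : Finset (Submodule F (Fin n → F))) {E : ℝ} (hE0 : 0 ≤ E)
    (h𝒱 : ∀ V ∈ 𝒱, (∀ i x, cosetProb (w i) x V ≤ 2 / (Fintype.card F : ℝ) ^ codim V) ∧
      (∃ i, ∃ u ∈ perp V, u ≠ 0 ∧ totalGap ψ (w i) u ≤ Y) ∧
      (Fintype.card F : ℝ) ^ (codim V + codim V * codim V) ≤ E) :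
    expect (fun i => prodWeight (w i)) (fun M => ind (rowInter lam (Matrix.of M) ∈ 𝒱)) ≤
      (n + 1) * n * E * (1 / 2 ^ 8) ^ n := by
  classical
  have hq0 : (0 : ℝ) < Fintype.card F := by exact_mod_cast Fintype.card_pos
  rw [expect_ind_rowInter_eq_sum]
  have hfib : ∑ V ∈ 𝒱, expect (fun i => prodWeight (w i))
        (fun M => ind (rowInter lam (Matrix.of M) = V)) =
      ∑ k ∈ Finset.range (n + 1), ∑ V ∈ 𝒱.filter (fun V => codim V = k),
        expect (fun i => prodWeight (w i)) (fun M => ind (rowInter lam (Matrix.of M) = V)) := by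
    refine (Finset.sum_fiberwise_of_maps_to (fun V _ => ?_) _).symm
    have := codim_add_finrank V
    rw [Finset.mem_range]; omega
  rw [hfib]
  have hk : ∀ k ∈ Finset.range (n + 1), ∑ V ∈ 𝒱.filter (fun V => codim V = k),
      expect (fun i => prodWeight (w i)) (fun M => ind (rowInter lam (Matrix.of M) = V)) ≤
      n * E * (1 / 2 ^ 8) ^ n := by
    intro k _
    set q : ℝ := ((Fintype.card F : ℕ) : ℝ) with hqdef
    by_cases hne : (𝒱.filter (fun V => codim V = k)).Nonempty
    swap
    · rw [Finset.not_nonempty_iff_eq_empty.1 hne, Finset.sum_empty]; positivity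
    have hEk : q ^ (k + k * k) ≤ E := by
      obtain ⟨V, hV⟩ := hne
      obtain ⟨hV', rfl⟩ := Finset.mem_filter.1 hV
      exact (h𝒱 V hV').2.2
    have hsum : ∑ V ∈ 𝒱.filter (fun V => codim V = k),
        expect (fun i => prodWeight (w i)) (fun M => ind (rowInter lam (Matrix.of M) = V)) ≤
        ((𝒱.filter (fun V => codim V = k)).card : ℝ) * (q ^ (k * k) * (2 / q ^ k) ^ n) := by
      rw [← nsmul_eq_mul]
      refine Finset.sum_le_card_nsmul _ _ _ fun V hV => ?_
      obtain ⟨hV', rfl⟩ := Finset.mem_filter.1 hV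
      exact expect_rowInter_eq_le hw lam V (h𝒱 V hV').1
    refine hsum.trans ?_
    set A : ℕ := Fintype.card F ^ n / 2 ^ (9 * n) with hA
    have hcount := card_subspaces_le k (fun i => sublevel (totalGap ψ (w i)) Y) (A := A)
      (fun i => (Nat.le_div_iff_mul_le (by positivity)).2 (by
        rw [mul_comm]
        exact card_sublevel_totalGap_le (hw i) (hα i) hψ h0 hh hq hY))
      (𝒱.filter (fun V => codim V = k)) (fun V hV => by
        obtain ⟨hV, hk⟩ := Finset.mem_filter.1 hV
        obtain ⟨i, u, hu, hu0, hug⟩ := (h𝒱 V hV).2.1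
        exact ⟨hk, i, u, hu, hu0, mem_sublevel.2 hug⟩)
    have hAle : (A : ℝ) * 2 ^ (9 * n) ≤ q ^ n := by
      have := Nat.div_mul_le_self (Fintype.card F ^ n) (2 ^ (9 * n))
      rw [hqdef, hA]
      exact_mod_cast this
    have hcount' : ((𝒱.filter (fun V => codim V = k)).card : ℝ) * q ^ n ≤
        n * q ^ k * (q ^ (n * k) * A) := by
      rw [hqdef]
      exact_mod_cast hcount
    -- At most n q^(k+nk) 2^(-9n) subspaces, each of probability at most q^(k²)(2/q^k)^n: the powers
    -- q^(nk) cancel and a saving of 2^(-8n) remains.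
    have hc2 : ((𝒱.filter (fun V => codim V = k)).card : ℝ) * 2 ^ (9 * n) ≤
        n * q ^ k * q ^ (n * k) := by
      refine le_of_mul_le_mul_right ?_ (pow_pos hq0 n)
      calc _ = (((𝒱.filter (fun V => codim V = k)).card : ℝ) * q ^ n) * 2 ^ (9 * n) := by ring
        _ ≤ (n * q ^ k * (q ^ (n * k) * A)) * 2 ^ (9 * n) :=
            mul_le_mul_of_nonneg_right hcount' (by positivity)
        _ = n * q ^ k * q ^ (n * k) * (A * 2 ^ (9 * n)) := by ring
        _ ≤ _ := mul_le_mul_of_nonneg_left hAle (by positivity)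
    have hqk : q ^ (n * k) * (2 / q ^ k) ^ n = 2 ^ n := by
      rw [div_pow, ← pow_mul, mul_comm k n]; field_simp
    have h29 : (2 : ℝ) ^ n = (1 / 2 ^ 8) ^ n * 2 ^ (9 * n) := by
      rw [pow_mul, ← mul_pow]; norm_num
    refine le_of_mul_le_mul_right ?_ (show (0 : ℝ) < 2 ^ (9 * n) by positivity)
    calc _ = (((𝒱.filter (fun V => codim V = k)).card : ℝ) * 2 ^ (9 * n)) *
            (q ^ (k * k) * (2 / q ^ k) ^ n) := by ring
      _ ≤ (n * q ^ k * q ^ (n * k)) * (q ^ (k * k) * (2 / q ^ k) ^ n) :=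
          mul_le_mul_of_nonneg_right hc2 (by positivity)
      _ = n * q ^ (k + k * k) * (q ^ (n * k) * (2 / q ^ k) ^ n) := by rw [pow_add]; ring
      _ = n * q ^ (k + k * k) * 2 ^ n := by rw [hqk]
      _ ≤ n * E * 2 ^ n := by gcongr
      _ = _ := by rw [h29]; ring
  calc _ ≤ ∑ k ∈ Finset.range (n + 1), n * E * (1 / 2 ^ 8 : ℝ) ^ n := Finset.sum_le_sum hk
    _ = _ := by simp; ring

end Semisaturated

/-! ### Unsaturated subspaces: swapping rows for lazy vectors. -/

section Unsaturated

open Matrix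

variable {F : Type*} [Field F] {n : ℕ}

theorem exists_finset_sup_span_eq (A : Fin n → Fin n → F) (d : ℕ) (T : Submodule F (Fin n → F))
    (hT : T ≤ Submodule.span F (Set.range A))
    (hd : Module.finrank F (Submodule.span F (Set.range A)) ≤ Module.finrank F T + d) :
    ∃ J : Finset (Fin n), J.card ≤ d ∧
      T ⊔ Submodule.span F (A '' J) = Submodule.span F (Set.range A) := by
  classical
  induction d generalizing T with
  | zero =>
    refine ⟨∅, le_rfl, ?_⟩
    simp [Submodule.eq_of_le_of_finrank_le hT (by omega)]
  | succ d ih =>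
    by_cases h : ∀ i, A i ∈ T
    · refine ⟨∅, Nat.zero_le _, ?_⟩
      have : Submodule.span F (Set.range A) ≤ T := by
        rw [Submodule.span_le]; rintro _ ⟨i, rfl⟩; exact h i
      simp [le_antisymm hT this]
    · push Not at h
      obtain ⟨i, hi⟩ := h
      have hlt : T < T ⊔ Submodule.span F {A i} := by
        refine lt_of_le_of_ne le_sup_left fun h => hi ?_
        rw [h]
        exact Submodule.mem_sup_right (Submodule.mem_span_singleton_self _)
      have hfin := Submodule.finrank_lt_finrank_of_lt hlt
      have hle : T ⊔ Submodule.span F {A i} ≤ Submodule.span F (Set.range A) := by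
        refine sup_le hT ?_
        rw [Submodule.span_singleton_le_iff_mem]
        exact Submodule.subset_span ⟨i, rfl⟩
      obtain ⟨J, hJ, hJeq⟩ := ih _ hle (by omega)
      refine ⟨insert i J, (Finset.card_insert_le _ _).trans (by omega), ?_⟩
      rw [Finset.coe_insert, Set.image_insert_eq, Submodule.span_insert, ← sup_assoc, hJeq]

/-- The `i`-th row of `M - lam j`. -/
def shiftRow {m : ℕ} (lam : Fin m → F) (j : Fin m) (M : Fin n → Fin n → F) (i : Fin n) :
    Fin n → F := M i - lam j • Pi.single i 1

/-- The span of the vectors `Z` and of the rows of `M - lam j` with index in `I`. -/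
def partialSpan {m L : ℕ} (lam : Fin m → F) (I : Finset (Fin n)) (Z : Fin L → Fin n → F)
    (M : Fin n → Fin n → F) (j : Fin m) : Submodule F (Fin n → F) :=
  Submodule.span F (Set.range Z) ⊔ Submodule.span F (shiftRow lam j M '' I)

theorem row_sub_eq_shiftRow {m : ℕ} (lam : Fin m → F) (j : Fin m) (M : Fin n → Fin n → F) :
    (Matrix.of M - lam j • (1 : Matrix (Fin n) (Fin n) F)).row = shiftRow lam j M := by
  ext i k
  simp [shiftRow, Matrix.row, Matrix.one_apply, Pi.single_apply, eq_comm]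

/-- `Z` spans a subspace of codimension at most `r` in each row space, so `r` further rows complete
it for each `j`; the union over `j` gives one set `I` for all shifts. -/
theorem exists_partialSpan_eq {m L r : ℕ} (lam : Fin m → F) (hL : n ≤ L + r)
    (Z : Fin L → Fin n → F) (hZ : LinearIndependent F Z) (M : Fin n → Fin n → F)
    (hZM : ∀ s, Z s ∈ rowInter lam (Matrix.of M)) :
    ∃ I : Finset (Fin n), I.card ≤ m * r ∧ ∀ j, partialSpan lam I Z M j =
      rowSpace (Matrix.of M - lam j • (1 : Matrix (Fin n) (Fin n) F)) := by
  classical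
  have hrow : ∀ j, rowSpace (Matrix.of M - lam j • (1 : Matrix (Fin n) (Fin n) F)) =
      Submodule.span F (Set.range (shiftRow lam j M)) := by
    intro j; rw [rowSpace, row_sub_eq_shiftRow]
  have hle : ∀ j, Submodule.span F (Set.range Z) ≤
      Submodule.span F (Set.range (shiftRow lam j M)) := by
    intro j
    rw [Submodule.span_le]
    rintro _ ⟨s, rfl⟩
    have := hZM s
    rw [rowInter, Submodule.mem_iInf] at this
    have h2 := this j
    rwa [hrow] at h2
  have hJ : ∀ j, ∃ J : Finset (Fin n), J.card ≤ r ∧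
      Submodule.span F (Set.range Z) ⊔ Submodule.span F (shiftRow lam j M '' J) =
        Submodule.span F (Set.range (shiftRow lam j M)) := by
    intro j
    refine exists_finset_sup_span_eq _ r _ (hle j) ?_
    rw [finrank_span_eq_card hZ, Fintype.card_fin]
    exact (Submodule.finrank_le _).trans (by simpa using hL)
  choose J hJc hJe using hJ
  refine ⟨Finset.univ.biUnion J, ?_, fun j => ?_⟩
  · refine Finset.card_biUnion_le.trans ((Finset.sum_le_card_nsmul _ _ r fun j _ => hJc j).trans ?_)
    simp
  · rw [hrow]
    refine le_antisymm (sup_le (hle j) (Submodule.span_mono (Set.image_subset_range _ _))) ?_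
    rw [← hJe j]
    refine sup_le_sup le_rfl (Submodule.span_mono (Set.image_mono ?_))
    exact_mod_cast Finset.subset_biUnion_of_mem J (Finset.mem_univ j)

variable [Fintype F]

/-- The partial spans involve only rows in `I`, so the other rows are fresh. For such a row, two
admissible values differ by an element of every partial span, hence of their intersection `V`: one
coset of `V` per row. -/
theorem expect_partialSpan_le {w : Fin n → Fin n → F → ℝ} (hw : ∀ i j, IsWeight (w i j))
    {m L : ℕ} (lam : Fin m → F) (V : Submodule F (Fin n → F)) {B : ℝ}
    (hB : ∀ i x, cosetProb (w i) x V ≤ B) (I : Finset (Fin n)) (Z : Fin L → Fin n → F) :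
    expect (fun i => prodWeight (w i)) (fun M => ind ((⨅ j, partialSpan lam I Z M j) = V ∧
      ∀ i ∈ Iᶜ, ∀ j, shiftRow lam j M i ∈ partialSpan lam I Z M j)) ≤
    expect (fun i => prodWeight (w i)) (fun M => ind ((⨅ j, partialSpan lam I Z M j) = V)) *
      B ^ (n - I.card) := by
  have hW : ∀ i, IsWeight (prodWeight (w i)) := fun i => isWeight_prodWeight (hw i)
  rw [← expect_resample hW Iᶜ, ← expect_mul_right]
  refine expect_mono hW fun M => ?_
  have hps : ∀ (M' : Fin n → Fin n → F) j,
      partialSpan lam I Z (Iᶜ.piecewise M' M) j = partialSpan lam I Z M j := by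
    intro M' j
    unfold partialSpan
    congr 2
    refine Set.image_congr fun i hi => ?_
    have : i ∉ Iᶜ := by simpa using hi
    simp only [shiftRow, Finset.piecewise_eq_of_notMem _ _ _ this]
  simp only [hps]
  by_cases hV : (⨅ j, partialSpan lam I Z M j) = V
  swap
  · rw [ind_false hV, zero_mul]
    refine expect_le_of_le hW fun M' => ?_
    rw [ind_false (by tauto)]
  rw [ind_true hV, one_mul]
  have hfresh : ∀ M' : Fin n → Fin n → F, ind ((⨅ j, partialSpan lam I Z M j) = V ∧
      ∀ i ∈ Iᶜ, ∀ j, shiftRow lam j (Iᶜ.piecewise M' M) i ∈ partialSpan lam I Z M j) ≤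
      ind (∀ i ∈ Iᶜ, ∀ j, M' i - lam j • Pi.single i 1 ∈ partialSpan lam I Z M j) := by
    intro M'
    refine ind_mono fun h i hi j => ?_
    have h2 := h.2 i hi j
    unfold shiftRow at h2
    rw [Finset.piecewise_eq_of_mem _ _ _ hi] at h2
    exact h2
  refine (expect_mono hW hfresh).trans ?_
  have hrow : ∀ i ∈ Iᶜ, ∑ r, prodWeight (w i) r *
      ind (∀ j, r - lam j • Pi.single i 1 ∈ partialSpan lam I Z M j) ≤ B := by
    intro i _
    refine sum_prodWeight_ind_le (hw i) (hB i) _ fun r r' hr hr' => ?_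
    rw [← hV, Submodule.mem_iInf]
    intro j
    have := Submodule.sub_mem _ (hr j) (hr' j)
    rwa [sub_sub_sub_cancel_right] at this
  have hcard : n - I.card = Iᶜ.card := by rw [Finset.card_compl, Fintype.card_fin]
  rw [hcard]
  set p : Fin n → (Fin n → F) → Prop := fun i r =>
    ∀ j, r - lam j • (Pi.single i 1 : Fin n → F) ∈ partialSpan lam I Z M j with hp
  exact expect_ind_forall_le (W := fun i => prodWeight (w i)) hW Iᶜ p hrow

/-- The row intersection is unlikely to be a subspace which is hit by the rows with much smaller
probability than by a vector with independent coordinates of laws `z`. -/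
theorem expect_rowInter_mem_le_of_swap {w : Fin n → Fin n → F → ℝ}
    (hw : ∀ i j, IsWeight (w i j)) {z : Fin n → F → ℝ} (hz : ∀ j, IsWeight (z j)) {β : ℝ}
    (hβ0 : 0 ≤ β) (hβ1 : β ≤ 1) (hβ : ∀ j a, z j a ≤ 1 - β) {m r : ℕ} (lam : Fin m → F)
    (hm : 1 ≤ m) (hr : m * r ≤ n) {ε δ : ℝ} (hε : 0 < ε) (hδ0 : 0 ≤ δ) (hδ1 : δ ≤ 1)
    (hrε : (1 - β) ^ r ≤ ε / 2) (𝒱 : Finset (Submodule F (Fin n → F)))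
    (h𝒱 : ∀ V ∈ 𝒱, ε ≤ cosetProb z 0 V ∧
      ∀ i x, cosetProb (w i) x V ≤ δ * cosetProb z 0 V) :
    expect (fun i => prodWeight (w i)) (fun M => ind (rowInter lam (Matrix.of M) ∈ 𝒱)) ≤
      4 ^ n * δ ^ (n - m * r) * (1 / ε) ^ (m * r) := by
  classical
  have hW : ∀ i, IsWeight (prodWeight (w i)) := fun i => isWeight_prodWeight (hw i)
  have hZ := isWeight_prodWeight hz
  have hrn : r ≤ n := le_trans (Nat.le_mul_of_pos_left r hm) hr
  set L := n - r with hL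
  set Q : Finset (Fin n) → Submodule F (Fin n → F) → ℝ := fun I V =>
    expect (fun _ : Fin L => prodWeight z) (fun Z => expect (fun i => prodWeight (w i))
      (fun M => ind ((⨅ j, partialSpan lam I Z M j) = V))) with hQ
  have hQ0 : ∀ I V, 0 ≤ Q I V := fun I V =>
    expect_nonneg (fun _ => hZ) fun Z => expect_nonneg hW fun M => ind_nonneg _
  set c : ℝ := 2 ^ n * δ ^ (n - m * r) * (1 / ε) ^ (m * r) with hc
  have hc0 : 0 ≤ c := by positivity
  have hV : ∀ V ∈ 𝒱, expect (fun i => prodWeight (w i))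
      (fun M => ind (rowInter lam (Matrix.of M) = V)) ≤ c * ∑ I, Q I V := by
    intro V hV
    obtain ⟨hp, hB⟩ := h𝒱 V hV
    set p := cosetProb z 0 V with hpdef
    have hp0 : 0 < p := hε.trans_le hp
    have hp1 : p ≤ 1 := expect_ind_le_one hz _
    have hind := pow_le_expect_linearIndependent hz hβ0 hβ1 hβ V (r := r)
      (hrε.trans (by linarith)) L (by omega)
    have hδp0 : 0 ≤ δ * p := by positivity
    have hδp1 : δ * p ≤ 1 := mul_le_one₀ hδ1 hp0.le hp1
    have hstep : expect (fun i => prodWeight (w i))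
        (fun M => ind (rowInter lam (Matrix.of M) = V)) * (p / 2) ^ L ≤
        ∑ I, Q I V * (δ * p) ^ (n - m * r) := by
      calc _ ≤ expect (fun i => prodWeight (w i))
            (fun M => ind (rowInter lam (Matrix.of M) = V)) *
              expect (fun _ : Fin L => prodWeight z)
                (fun Z => ind (LinearIndependent F Z ∧ ∀ s, Z s ∈ V)) :=
            mul_le_mul_of_nonneg_left hind (expect_nonneg hW fun _ => ind_nonneg _)
        _ = expect (fun _ : Fin L => prodWeight z) (fun Z => expect (fun i => prodWeight (w i))
              (fun M => ind (rowInter lam (Matrix.of M) = V ∧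
                (LinearIndependent F Z ∧ ∀ s, Z s ∈ V)))) := by
            rw [← expect_mul_left]
            congr 1; ext Z
            rw [← expect_mul_right]
            congr 1; ext M
            exact (ind_and _ _).symm
        _ ≤ expect (fun _ : Fin L => prodWeight z) (fun Z => ∑ I,
              expect (fun i => prodWeight (w i))
                (fun M => ind ((⨅ j, partialSpan lam I Z M j) = V)) * (δ * p) ^ (n - m * r)) := by
            refine expect_mono (fun _ => hZ) fun Z => ?_
            calc _ ≤ expect (fun i => prodWeight (w i)) (fun M =>
                  ∑ I ∈ Finset.univ.filter (fun I : Finset (Fin n) => I.card ≤ m * r),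
                    ind ((⨅ j, partialSpan lam I Z M j) = V ∧
                      ∀ i ∈ Iᶜ, ∀ j, shiftRow lam j M i ∈ partialSpan lam I Z M j)) := by
                  refine expect_mono hW fun M => ?_
                  refine (ind_mono ?_).trans (ind_exists_le _ _)
                  rintro ⟨hR, hli, hZV⟩
                  obtain ⟨I, hI, hIe⟩ := exists_partialSpan_eq (r := r) lam (by omega) Z hli M
                    (fun s => hR ▸ hZV s)
                  refine ⟨I, Finset.mem_filter.2 ⟨Finset.mem_univ _, hI⟩, ?_, fun i _ j => ?_⟩
                  · simp only [hIe]; exact hR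
                  · rw [hIe, rowSpace, row_sub_eq_shiftRow]
                    exact Submodule.subset_span ⟨i, rfl⟩
              _ ≤ ∑ I ∈ Finset.univ.filter (fun I : Finset (Fin n) => I.card ≤ m * r),
                    expect (fun i => prodWeight (w i))
                    (fun M => ind ((⨅ j, partialSpan lam I Z M j) = V)) *
                      (δ * p) ^ (n - m * r) := by
                  rw [expect_sum]
                  refine Finset.sum_le_sum fun I hI => ?_
                  refine (expect_partialSpan_le hw lam V hB I Z).trans ?_
                  refine mul_le_mul_of_nonneg_left ?_ (expect_nonneg hW fun _ => ind_nonneg _)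
                  have := (Finset.mem_filter.1 hI).2
                  exact pow_le_pow_of_le_one hδp0 hδp1 (by omega)
              _ ≤ _ := Finset.sum_le_sum_of_subset_of_nonneg (Finset.filter_subset _ _)
                  fun I _ _ => mul_nonneg (expect_nonneg hW fun _ => ind_nonneg _)
                    (pow_nonneg hδp0 _)
        _ = _ := by
            rw [expect_sum]
            refine Finset.sum_congr rfl fun I _ => ?_
            rw [expect_mul_right]
    -- The powers of `p` from the n - mr fresh rows nearly pay for the `L` lazy vectors: the
    -- mismatch is at most p^(-mr) ≤ ε^(-mr), and 2^n absorbs the halves in (p/2)^L.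
    have hpow : (δ * p) ^ (n - m * r) ≤ c * (p / 2) ^ L := by
      have h1 : p ^ (n - m * r) ≤ (1 / ε) ^ (m * r) * p ^ L := by
        have h2 : p ^ (n - m * r) * ε ^ (m * r) ≤ p ^ L := by
          calc _ ≤ p ^ (n - m * r) * p ^ (m * r) := by gcongr
            _ = p ^ n := by rw [← pow_add]; congr 1; omega
            _ ≤ p ^ L := pow_le_pow_of_le_one hp0.le hp1 (by omega)
        rw [one_div, inv_pow, inv_mul_eq_div, le_div_iff₀ (by positivity)]
        exact h2
      have h3 : (1 : ℝ) ≤ 2 ^ n * (1 / 2) ^ L := by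
        have : (2 : ℝ) ^ n = 2 ^ L * 2 ^ r := by rw [← pow_add]; congr 1; omega
        rw [this, mul_right_comm, ← mul_pow]
        norm_num
        exact one_le_pow₀ (by norm_num)
      calc (δ * p) ^ (n - m * r) = δ ^ (n - m * r) * p ^ (n - m * r) := mul_pow _ _ _
        _ ≤ δ ^ (n - m * r) * ((1 / ε) ^ (m * r) * p ^ L) := by gcongr
        _ ≤ δ ^ (n - m * r) * ((1 / ε) ^ (m * r) * p ^ L) * (2 ^ n * (1 / 2) ^ L) :=
            le_mul_of_one_le_right (by positivity) h3
        _ = c * (p / 2) ^ L := by rw [hc, div_pow p, div_pow 1 2, one_pow]; ring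
    have hpL : 0 < (p / 2) ^ L := by positivity
    refine le_of_mul_le_mul_right (hstep.trans ?_) hpL
    rw [← Finset.sum_mul]
    calc (∑ I, Q I V) * (δ * p) ^ (n - m * r) ≤ (∑ I, Q I V) * (c * (p / 2) ^ L) :=
          mul_le_mul_of_nonneg_left hpow (Finset.sum_nonneg fun I _ => hQ0 I V)
      _ = _ := by ring
  rw [expect_ind_rowInter_eq_sum]
  calc _ ≤ ∑ V ∈ 𝒱, c * ∑ I, Q I V := Finset.sum_le_sum hV
    _ = c * ∑ I, ∑ V ∈ 𝒱, Q I V := by rw [← Finset.mul_sum, Finset.sum_comm]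
    -- For given `I`, `Z`, `M` the intersection of partial spans equals at most one `V`, so summing
    -- over `V` costs nothing.
    _ ≤ c * ∑ _I : Finset (Fin n), 1 := by
        refine mul_le_mul_of_nonneg_left (Finset.sum_le_sum fun I _ => ?_) hc0
        rw [hQ, ← expect_sum]
        refine expect_le_of_le (fun _ => hZ) fun Z => ?_
        rw [← expect_sum]
        refine expect_le_of_le hW fun M => ?_
        by_cases h : (⨅ j, partialSpan lam I Z M j) ∈ 𝒱
        · rw [Finset.sum_eq_single_of_mem _ h]
          · exact ind_le_one _
          · intro V _ hV; exact ind_false hV.symm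
        · rw [Finset.sum_eq_zero]
          · exact zero_le_one
          · intro V hV; refine ind_false ?_; rintro rfl; exact h hV
    _ = _ := by
        have : (4 : ℝ) ^ n = 2 ^ n * 2 ^ n := by rw [← mul_pow]; norm_num
        simp [hc, this]; ring

end Unsaturated

/-! ### From measures to finite sums. -/

section Link

variable {F : Type*} [MeasurableSpace F] [MeasurableSingletonClass F] [Fintype F]

theorem measureReal_eq_sum_ind (ν : Measure F) [IsFiniteMeasure ν] (S : Set F) :
    ν.real S = ∑ a, ν.real {a} * ind (a ∈ S) := by
  classical
  have h1 := sum_measureReal_singleton (μ := ν) (Finset.univ.filter (· ∈ S))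
  have h2 : ((Finset.univ.filter (· ∈ S) : Finset F) : Set F) = S := by ext; simp
  rw [h2] at h1
  rw [← h1, Finset.sum_filter]
  refine Finset.sum_congr rfl fun a _ => ?_
  by_cases ha : a ∈ S
  · rw [if_pos ha, ind_true ha, mul_one]
  · rw [if_neg ha, ind_false ha, mul_zero]

variable {n : ℕ}

/-- The weights of the atoms of the laws of the entries. -/
noncomputable def entryWeight (μ : Fin n → Fin n → Measure F) (i j : Fin n) (a : F) : ℝ :=
  (μ i j).real {a}

theorem isWeight_entryWeight {μ : Fin n → Fin n → Measure F}
    (hμ : ∀ i j, IsProbabilityMeasure (μ i j)) (i j : Fin n) : IsWeight (entryWeight μ i j) := by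
  have := hμ i j
  refine ⟨fun a => measureReal_nonneg, ?_⟩
  simp [entryWeight]

theorem rowLaw_real_singleton {μ : Fin n → Fin n → Measure F}
    (hμ : ∀ i j, IsProbabilityMeasure (μ i j)) (i : Fin n) (r : Fin n → F) :
    (rowLaw μ i).real {r} = prodWeight (entryWeight μ i) r := by
  have := hμ
  rw [rowLaw, measureReal_def, Measure.pi_singleton, ENNReal.toReal_prod]
  rfl

theorem isProbabilityMeasure_rowLaw {μ : Fin n → Fin n → Measure F}
    (hμ : ∀ i j, IsProbabilityMeasure (μ i j)) (i : Fin n) : IsProbabilityMeasure (rowLaw μ i) := by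
  have := hμ
  unfold rowLaw; infer_instance

theorem rowLaw_real_eq {μ : Fin n → Fin n → Measure F}
    (hμ : ∀ i j, IsProbabilityMeasure (μ i j)) (i : Fin n) (S : Set (Fin n → F)) :
    (rowLaw μ i).real S = expect (entryWeight μ i) (fun r => ind (r ∈ S)) := by
  have := isProbabilityMeasure_rowLaw hμ i
  rw [measureReal_eq_sum_ind]
  exact Finset.sum_congr rfl fun r _ => by rw [rowLaw_real_singleton hμ]; rfl

theorem matrixLaw_real_eq {μ : Fin n → Fin n → Measure F}
    (hμ : ∀ i j, IsProbabilityMeasure (μ i j)) (S : Set (Fin n → Fin n → F)) :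
    (matrixLaw μ).real S =
      expect (fun i => prodWeight (entryWeight μ i)) (fun M => ind (M ∈ S)) := by
  have := isProbabilityMeasure_rowLaw hμ
  have hp : IsProbabilityMeasure (matrixLaw μ) := by unfold matrixLaw; infer_instance
  rw [measureReal_eq_sum_ind]
  refine Finset.sum_congr rfl fun M _ => ?_
  congr 1
  rw [matrixLaw, measureReal_def, Measure.pi_singleton, ENNReal.toReal_prod]
  exact Finset.prod_congr rfl fun i _ => rowLaw_real_singleton hμ i (M i)

variable [Field F]

theorem isBalancedWeight_entryWeight {μ : Fin n → Fin n → Measure F} {α : ℝ}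
    (hμ : ∀ i j, IsProbabilityMeasure (μ i j)) (hα : ∀ i j, IsBalanced α (μ i j)) (i j : Fin n) :
    IsBalancedWeight α (entryWeight μ i j) := by
  intro x H hH
  have := hμ i j
  have h := hα i j x H hH
  rw [measureReal_eq_sum_ind] at h
  exact h

theorem rhoRow_eq {μ : Fin n → Fin n → Measure F} (hμ : ∀ i j, IsProbabilityMeasure (μ i j))
    (i : Fin n) (V : Submodule F (Fin n → F)) :
    rhoRow μ i V = ⨆ x : Fin n → F,
      |cosetProb (entryWeight μ i) x V - 1 / (Fintype.card F : ℝ) ^ codim V| := by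
  unfold rhoRow
  congr 1; ext x
  rw [rowLaw_real_eq hμ]
  rfl

theorem exists_rho_eq {μ : Fin n → Fin n → Measure F} (hμ : ∀ i j, IsProbabilityMeasure (μ i j))
    (hn : 0 < n) (V : Submodule F (Fin n → F)) : ∃ i x, rho μ V =
      |cosetProb (entryWeight μ i) x V - 1 / (Fintype.card F : ℝ) ^ codim V| := by
  have : Nonempty (Fin n) := ⟨⟨0, hn⟩⟩
  obtain ⟨i, hi⟩ := exists_eq_ciSup_of_finite (f := fun i => rhoRow μ i V)
  obtain ⟨x, hx⟩ := exists_eq_ciSup_of_finite (f := fun x : Fin n → F =>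
    |cosetProb (entryWeight μ i) x V - 1 / (Fintype.card F : ℝ) ^ codim V|)
  refine ⟨i, x, ?_⟩
  rw [rho, ← hi]
  rw [rhoRow_eq hμ, ← hx]

theorem cosetProb_le_add_rho {μ : Fin n → Fin n → Measure F}
    (hμ : ∀ i j, IsProbabilityMeasure (μ i j)) (V : Submodule F (Fin n → F)) (i : Fin n)
    (x : Fin n → F) : cosetProb (entryWeight μ i) x V ≤
      1 / (Fintype.card F : ℝ) ^ codim V + rho μ V := by
  have h1 : |cosetProb (entryWeight μ i) x V - 1 / (Fintype.card F : ℝ) ^ codim V| ≤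
      rhoRow μ i V := by
    rw [rhoRow_eq hμ]
    exact le_ciSup (f := fun x : Fin n → F =>
      |cosetProb (entryWeight μ i) x V - 1 / (Fintype.card F : ℝ) ^ codim V|)
      (Set.finite_range _).bddAbove x
  have h2 : rhoRow μ i V ≤ rho μ V :=
    le_ciSup (f := fun i => rhoRow μ i V) (Set.finite_range _).bddAbove i
  linarith [le_abs_self (cosetProb (entryWeight μ i) x V - 1 / (Fintype.card F : ℝ) ^ codim V)]

end Link

/-! ### What a large value of ρ implies. -/

section Events

variable {F : Type*} [Field F] [Fintype F] [MeasurableSpace F] [MeasurableSingletonClass F] {n : ℕ}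

theorem IsSparse.mono {s t : ℝ} (h : s ≤ t) {V : Submodule F (Fin n → F)} (hV : IsSparse s V) :
    IsSparse t V := by
  obtain ⟨v, h0, hv, hs⟩ := hV
  exact ⟨v, h0, hv, hs.trans h⟩

/-- The case in which `ρ` is at most the uniform value: the complement contains a vector of
small defect. -/
theorem exists_totalGap_le_of_lt_rho {μ : Fin n → Fin n → Measure F}
    (hμ : ∀ i j, IsProbabilityMeasure (μ i j)) (hn : 0 < n) {ψ : AddChar F ℂ}
    (hψ : ψ.IsPrimitive) {V : Submodule F (Fin n → F)} {y : ℝ} (hy : Real.exp (-y) < rho μ V) :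
    ∃ i, ∃ u ∈ perp V, u ≠ 0 ∧ totalGap ψ (entryWeight μ i) u ≤ 2 * y := by
  classical
  obtain ⟨i, x, hix⟩ := exists_rho_eq hμ hn V
  refine ⟨i, ?_⟩
  -- If every nonzero vector of the complement had defect above 2y, each of the at most q^k Fourier
  -- terms would be below e^(-y), and so would their normalized sum ρ(V).
  by_contra hcon
  push Not at hcon
  have h1 := abs_cosetProb_sub_le (isWeight_entryWeight hμ i) hψ x V
  rw [← hix] at h1
  have h2 : ∑ u ∈ Finset.univ.erase (0 : perp V),
      Real.exp (-totalGap ψ (entryWeight μ i) u / 2) ≤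
      (Fintype.card F : ℝ) ^ codim V * Real.exp (-y) := by
    have hc : ((Finset.univ.erase (0 : perp V)).card : ℝ) ≤ (Fintype.card F : ℝ) ^ codim V := by
      have := Finset.card_le_univ (Finset.univ.erase (0 : perp V))
      rw [card_perp] at this
      exact_mod_cast this
    refine le_trans ?_ (mul_le_mul_of_nonneg_right hc (Real.exp_pos _).le)
    rw [← nsmul_eq_mul]
    refine Finset.sum_le_card_nsmul _ _ _ fun u hu => Real.exp_le_exp.2 ?_
    have hu0 : (u : Fin n → F) ≠ 0 := by
      intro h; exact Finset.ne_of_mem_erase hu (by ext1; exact h)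
    have := hcon u u.2 hu0
    linarith
  have hq : (0 : ℝ) < (Fintype.card F : ℝ) ^ codim V :=
    pow_pos (by exact_mod_cast Fintype.card_pos) _
  have h3 := h1.trans (mul_le_mul_of_nonneg_left h2 (inv_nonneg.2 hq.le))
  rw [inv_mul_cancel_left₀ hq.ne'] at h3
  linarith

/-- If `V` is not sparse, then `ρ(V)` is much smaller than the probability that a lazy random
vector hits `V`. -/
theorem rho_le_cosetProb_lazyWeight {μ : Fin n → Fin n → Measure F}
    (hμ : ∀ i j, IsProbabilityMeasure (μ i j)) {α : ℝ} (hα0 : 0 < α)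
    (hα : ∀ i j, IsBalanced α (μ i j)) (hn : 0 < n) {η C : ℝ} (hη0 : 0 ≤ η) (hη1 : η ≤ 1 / 2)
    (hη : 2 * η * (16 ^ 20 * 44) = 1) (hC : 16 ^ 20 * 44 < C) {V : Submodule F (Fin n → F)}
    (hV : ¬ IsSparse (C / α) V) :
    ∃ i, rho μ V ≤ 1 / 20000 *
      cosetProb (fun j => lazyWeight η (entryWeight μ i j)) 0 V := by
  classical
  obtain ⟨i, x, hix⟩ := exists_rho_eq hμ hn V
  refine ⟨i, ?_⟩
  set ψ := AddChar.FiniteField.primitiveChar_to_Complex F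
  have hψ : ψ.IsPrimitive := AddChar.FiniteField.primitiveChar_to_Complex_isPrimitive F
  have hw := isWeight_entryWeight hμ i
  have h1 := abs_cosetProb_sub_le hw hψ x V
  rw [← hix] at h1
  -- Applied on the complement of `V`, this compares the Fourier bound for ρ(V) with the Fourier
  -- lower bound for the lazy vector; non-sparsity supplies the large defect in every nontrivial
  -- subgroup.
  have h2 := sum_exp_neg_half_le ((isQuasiSq_totalGap hw ψ).restrict (perp V)) hη hC
    (exists_le_totalGap hw hα0 (isBalancedWeight_entryWeight hμ hα i) hψ hV)
  have h3 := le_cosetProb_lazyWeight hη0 hη1 hw hψ V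
  have hq : (0 : ℝ) ≤ ((Fintype.card F : ℝ) ^ codim V)⁻¹ := by positivity
  calc rho μ V ≤ _ := h1
    _ ≤ _ := mul_le_mul_of_nonneg_left h2 hq
    _ = 1 / 20000 * (((Fintype.card F : ℝ) ^ codim V)⁻¹ *
        ∑ u : perp V, Real.exp (-(2 * η * totalGap ψ (entryWeight μ i) u))) := by ring
    _ ≤ _ := by linarith

end Events

/-! ### Quantitative bounds for the three bad events. -/

section Estimates

variable {F : Type*} [Field F] [Fintype F] [MeasurableSpace F] [MeasurableSingletonClass F] {n : ℕ}

theorem expect_semisaturated_le {μ : Fin n → Fin n → Measure F}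
    (hμ : ∀ i j, IsProbabilityMeasure (μ i j)) {α : ℝ} (hα0 : 0 < α)
    (hα : ∀ i j, IsBalanced α (μ i j)) (hn : 0 < n) {m : ℕ} (lam : Fin m → F) {y : ℝ}
    (hy0 : 0 ≤ y) (hyn : y + y ^ 2 ≤ n) (hyα : 4 * y ≤ α / (2 * 16 ^ 20) * n)
    (hq : 2 ^ 20 ≤ Fintype.card F) (𝒱 : Finset (Submodule F (Fin n → F)))
    (h𝒱 : ∀ V ∈ 𝒱, Real.exp (-y) < rho μ V ∧ rho μ V ≤ 1 / (Fintype.card F : ℝ) ^ codim V) :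
    expect (fun i => prodWeight (entryWeight μ i))
      (fun M => ind (rowInter lam (Matrix.of M) ∈ 𝒱)) ≤ Real.exp (-n) := by
  set ψ := AddChar.FiniteField.primitiveChar_to_Complex F
  have hψ : ψ.IsPrimitive := AddChar.FiniteField.primitiveChar_to_Complex_isPrimitive F
  have hq' : (2 : ℝ) ^ 20 ≤ Fintype.card F := by exact_mod_cast hq
  have hq0 : (0 : ℝ) < Fintype.card F := lt_of_lt_of_le (by positivity) hq'
  -- `h` is half of the limit α/16^20 set by twenty doublings. The choice E = e^n works since q^k ≤
  -- e^y and k ≤ y give q^(k+k²) ≤ e^(y+y²).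
  have h := expect_rowInter_mem_le_of_small_gap (isWeight_entryWeight hμ)
    (isBalancedWeight_entryWeight hμ hα) hψ lam (h := α / (2 * 16 ^ 20)) (Y := 2 * y)
    (by positivity) (by
      rw [mul_div_assoc', div_lt_iff₀ (by positivity)]
      nlinarith) hq (by linarith) 𝒱 (E := Real.exp n) (Real.exp_pos _).le (by
      intro V hV
      obtain ⟨h1, h2⟩ := h𝒱 V hV
      refine ⟨fun i x => ?_, exists_totalGap_le_of_lt_rho hμ hn hψ h1, ?_⟩
      · refine (cosetProb_le_add_rho hμ V i x).trans ?_
        have : (2 : ℝ) / (Fintype.card F : ℝ) ^ codim V =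
          1 / (Fintype.card F : ℝ) ^ codim V + 1 / (Fintype.card F : ℝ) ^ codim V := by ring
        rw [this]; linarith
      · have hqk : (Fintype.card F : ℝ) ^ codim V ≤ Real.exp y := by
          have h3 := (h1.trans_le h2).le
          rw [Real.exp_neg, ← one_div, one_div_le_one_div (Real.exp_pos _) (pow_pos hq0 _)] at h3
          exact h3
        have hk : (codim V : ℝ) ≤ y := by
          have h4 : Real.exp (codim V) ≤ Real.exp y := by
            refine le_trans ?_ hqk
            rw [← mul_one (codim V : ℝ), Real.exp_nat_mul]
            refine pow_le_pow_left₀ (Real.exp_pos _).le ?_ _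
            have := Real.exp_one_lt_d9
            linarith
          exact Real.exp_le_exp.1 h4
        calc (Fintype.card F : ℝ) ^ (codim V + codim V * codim V)
            = ((Fintype.card F : ℝ) ^ codim V) ^ (1 + codim V) := by rw [← pow_mul]; congr 1; ring
          _ ≤ Real.exp y ^ (1 + codim V) := pow_le_pow_left₀ (by positivity) hqk _
          _ = Real.exp ((1 + codim V : ℕ) * y) := (Real.exp_nat_mul _ _).symm
          _ ≤ Real.exp n := by
              refine Real.exp_le_exp.2 ?_
              push_cast
              nlinarith)
  refine h.trans ?_
  have hn2 : (n : ℝ) ≤ 2 ^ n := by exact_mod_cast Nat.lt_two_pow_self.le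
  have hn3 : (n : ℝ) + 1 ≤ 2 ^ n := by exact_mod_cast Nat.lt_two_pow_self
  have he : Real.exp n = Real.exp 1 ^ n := by rw [← Real.exp_nat_mul, mul_one]
  have he2 : Real.exp (-n) = (Real.exp 1)⁻¹ ^ n := by rw [Real.exp_neg, he, inv_pow]
  calc ((n : ℝ) + 1) * n * Real.exp n * (1 / 2 ^ 8) ^ n
      ≤ 2 ^ n * 2 ^ n * Real.exp n * (1 / 2 ^ 8) ^ n := by gcongr
    _ = (2 * 2 * Real.exp 1 * (1 / 2 ^ 8)) ^ n := by rw [he, mul_pow, mul_pow, mul_pow]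
    _ ≤ (Real.exp 1)⁻¹ ^ n := by
        refine pow_le_pow_left₀ (by positivity) ?_ _
        rw [← one_div, le_div_iff₀ (Real.exp_pos _)]
        nlinarith [Real.exp_one_lt_d9, Real.exp_pos 1]
    _ = _ := he2.symm

theorem expect_unsaturated_le {μ : Fin n → Fin n → Measure F}
    (hμ : ∀ i j, IsProbabilityMeasure (μ i j)) {α : ℝ} (hα0 : 0 < α)
    (hα1 : α ≤ 1) (hα : ∀ i j, IsBalanced α (μ i j)) (hn : 0 < n) {m r : ℕ} (lam : Fin m → F)
    (hm : 1 ≤ m) {y η C : ℝ} (hη0 : 0 ≤ η) (hη1 : η ≤ 1 / 2)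
    (hη : 2 * η * (16 ^ 20 * 44) = 1) (hC : 16 ^ 20 * 44 < C)
    (hr : y + 1 ≤ α * η * r) (hmr : 2 * (m * r) ≤ n) (hyr : y * (m * r) ≤ n)
    (𝒱 : Finset (Submodule F (Fin n → F)))
    (h𝒱 : ∀ V ∈ 𝒱, ¬ IsSparse (C / α) V ∧ Real.exp (-y) < rho μ V ∧
      1 / (Fintype.card F : ℝ) ^ codim V < rho μ V) :
    expect (fun i => prodWeight (entryWeight μ i))
      (fun M => ind (rowInter lam (Matrix.of M) ∈ 𝒱)) ≤ Real.exp (-n) := by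
  classical
  have hw := isWeight_entryWeight hμ
  have hW : ∀ i, IsWeight (prodWeight (entryWeight μ i)) := fun i => isWeight_prodWeight (hw i)
  set z : Fin n → Fin n → F → ℝ := fun i j => lazyWeight η (entryWeight μ i j) with hz
  have hzw : ∀ i j, IsWeight (z i j) := fun i j => isWeight_lazyWeight hη0 (by linarith) (hw i j)
  have hαη : α * η ≤ 1 := by nlinarith
  -- The row whose lazy version dominates ρ(V) depends on `V`, so the family is split by that row.
  set 𝒱' : Fin n → Finset (Submodule F (Fin n → F)) := fun i =>
    𝒱.filter fun V => rho μ V ≤ 1 / 20000 * cosetProb (z i) 0 V with h𝒱'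
  have hone : ∀ i, expect (fun i => prodWeight (entryWeight μ i))
      (fun M => ind (rowInter lam (Matrix.of M) ∈ 𝒱' i)) ≤
        4 ^ n * (1 / 10000) ^ (n - m * r) * (1 / Real.exp (-y)) ^ (m * r) := by
    intro i
    -- Here ε = e^(-y) and δ = 1/10000: a row hits a coset with probability at most q^(-k) + ρ(V) ≤
    -- 2ρ(V) ≤ p/10000.
    refine expect_rowInter_mem_le_of_swap hw (hzw i) (β := α * η) (by positivity) hαη
      (fun j a => lazyWeight_le hη0 (by linarith) (hw i j)
        (isBalancedWeight_entryWeight hμ hα i j).apply_le a) lam hm (by omega) (Real.exp_pos _)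
      (by norm_num) (by norm_num) ?_ _ ?_
    · have h1 : 1 - α * η ≤ Real.exp (-(α * η)) := by
        linarith [Real.add_one_le_exp (-(α * η))]
      calc (1 - α * η) ^ r ≤ Real.exp (-(α * η)) ^ r :=
            pow_le_pow_left₀ (by linarith) h1 _
        _ = Real.exp (r * -(α * η)) := (Real.exp_nat_mul _ _).symm
        _ ≤ Real.exp (-y + -1) := Real.exp_le_exp.2 (by linarith)
        _ = Real.exp (-y) * (Real.exp 1)⁻¹ := by rw [Real.exp_add, Real.exp_neg 1]
        _ ≤ Real.exp (-y) * 2⁻¹ := by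
            refine mul_le_mul_of_nonneg_left ?_ (Real.exp_pos _).le
            exact inv_anti₀ (by norm_num) (by linarith [Real.exp_one_gt_d9])
        _ = _ := by ring
    · intro V hV
      obtain ⟨hV, hVi⟩ := Finset.mem_filter.1 hV
      obtain ⟨_, h2, h3⟩ := h𝒱 V hV
      have h0 := cosetProb_nonneg (hzw i) 0 V
      refine ⟨by linarith, fun i' x => ?_⟩
      have h4 := cosetProb_le_add_rho hμ V i' x
      linarith
  have hle : ∀ M : Fin n → Fin n → F, ind (rowInter lam (Matrix.of M) ∈ 𝒱) ≤
      ∑ i, ind (rowInter lam (Matrix.of M) ∈ 𝒱' i) := by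
    intro M
    refine (ind_mono fun hM => ?_).trans (ind_exists_le Finset.univ _)
    obtain ⟨i, hi⟩ := rho_le_cosetProb_lazyWeight hμ hα0 hα hn hη0 hη1 hη hC (h𝒱 _ hM).1
    exact ⟨i, Finset.mem_univ _, Finset.mem_filter.2 ⟨hM, hi⟩⟩
  refine (expect_mono hW hle).trans ?_
  rw [expect_sum]
  have hn2 : (n : ℝ) ≤ 2 ^ n := by exact_mod_cast Nat.lt_two_pow_self.le
  have he : Real.exp n = Real.exp 1 ^ n := by rw [← Real.exp_nat_mul, mul_one]
  have he2 : Real.exp (-n) = (Real.exp 1)⁻¹ ^ n := by rw [Real.exp_neg, he, inv_pow]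
  have hδ : (1 / 10000 : ℝ) ^ (n - m * r) ≤ (1 / 100) ^ n := by
    calc (1 / 10000 : ℝ) ^ (n - m * r) = (1 / 100) ^ (2 * (n - m * r)) := by
          rw [pow_mul]; norm_num
      _ ≤ _ := pow_le_pow_of_le_one (by norm_num) (by norm_num) (by omega)
  have hεb : (1 / Real.exp (-y)) ^ (m * r) ≤ Real.exp 1 ^ n := by
    rw [one_div, ← Real.exp_neg, neg_neg, ← Real.exp_nat_mul, ← he]
    refine Real.exp_le_exp.2 ?_
    push_cast; linarith
  calc _ ≤ ∑ _i : Fin n, (4 ^ n * (1 / 100) ^ n * Real.exp 1 ^ n : ℝ) := by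
        refine Finset.sum_le_sum fun i _ => (hone i).trans ?_
        gcongr
    _ = n * (4 ^ n * (1 / 100) ^ n * Real.exp 1 ^ n) := by simp
    _ ≤ 2 ^ n * (4 ^ n * (1 / 100) ^ n * Real.exp 1 ^ n) := by gcongr
    _ = (2 * (4 * (1 / 100) * Real.exp 1)) ^ n := by rw [mul_pow, mul_pow, mul_pow]
    _ ≤ (Real.exp 1)⁻¹ ^ n := by
        refine pow_le_pow_left₀ (by positivity) ?_ _
        rw [← one_div, le_div_iff₀ (Real.exp_pos _)]
        nlinarith [Real.exp_one_lt_d9, Real.exp_pos 1]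
    _ = _ := he2.symm

theorem expect_isSparse_rowInter_le {μ : Fin n → Fin n → Measure F}
    (hμ : ∀ i j, IsProbabilityMeasure (μ i j)) {α : ℝ} (hα0 : 0 < α) (hα1 : α ≤ 1)
    (hα : ∀ i j, IsBalanced α (μ i j)) (hn : 0 < n) {m : ℕ} (hm : 1 ≤ m) (lam : Fin m → F)
    {C c : ℝ} (hC : 0 < C) (hcC : c * (2 * C + 1) ≤ 1)
    (h1 : (m : ℝ) * 2 ^ m * Real.log n < c * α ^ 2 * n)
    (h2 : Real.log (Fintype.card F) < c * α ^ 2 * n / (m * 2 ^ m)) :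
    expect (fun i => prodWeight (entryWeight μ i))
      (fun M => ind (IsSparse (C / α) (rowInter lam (Matrix.of M)))) ≤
      3 * Real.exp (-(c * α * n / (m * 2 ^ m))) := by
  have hw := isWeight_entryWeight hμ
  have hW : ∀ i, IsWeight (prodWeight (entryWeight μ i)) := fun i => isWeight_prodWeight (hw i)
  have hm0 : (0 : ℝ) < m := by exact_mod_cast hm
  set N : ℝ := α * n / (m * 2 ^ m) with hN
  have hn0 : (0 : ℝ) < n := by exact_mod_cast hn
  have hN0 : 0 < N := by positivity
  have hB : ∀ v : Fin n → F, v ≠ 0 → expect (fun i => prodWeight (entryWeight μ i))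
      (fun M => ind (shiftProd (fun j => if h : j < m then lam ⟨j, h⟩ else 0) v
        (Matrix.of M) m = 0)) ≤ 3 * Real.exp (-N) := by
    intro v hv
    have h3 := expect_shiftProd_eq_zero_pow_le hw hα0.le hα1
      (fun i j => (isBalancedWeight_entryWeight hμ hα i j).apply_le) m
      (fun j => if h : j < m then lam ⟨j, h⟩ else 0) hv
    refine (pow_le_pow_iff_left₀ (expect_nonneg hW fun _ => ind_nonneg _) (by positivity)
      (pow_ne_zero m two_ne_zero)).1 (h3.trans ?_)
    -- Rounding n/m down loses at most one factor `1 - α`, paid for by e in the exponential bound.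
    have h4 : (1 - α) ^ (n / m) ≤ Real.exp 1 * Real.exp (-(α * n / m)) := by
      have h5 : 1 - α ≤ Real.exp (-α) := by linarith [Real.add_one_le_exp (-α)]
      have h6 : (n : ℝ) / m - 1 ≤ (n / m : ℕ) := by
        have : n < m * (n / m + 1) := Nat.lt_mul_div_succ n hm
        have h7 : (n : ℝ) ≤ m * ((n / m : ℕ) + 1) := by exact_mod_cast this.le
        rw [sub_le_iff_le_add, div_le_iff₀ hm0]
        linarith
      calc (1 - α) ^ (n / m) ≤ Real.exp (-α) ^ (n / m) :=
            pow_le_pow_left₀ (by linarith) h5 _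
        _ = Real.exp ((n / m : ℕ) * -α) := (Real.exp_nat_mul _ _).symm
        _ ≤ Real.exp (1 + -(α * n / m)) := by
            refine Real.exp_le_exp.2 ?_
            have : α * n / m = α * (n / m) := by ring
            rw [this]
            nlinarith
        _ = _ := Real.exp_add _ _
    have h8 : Real.exp (-N) ^ 2 ^ m = Real.exp (-(α * n / m)) := by
      rw [← Real.exp_nat_mul]
      congr 1
      rw [hN]
      push_cast
      field_simp
    -- This makes the prefactor at most 3 after the 2^m-th root.
    have h9 : (m : ℝ) * Real.exp 1 ≤ 3 ^ 2 ^ m := by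
      have h10 : m + 1 ≤ 2 ^ m := Nat.lt_two_pow_self
      calc (m : ℝ) * Real.exp 1 ≤ 3 ^ m * 3 := by
            have h11 : (m : ℝ) ≤ 3 ^ m := by
              exact_mod_cast (Nat.lt_pow_self (by norm_num)).le
            have := Real.exp_one_lt_d9
            gcongr
            linarith
        _ = 3 ^ (m + 1) := by ring
        _ ≤ _ := pow_le_pow_right₀ (by norm_num) h10
    calc (m : ℝ) * (1 - α) ^ (n / m) ≤ m * (Real.exp 1 * Real.exp (-(α * n / m))) := by gcongr
      _ = (m * Real.exp 1) * Real.exp (-(α * n / m)) := by ring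
      _ ≤ 3 ^ 2 ^ m * Real.exp (-(α * n / m)) :=
          mul_le_mul_of_nonneg_right h9 (Real.exp_pos _).le
      _ = (3 * Real.exp (-N)) ^ 2 ^ m := by rw [mul_pow, h8]
  refine (expect_isSparse_le hw lam hn _ (fun j => by simp) hB).trans ?_
  have hq0 : (0 : ℝ) < Fintype.card F := by exact_mod_cast Fintype.card_pos
  have hq1 : (1 : ℝ) ≤ Fintype.card F := by exact_mod_cast Fintype.card_pos
  have hn1 : (1 : ℝ) ≤ n := by exact_mod_cast hn
  have hcN : c * α ^ 2 * n / (m * 2 ^ m) = c * α * N := by rw [hN]; ring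
  rw [hcN] at h2
  have h1' : Real.log n < c * α * N := by
    rw [← hcN, lt_div_iff₀ (by positivity)]; linarith
  -- Both log n and log q are below cαN, and the number of sparse vectors has exponent at most C/α,
  -- so the α cancels; c(2C+1) ≤ 1 then leaves e^(-cN).
  have hpow : ((n : ℝ) * Fintype.card F) ^ ⌊C / α⌋₊ ≤ Real.exp (2 * C * c * N) := by
    have h12 : (n : ℝ) * Fintype.card F = Real.exp (Real.log n + Real.log (Fintype.card F)) := by
      rw [Real.exp_add, Real.exp_log hn0, Real.exp_log hq0]
    rw [h12, ← Real.exp_nat_mul]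
    refine Real.exp_le_exp.2 ?_
    have h13 : (⌊C / α⌋₊ : ℝ) ≤ C / α := Nat.floor_le (by positivity)
    have h14 : 0 ≤ Real.log n + Real.log (Fintype.card F) :=
      add_nonneg (Real.log_nonneg hn1) (Real.log_nonneg hq1)
    calc _ ≤ C / α * (2 * (c * α * N)) := by
          refine mul_le_mul h13 (by linarith) h14 (by positivity)
      _ = _ := by field_simp
  have hfin : c * α * n / (m * 2 ^ m) = c * N := by rw [hN]; ring
  rw [hfin]
  calc _ ≤ Real.exp (2 * C * c * N) * (3 * Real.exp (-N)) :=
        mul_le_mul_of_nonneg_right hpow (by positivity)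
    _ = 3 * Real.exp (2 * C * c * N + -N) := by rw [Real.exp_add]; ring
    _ ≤ _ := by
        gcongr
        nlinarith

end Estimates

/-! ### Choice of constants and conclusion. -/

theorem one_sub_le_of_balanced {F : Type*} [Field F] [Fintype F] [MeasurableSpace F]
    [MeasurableSingletonClass F] {n : ℕ} {μ : Fin n → Fin n → Measure F} {α : ℝ}
    (hμ : ∀ i j, IsProbabilityMeasure (μ i j)) (hα : ∀ i j, IsBalanced α (μ i j)) (hn : 0 < n) :
    α ≤ 1 := by
  have h1 := (isBalancedWeight_entryWeight hμ hα ⟨0, hn⟩ ⟨0, hn⟩).apply_le 0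
  have h2 := (isWeight_entryWeight hμ ⟨0, hn⟩ ⟨0, hn⟩).1 0
  linarith

/-- With X = αn/m and y = ζ√X, these are the inequalities on y needed later. The square y² = ζ²X is
controlled by the smallness of ζ, and linear terms in y by the largeness of X. -/
theorem scale_estimates {η ζ X : ℝ} (hη0 : 0 < η) (hη1 : η ≤ 1 / 2) (hζ1 : ζ ≤ 1)
    (hζη : ζ ^ 2 ≤ η / 2) (hX0 : 0 < X) (hXη : 16 ≤ η ^ 2 * X) :
    ζ * Real.sqrt X ≤ Real.sqrt X ∧ 4 * Real.sqrt X ≤ η * X ∧ η * X ≤ X ∧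
      ζ * Real.sqrt X * (ζ * Real.sqrt X + 2) ≤ η * X ∧
      2 * (ζ * Real.sqrt X + 2) ≤ η * X := by
  have hsq : Real.sqrt X * Real.sqrt X = X := Real.mul_self_sqrt hX0.le
  have hs0 : 0 ≤ Real.sqrt X := Real.sqrt_nonneg _
  have hsη : 4 ≤ η * Real.sqrt X := by
    refine (pow_le_pow_iff_left₀ (by norm_num) (by positivity) two_ne_zero).1 ?_
    rw [mul_pow, sq (Real.sqrt X), hsq]; linarith
  have hsX : 4 * Real.sqrt X ≤ η * X := by
    calc 4 * Real.sqrt X ≤ η * Real.sqrt X * Real.sqrt X := mul_le_mul_of_nonneg_right hsη hs0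
      _ = η * X := by rw [mul_assoc, hsq]
  have hys : ζ * Real.sqrt X ≤ Real.sqrt X := mul_le_of_le_one_left hs0 hζ1
  have hy2 : (ζ * Real.sqrt X) * (ζ * Real.sqrt X) ≤ η / 2 * X := by
    calc (ζ * Real.sqrt X) * (ζ * Real.sqrt X) = ζ ^ 2 * (Real.sqrt X * Real.sqrt X) := by ring
      _ ≤ η / 2 * X := by rw [hsq]; exact mul_le_mul_of_nonneg_right hζη hX0.le
  have h8 : 16 ≤ 1 / 2 * (η * X) := by
    calc (16 : ℝ) ≤ η ^ 2 * X := hXη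
      _ = η * (η * X) := by ring
      _ ≤ _ := mul_le_mul_of_nonneg_right hη1 (by positivity)
  refine ⟨hys, hsX, mul_le_of_le_one_left hX0.le (by linarith), ?_, ?_⟩
  · rw [mul_add]; linarith
  · linarith

theorem mainTheorem5 :
    ∃ ζ₀ : ℝ, 0 < ζ₀ ∧ ∀ ζ : ℝ, 0 < ζ → ζ ≤ ζ₀ → ∀ C : ℝ, 0 < C →
    ∃ c : ℝ, 0 < c ∧ ∀ α : ℝ, 0 < α → ∃ K : ℝ, 0 < K ∧
    ∀ (F : Type*) [Field F] [Fintype F] [MeasurableSpace F] [MeasurableSingletonClass F]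
      (n m : ℕ) (μ : Fin n → Fin n → Measure F) (lam : Fin m → F),
      (∀ i j, IsProbabilityMeasure (μ i j)) →
      (∀ i j, IsBalanced α (μ i j)) →
      Function.Injective lam →
      1 < m →
      (m : ℝ) * 2 ^ m * Real.log n < c * α ^ 2 * n →
      Real.log (Fintype.card F) < c * α ^ 2 * n / (m * 2 ^ m) →
      1 / Real.sqrt ζ ≤ Fintype.card F →
      1 - K * Real.exp (-(c * α * n / (m * 2 ^ m))) ≤
        (matrixLaw μ).real {M | IsSaturated ζ C α m μ (rowInter lam (Matrix.of M))} := by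
  refine ⟨1 / 2 ^ 50, by positivity, fun ζ hζ hζ1 C hC => ?_⟩
  obtain ⟨η, hηdef⟩ : ∃ η : ℝ, η = 1 / (88 * 16 ^ 20) := ⟨_, rfl⟩
  have hη0 : 0 < η := by positivity
  have hη1 : η ≤ 1 / 2 := by rw [hηdef]; norm_num
  have hη : 2 * η * (16 ^ 20 * 44) = 1 := by rw [hηdef]; norm_num
  have hζη : ζ ^ 2 ≤ η / 2 := by
    calc ζ ^ 2 ≤ (1 / 2 ^ 50) ^ 2 := pow_le_pow_left₀ hζ.le hζ1 2
      _ ≤ η / 2 := by rw [hηdef]; norm_num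
  -- The growth argument needs a threshold above 16^20 · 44; a subspace not sparse for the larger
  -- `C'` is not sparse for `C`.
  obtain ⟨C', hC'⟩ : ∃ C' : ℝ, C' = max C (16 ^ 20 * 45) := ⟨_, rfl⟩
  have hC'0 : 0 < C' := hC.trans_le (hC' ▸ le_max_left _ _)
  have hC'1 : 16 ^ 20 * 44 < C' := lt_of_lt_of_le (by norm_num) (hC' ▸ le_max_right _ _)
  -- The first bound turns cX ≥ 2 into η²X ≥ 16; the second serves the union bound over sparse
  -- vectors.
  obtain ⟨c, hc⟩ : ∃ c : ℝ, c = min (η ^ 2 / 8) (1 / (2 * C' + 1)) := ⟨_, rfl⟩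
  have hc0 : 0 < c := hc ▸ lt_min (by positivity) (by positivity)
  have hc1 : c ≤ η ^ 2 / 8 := hc ▸ min_le_left _ _
  have hc2 : c * (2 * C' + 1) ≤ 1 := by
    rw [← le_div_iff₀ (by positivity)]; exact hc ▸ min_le_right _ _
  -- 5 = 3 + 1 + 1, for the sparse, semisaturated and unsaturated events.
  refine ⟨c, hc0, fun α hα0 => ⟨5, by norm_num, ?_⟩⟩
  intro F _ _ _ _ n m μ lam hμ hα _ hm h1 h2 h3
  classical
  have hm0 : (0 : ℝ) < m := by exact_mod_cast (by omega : 0 < m)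
  have hq2 : (2 : ℝ) ≤ Fintype.card F := by exact_mod_cast Fintype.one_lt_card (α := F)
  have hlogq : 1 / 2 ≤ Real.log (Fintype.card F) :=
    (by linarith [Real.log_two_gt_d9] : (1 : ℝ) / 2 ≤ Real.log 2).trans
      (Real.log_le_log (by norm_num) hq2)
  -- As q ≥ 2, the upper bound on log q becomes an upper bound on m2^m; it forces n > 0 and makes X
  -- large.
  have hD : (m : ℝ) * 2 ^ m < 2 * (c * α ^ 2 * n) := by
    have := hlogq.trans_lt h2
    rw [lt_div_iff₀ (by positivity)] at this
    linarith
  have hn : 0 < n := by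
    rcases Nat.eq_zero_or_pos n with h | h
    · exfalso
      rw [h] at hD
      have : (0 : ℝ) < m * 2 ^ m := by positivity
      simp at hD
      linarith
    · exact h
  have hα1 : α ≤ 1 := one_sub_le_of_balanced hμ hα hn
  have hn0 : (0 : ℝ) < n := by exact_mod_cast hn
  obtain ⟨X, hX⟩ : ∃ X : ℝ, X = α * n / m := ⟨_, rfl⟩
  have hX0 : 0 < X := by rw [hX]; positivity
  have hmX : m * X = α * n := by rw [hX]; field_simp
  have h2m : (4 : ℝ) ≤ 2 ^ m := by
    calc (4 : ℝ) = 2 ^ 2 := by norm_num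
      _ ≤ 2 ^ m := pow_le_pow_right₀ (by norm_num) hm
  have hXc : 2 ≤ c * X := by
    have h4 : (m : ℝ) * 2 ^ m < 2 * c * (m * X) := by
      rw [hmX]
      refine hD.trans_le ?_
      have : α ^ 2 ≤ α := by nlinarith only [hα0, hα1]
      have : c * n * α ^ 2 ≤ c * n * α := mul_le_mul_of_nonneg_left this (by positivity)
      linarith
    have h5 : (2 : ℝ) ^ m < 2 * c * X := by
      refine lt_of_mul_lt_mul_left ?_ hm0.le
      linarith
    linarith
  have hXη : 16 ≤ η ^ 2 * X := by
    have := mul_le_mul_of_nonneg_right hc1 hX0.le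
    linarith
  have hs0 : 0 ≤ Real.sqrt X := Real.sqrt_nonneg _
  have hXn : X ≤ n := by
    rw [hX, div_le_iff₀ hm0]
    have : (1 : ℝ) ≤ m := by exact_mod_cast hm.le
    nlinarith only [this, hα1, hn0]
  obtain ⟨y, hy⟩ : ∃ y : ℝ, y = ζ * Real.sqrt X := ⟨_, rfl⟩
  have hy0 : 0 ≤ y := by rw [hy]; positivity
  obtain ⟨hys, hsX, hηX, hyA, hyB⟩ := scale_estimates hη0 hη1 (hζ1.trans (by norm_num))
    hζη hX0 hXη
  rw [← hy] at hys hyA hyB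
  have hqbig : 2 ^ 20 ≤ Fintype.card F := by
    have h5 : Real.sqrt ζ ≤ 1 / 2 ^ 25 := by
      rw [Real.sqrt_le_left (by positivity)]
      exact hζ1.trans (by norm_num)
    have h6 : (2 : ℝ) ^ 20 ≤ 1 / Real.sqrt ζ := by
      rw [le_div_iff₀ (Real.sqrt_pos.2 hζ)]
      calc (2 : ℝ) ^ 20 * Real.sqrt ζ ≤ 2 ^ 20 * (1 / 2 ^ 25) := by gcongr
        _ ≤ 1 := by norm_num
    exact_mod_cast h6.trans h3
  -- The least r with e^(-αηr) ≤ e^(-y-1), so that Odlyzko's bound for the lazy law falls below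
  -- e^(-y)/2.
  obtain ⟨r, hr⟩ : ∃ r : ℕ, r = ⌈(y + 1) / (α * η)⌉₊ := ⟨_, rfl⟩
  have hr1 : y + 1 ≤ α * η * r := by
    have := Nat.le_ceil ((y + 1) / (α * η))
    rw [← hr, div_le_iff₀ (by positivity)] at this
    linarith
  have hr2 : α * η * r ≤ y + 2 := by
    have h5 := (Nat.ceil_lt_add_one (show 0 ≤ (y + 1) / (α * η) by positivity)).le
    rw [← hr] at h5
    have h6 : (r : ℝ) * (α * η) ≤ ((y + 1) / (α * η) + 1) * (α * η) :=
      mul_le_mul_of_nonneg_right h5 (by positivity)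
    rw [add_mul, div_mul_cancel₀ _ (by positivity)] at h6
    have h7 : α * η ≤ 1 := mul_le_one₀ hα1 hη0.le (by linarith)
    linarith
  have hmr : ∀ t : ℝ, 0 ≤ t → t * (y + 2) ≤ η * X → t * (m * r) ≤ n := by
    intro t ht h5
    have h6 : t * (m * r) * (α * η) ≤ n * (α * η) := by
      calc t * (m * r) * (α * η) = m * (t * (α * η * r)) := by ring
        _ ≤ m * (t * (y + 2)) := by gcongr
        _ ≤ m * (η * X) := by gcongr
        _ = η * (m * X) := by ring
        _ = _ := by rw [hmX]; ring
    exact le_of_mul_le_mul_right h6 (by positivity)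
  set R : (Fin n → Fin n → F) → Submodule F (Fin n → F) := fun M => rowInter lam (Matrix.of M)
    with hRdef
  set 𝒱s : Finset (Submodule F (Fin n → F)) := Finset.univ.filter fun V =>
    Real.exp (-y) < rho μ V ∧ rho μ V ≤ 1 / (Fintype.card F : ℝ) ^ codim V with h𝒱s
  set 𝒱u : Finset (Submodule F (Fin n → F)) := Finset.univ.filter fun V =>
    ¬ IsSparse (C' / α) V ∧ Real.exp (-y) < rho μ V ∧
      1 / (Fintype.card F : ℝ) ^ codim V < rho μ V with h𝒱u
  have hsparse := expect_isSparse_rowInter_le hμ hα0 hα1 hα hn hm.le lam hC'0 hc2 h1 h2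
  have hsemi := expect_semisaturated_le hμ hα0 hα hn lam hy0 (by
    have h5 : y + y ^ 2 ≤ y * (y + 2) := by nlinarith only [hy0]
    linarith) (by
    have h5 : α / (2 * 16 ^ 20) * n = m * X / (2 * 16 ^ 20) := by rw [hmX]; ring
    rw [h5, le_div_iff₀ (by positivity)]
    have h6 : 8 * 16 ^ 20 * η ≤ 1 := by rw [hηdef]; norm_num
    have h7 : (1 : ℝ) ≤ m := by exact_mod_cast hm.le
    have h8 : 4 * y * (2 * 16 ^ 20) ≤ X := by
      refine le_of_mul_le_mul_left ?_ hη0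
      calc η * (4 * y * (2 * 16 ^ 20)) = (8 * 16 ^ 20 * η) * y := by ring
        _ ≤ y := mul_le_of_le_one_left hy0 h6
        _ ≤ η * X := by linarith
    exact h8.trans (le_mul_of_one_le_left hX0.le h7)) hqbig 𝒱s (fun V hV => (Finset.mem_filter.1 hV).2)
  have hunsat := expect_unsaturated_le hμ hα0 hα1 hα hn lam hm.le hη0.le hη1 hη hC'1 hr1
    (by exact_mod_cast hmr 2 (by norm_num) hyB) (hmr y hy0 hyA) 𝒱u
    (fun V hV => (Finset.mem_filter.1 hV).2)
  have hW : ∀ i, IsWeight (prodWeight (entryWeight μ i)) :=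
    fun i => isWeight_prodWeight (isWeight_entryWeight hμ i)
  have hcover : ∀ M, (1 : ℝ) ≤ ind (IsSaturated ζ C α m μ (R M)) +
      (ind (IsSparse (C' / α) (R M)) + (ind (R M ∈ 𝒱s) + ind (R M ∈ 𝒱u))) := by
    intro M
    rw [← ind_true (p := IsSaturated ζ C α m μ (R M) ∨ IsSparse (C' / α) (R M) ∨
      R M ∈ 𝒱s ∨ R M ∈ 𝒱u)]
    · refine (ind_or_le _ _).trans (add_le_add le_rfl ?_)
      exact (ind_or_le _ _).trans (add_le_add le_rfl (ind_or_le _ _))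
    · by_cases hsp : IsSparse (C' / α) (R M)
      · exact Or.inr (Or.inl hsp)
      by_cases hρ : rho μ (R M) ≤ Real.exp (-y)
      · refine Or.inl ⟨fun h => hsp (h.mono ?_), ?_⟩
        · exact div_le_div_of_nonneg_right (hC' ▸ le_max_left _ _) hα0.le
        · rwa [neg_mul, ← hX, ← hy]
      · push Not at hρ
        rcases le_or_gt (rho μ (R M)) (1 / (Fintype.card F : ℝ) ^ codim (R M)) with h | h
        · exact Or.inr (Or.inr (Or.inl (Finset.mem_filter.2 ⟨Finset.mem_univ _, hρ, h⟩)))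
        · exact Or.inr (Or.inr (Or.inr (Finset.mem_filter.2 ⟨Finset.mem_univ _, hsp, hρ, h⟩)))
  have htot := expect_mono hW hcover
  rw [expect_const hW, expect_add, expect_add, expect_add] at htot
  rw [matrixLaw_real_eq hμ]
  have hexp : Real.exp (-n) ≤ Real.exp (-(c * α * n / (m * 2 ^ m))) := by
    refine Real.exp_le_exp.2 (neg_le_neg ?_)
    rw [div_le_iff₀ (by positivity)]
    have h7 : (1 : ℝ) ≤ m := by exact_mod_cast hm.le
    have h8 : c ≤ 1 := by nlinarith only [hc1, hη0, hη1]
    calc c * α * n ≤ 1 * 1 * n := by gcongr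
      _ = n * 1 := by ring
      _ ≤ n * (m * 2 ^ m) := by
          gcongr
          exact one_le_mul_of_one_le_of_one_le h7 (by linarith)
  have hset : expect (fun i => prodWeight (entryWeight μ i))
      (fun M => ind (M ∈ {M : Fin n → Fin n → F | IsSaturated ζ C α m μ
        (rowInter lam (Matrix.of M))})) =
      expect (fun i => prodWeight (entryWeight μ i))
        (fun M => ind (IsSaturated ζ C α m μ (R M))) := rfl
  rw [hset]
  linarith
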